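/- Let $\mathrm{Top}$ be the site of topological spaces with open coverings. A prestack is a (not necessarily strict) 2-functor from $\mathrm{Top}^{op}$ to categories; it is a stack in topological spaces if all its values are groupoids and morphisms and objects satisfy descent for open coverings. Spaces are viewed as stacks via the Yoneda embedding. For a stack $X$, the loop stack $LX$ assigns to a space $T$ the category of pairs $(u,\phi)$ with $u\in X(T)$ and $\phi\in\mathrm{Aut}(u)$ (a morphism $(u,\phi)\to(u',\phi')$ is a morphism $\psi:u\to u'$ with $\psi\phi=\phi'\psi$). An atlas of $X$ is a map $a:A\to X$ from a space $A$ (i.e. an object of $X(A)$) that is representable, surjective and admits local sections: for every map $T\to X$ from a space, the fibre product $T\times_XA$ is (represented by) a space, and the projection $T\times_XA\to T$ is surjective and has a local section near each point of $T$. For an atlas, let $\mathcal A=(A\times_XA\rightrightarrows A)$ be the associated topological groupoid; an arrow $x\to y$ of it is an isomorphism $a_x\cong a_y$. For a topological groupoid $\mathcal G=(\mathcal G^1\rightrightarrows \mathcal G^0)$ with source $s$ and range $t$, let $\mathcal B\mathcal G$ be the stack of principal $\mathcal G$-bundles, that is, $\mathcal B\mathcal G(T)$ is the category of spaces $P\to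 T$ over $T$ with an anchor map $P\to\mathcal G^0$ and a fibrewise $\mathcal G$-action such that $P\to T$ has local sections and $P\times_{\mathcal G^0}\mathcal G^1\to P\times_TP$ is a homeomorphism. The loop (inertia) groupoid $L\mathcal G$ has as space of objects $\{\gamma\in\mathcal G^1 : s(\gamma)=t(\gamma)\}$ and as space of arrows $\{(\gamma,\mu) : \gamma\in (L\mathcal G)^0,\ \mu\in\mathcal G^1,\ s(\mu)=s(\gamma)\}$, where $(\gamma,\mu)$ is an arrow from $\gamma$ to $\mu\gamma\mu^{-1}$, and arrows are composed by multiplying the components $\mu$. **Lemma.** Let $X$ be a stack in topological spaces, let $a:A\to X$ be an atlas, and let $\mathcal A=(A\times_XA\rightrightarrows A)$ be the associated topological groupoid (formed with any space that represents $A\times_XA$). Then $LX$ and $\mathcal B L\mathcal A$ are stacks in topological spaces, and there is an equivalence of stacks $$e: LX\ \xrightarrow{\ \simeq\ }\ \mathcal B L\mathcal A .$$ It is natural in the following sense. Let $c:(L\mathcal A)^0\to LX$ be the canonical map, given by the pull-back of $a$ along $(L\mathcal A)^0\to A$ together with its tautological automorphism; over $(L\mathcal A)^1$ it carries the tautological 2-isomorphism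 between $c\circ s$ and $c\circ t$, given over $(\gamma,\mu)$ by $\mu$. Let $b:(L\mathcal A)^0\to\mathcal B L\mathcal A$ be the canonical map, given by the unit bundle $s:(L\mathcal A)^1\to(L\mathcal A)^0$, with its canonical 2-isomorphism between $b\circ s$ and $b\circ t$. Then $e\circ c$ and $b$ are 2-isomorphic, by a 2-isomorphism that is compatible with the given 2-isomorphisms over $(L\mathcal A)^1$. Thus the loop stack $LX$ is presented by the loop groupoid of $\mathcal A$. -/

import Mathlib

open CategoryTheory Opposite Bicategory
open scoped CategoryTheory.Pseudofunctor.StrongTrans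

universe u

namespace TopStack

/-! ### Prestacks and stacks on topological spaces -/

/-- A prestack on the site of topological spaces: a (not necessarily strict) 2-functor
`Topᵒᵖ ⥤ Cat`. -/
abbrev Prestack := LocallyDiscrete TopCat.{u}ᵒᵖ ⥤ᵖ Cat.{u, u + 1}

namespace Prestack

/-- The category `X(T)`. -/
abbrev fiber (X : Prestack.{u}) (T : TopCat.{u}) : Cat.{u, u + 1} := X.obj ⟨op T⟩

/-- The pull-back functor `f^* : X(T) ⥤ X(S)`. -/
abbrev pull (X : Prestack.{u}) {S T : TopCat.{u}} (f : S ⟶ T) : X.fiber T ⥤ X.fiber S :=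
  (X.map f.op.toLoc).toFunctor

/-- A stack in topological spaces: all `X(T)` are groupoids, and morphisms and objects satisfy
descent for open coverings. -/
structure IsStackInGroupoids (X : Prestack.{u}) : Prop where
  isGroupoid (T : TopCat.{u}) : IsGroupoid (X.fiber T)
  isStack : X.IsStack TopCat.grothendieckTopology.{u}

end Prestack

/-! ### The loop stack -/

/-- An object of the category of loops in `C`: an object of `C` with an automorphism, that is, a
functor from the category with one object and automorphism group `ℤ` to `C`. -/
structure LoopObj (C : Type (u + 1)) [Category.{u} C] where
  /-- the underlying object -/
  base : C
  /-- the automorphism -/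
  aut : base ≅ base

namespace LoopObj

variable {C : Type (u + 1)} [Category.{u} C]

/-- A morphism of loops: a morphism of underlying objects commuting with the automorphisms. -/
@[ext]
structure Hom (x y : LoopObj C) where
  /-- the underlying morphism -/
  hom : x.base ⟶ y.base
  comm : x.aut.hom ≫ hom = hom ≫ y.aut.hom

instance : Category (LoopObj C) where
  Hom := Hom
  id x := ⟨𝟙 _, by simp⟩
  comp f g := ⟨f.hom ≫ g.hom, by
    rw [← Category.assoc, f.comm, Category.assoc, g.comm, Category.assoc]⟩

@[ext]
lemma hom_ext {x y : LoopObj C} {f g : x ⟶ y} (h : f.hom = g.hom) : f = g := Hom.ext h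

@[simp] lemma id_hom (x : LoopObj C) : Hom.hom (𝟙 x) = 𝟙 x.base := rfl

@[simp] lemma comp_hom {x y z : LoopObj C} (f : x ⟶ y) (g : y ⟶ z) :
    (f ≫ g).hom = f.hom ≫ g.hom := rfl

/-- The functor induced on loops by a functor. -/
def map {D : Type (u + 1)} [Category.{u} D] (F : C ⥤ D) : LoopObj C ⥤ LoopObj D where
  obj x := ⟨F.obj x.base, F.mapIso x.aut⟩
  map f := ⟨F.map f.hom, by
    rw [Functor.mapIso_hom, Functor.mapIso_hom, ← F.map_comp, ← F.map_comp, f.comm]⟩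
  map_id x := by ext; exact F.map_id _
  map_comp f g := by ext; exact F.map_comp _ _

/-- The natural transformation induced on loops by a natural transformation. -/
def mapNat {D : Type (u + 1)} [Category.{u} D] {F G : C ⥤ D} (η : F ⟶ G) : map F ⟶ map G where
  app x := ⟨η.app x.base, η.naturality _⟩
  naturality x y f := by ext; exact η.naturality _

end LoopObj

/-- Taking loops, as a (strict) 2-functor `Cat ⥤ Cat`. -/
def loopFunctor : Cat.{u, u + 1} ⥤ᵖ Cat.{u, u + 1} where
  obj C := Cat.of (LoopObj C)
  map F := (LoopObj.map F.toFunctor).toCatHom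
  map₂ η := (LoopObj.mapNat η.toNatTrans).toCatHom₂
  mapId C := Iso.refl _
  mapComp F G := Iso.refl _
  map₂_id F := rfl
  map₂_comp F G := rfl
  map₂_whisker_left F _ _ η := by
    apply Cat.Hom₂.ext; apply NatTrans.ext; funext x; apply LoopObj.hom_ext
    exact ((Category.id_comp _).trans (Category.comp_id _)).symm
  map₂_whisker_right η F := by
    apply Cat.Hom₂.ext; apply NatTrans.ext; funext x; apply LoopObj.hom_ext
    exact ((Category.id_comp _).trans (Category.comp_id _)).symm
  map₂_associator F G H := by
    apply Cat.Hom₂.ext; apply NatTrans.ext; funext x; apply LoopObj.hom_ext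
    change 𝟙 _ = 𝟙 _ ≫ H.toFunctor.map (𝟙 _) ≫ 𝟙 _ ≫ 𝟙 _ ≫ 𝟙 _
    simp
  map₂_left_unitor F := by
    apply Cat.Hom₂.ext; apply NatTrans.ext; funext x; apply LoopObj.hom_ext
    change 𝟙 _ = 𝟙 _ ≫ F.toFunctor.map (𝟙 _) ≫ 𝟙 _
    simp
  map₂_right_unitor F := by
    apply Cat.Hom₂.ext; apply NatTrans.ext; funext x; apply LoopObj.hom_ext
    change 𝟙 _ = 𝟙 _ ≫ 𝟙 _ ≫ 𝟙 _
    simp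

/-- The loop (inertia) prestack: `(LX)(T)` is the category of pairs of an object of `X(T)` and an
automorphism of it. -/
def loopStack (X : Prestack.{u}) : Prestack.{u} := X.comp loopFunctor

/-! ### Topological groupoids -/

/-- A topological groupoid, that is, a groupoid object in topological spaces. Composition is written
in diagrammatic order: `comp (γ, δ)` is `γ` followed by `δ`. -/
structure TopGroupoid where
  /-- the space of objects -/
  Obj : TopCat.{u}
  /-- the space of arrows -/
  Arr : TopCat.{u}
  /-- the source map -/
  src : Arr ⟶ Obj
  /-- the range map -/
  tgt : Arr ⟶ Obj
  /-- the identity arrows -/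
  one : Obj ⟶ Arr
  /-- the inversion -/
  inv : Arr ⟶ Arr
  /-- the composition -/
  comp : TopCat.of {p : Arr × Arr // tgt p.1 = src p.2} ⟶ Arr
  src_one (x : Obj) : src (one x) = x
  tgt_one (x : Obj) : tgt (one x) = x
  src_inv (γ : Arr) : src (inv γ) = tgt γ
  tgt_inv (γ : Arr) : tgt (inv γ) = src γ
  src_comp (γ δ : Arr) (h : tgt γ = src δ) : src (comp ⟨(γ, δ), h⟩) = src γ
  tgt_comp (γ δ : Arr) (h : tgt γ = src δ) : tgt (comp ⟨(γ, δ), h⟩) = tgt δ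
  one_comp (γ : Arr) : comp ⟨(one (src γ), γ), tgt_one _⟩ = γ
  comp_one (γ : Arr) : comp ⟨(γ, one (tgt γ)), (src_one _).symm⟩ = γ
  inv_comp (γ : Arr) : comp ⟨(inv γ, γ), tgt_inv _⟩ = one (tgt γ)
  comp_inv (γ : Arr) : comp ⟨(γ, inv γ), (src_inv _).symm⟩ = one (src γ)
  assoc (γ δ κ : Arr) (h : tgt γ = src δ) (h' : tgt δ = src κ) :
    comp ⟨(comp ⟨(γ, δ), h⟩, κ), (tgt_comp γ δ h).trans h'⟩ =
      comp ⟨(γ, comp ⟨(δ, κ), h'⟩), h.trans (src_comp δ κ h').symm⟩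

namespace TopGroupoid

variable (G : TopGroupoid.{u})

/-- `γ` followed by `δ`. -/
def mul (γ δ : G.Arr) (h : G.tgt γ = G.src δ) : G.Arr := G.comp ⟨(γ, δ), h⟩

variable {G}

@[simp] lemma src_mul (γ δ : G.Arr) (h) : G.src (G.mul γ δ h) = G.src γ := G.src_comp _ _ _

@[simp] lemma tgt_mul (γ δ : G.Arr) (h) : G.tgt (G.mul γ δ h) = G.tgt δ := G.tgt_comp _ _ _

lemma one_mul (γ : G.Arr) (x : G.Obj) (h : G.tgt (G.one x) = G.src γ) :
    G.mul (G.one x) γ h = γ := by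
  obtain rfl : x = G.src γ := by rw [← h, G.tgt_one]
  exact G.one_comp γ

lemma mul_one (γ : G.Arr) (x : G.Obj) (h : G.tgt γ = G.src (G.one x)) :
    G.mul γ (G.one x) h = γ := by
  obtain rfl : x = G.tgt γ := by rw [h, G.src_one]
  exact G.comp_one γ

lemma inv_mul (γ : G.Arr) (h : G.tgt (G.inv γ) = G.src γ) :
    G.mul (G.inv γ) γ h = G.one (G.tgt γ) := G.inv_comp γ

lemma mul_inv (γ : G.Arr) (h : G.tgt γ = G.src (G.inv γ)) :
    G.mul γ (G.inv γ) h = G.one (G.src γ) := G.comp_inv γ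

lemma mul_assoc (γ δ κ : G.Arr) (h : G.tgt γ = G.src δ) (h' : G.tgt (G.mul γ δ h) = G.src κ) :
    G.mul (G.mul γ δ h) κ h' =
      G.mul γ (G.mul δ κ ((tgt_mul γ δ h).symm.trans h')) (h.trans (src_mul _ _ _).symm) :=
  G.assoc _ _ _ _ _

lemma inv_mul_cancel (γ δ : G.Arr) (h : G.tgt γ = G.src δ)
    (h' : G.tgt (G.inv γ) = G.src (G.mul γ δ h)) : G.mul (G.inv γ) (G.mul γ δ h) h' = δ := by
  have := mul_assoc (G.inv γ) γ δ (G.tgt_inv γ) ((tgt_mul _ _ _).trans h)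
  rw [← this]
  have e : ∀ (x : G.Arr) (hx : x = G.one (G.tgt γ)) (k), G.mul x δ k = δ := by
    rintro x rfl k; exact one_mul _ _ _
  exact e _ (inv_mul _ _) _

lemma mul_inv_cancel (γ δ : G.Arr) (h : G.tgt (G.inv γ) = G.src δ)
    (h' : G.tgt γ = G.src (G.mul (G.inv γ) δ h)) : G.mul γ (G.mul (G.inv γ) δ h) h' = δ := by
  have := mul_assoc γ (G.inv γ) δ (G.src_inv γ).symm ((tgt_mul _ _ _).trans h)
  rw [← this]
  have e : ∀ (x : G.Arr) (hx : x = G.one (G.src γ)) (k), G.mul x δ k = δ := by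
    rintro x rfl k; exact one_mul _ _ _
  exact e _ (mul_inv _ _) _

@[fun_prop]
lemma continuous_mul {Z : Type*} [TopologicalSpace Z] {f g : Z → G.Arr} (hf : Continuous f)
    (hg : Continuous g) (h : ∀ z, G.tgt (f z) = G.src (g z)) :
    Continuous fun z ↦ G.mul (f z) (g z) (h z) :=
  G.comp.hom.continuous.comp ((hf.prodMk hg).subtype_mk _)

/-- The conjugate `μ ∘ γ ∘ μ⁻¹` of a loop `γ` by an arrow `μ` starting where `γ` does. -/
def conj (γ μ : G.Arr) (h : G.src γ = G.tgt γ) (h' : G.src γ = G.src μ) : G.Arr :=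
  G.mul (G.mul (G.inv μ) γ (by rw [G.tgt_inv, h'])) μ (by rw [tgt_mul, ← h, h'])

@[simp] lemma src_conj (γ μ : G.Arr) (h) (h') : G.src (G.conj γ μ h h') = G.tgt μ := by
  rw [conj, src_mul, src_mul, G.src_inv]

@[simp] lemma tgt_conj (γ μ : G.Arr) (h) (h') : G.tgt (G.conj γ μ h h') = G.tgt μ := by
  rw [conj, tgt_mul]

lemma mul_conj (γ μ : G.Arr) (h) (h') (k) (k') :
    G.mul μ (G.conj γ μ h h') k = G.mul γ μ k' := by
  simp only [conj, mul_assoc]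
  exact mul_inv_cancel _ _ _ _

lemma eq_conj (γ μ ν : G.Arr) (h) (h') (k) (k') (e : G.mul μ ν k = G.mul γ μ k') :
    ν = G.conj γ μ h h' := by
  simp only [conj, mul_assoc]
  simp only [← e]
  exact (inv_mul_cancel _ _ _ _).symm

lemma mul_congr {γ γ' δ δ' : G.Arr} (e : γ = γ') (e' : δ = δ') (h : G.tgt γ = G.src δ) :
    G.mul γ δ h = G.mul γ' δ' (by rw [← e, ← e', h]) := by
  subst e e'; rfl

lemma conj_one (γ : G.Arr) (x : G.Obj) (h) (h') : G.conj γ (G.one x) h h' = γ :=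
  (eq_conj _ _ _ _ _ (by rw [G.tgt_one, h', G.src_one]) (by rw [← h, h']) (by
    rw [one_mul, mul_one])).symm

lemma conj_conj_inv (γ μ : G.Arr) (h) (h') (k) (k') :
    G.conj (G.conj γ μ h h') (G.inv μ) k k' = γ := by
  refine (eq_conj _ _ _ _ _ (by rw [G.tgt_inv, h']) (by rw [tgt_conj, G.src_inv]) ?_).symm
  simp only [conj, mul_assoc]
  exact mul_congr rfl
    ((mul_congr rfl (mul_inv _ (G.src_inv _).symm) _).trans (mul_one _ _ (by
      rw [G.src_one, ← h, h']))).symm _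

lemma conj_mul (γ μ ν : G.Arr) (h) (h') (k) (k') (l) (l') :
    G.conj γ (G.mul μ ν l) h l' = G.conj (G.conj γ μ h h') ν k k' := by
  refine (eq_conj _ _ _ _ _ (by rw [src_conj, tgt_mul]) (by rw [src_mul, ← h, h']) ?_).symm
  have e₁ := mul_conj (G.conj γ μ h h') ν k k' (by rw [src_conj]) (by rw [tgt_conj, l])
  have e₂ := mul_conj γ μ h h' (by rw [src_conj]) (by rw [← h, h'])
  rw [mul_assoc, mul_congr rfl e₁, ← mul_assoc _ _ _ (by rw [src_conj]) (by rw [tgt_mul, tgt_conj, l]),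
    mul_congr e₂ rfl, mul_assoc]

lemma continuous_conj {Z : Type*} [TopologicalSpace Z] {f g : Z → G.Arr} (hf : Continuous f)
    (hg : Continuous g) (h : ∀ z, G.src (f z) = G.tgt (f z))
    (h' : ∀ z, G.src (f z) = G.src (g z)) :
    Continuous fun z ↦ G.conj (f z) (g z) (h z) (h' z) :=
  continuous_mul (continuous_mul (G.inv.hom.continuous.comp hg) hf _) hg _

lemma conj_mul' (γ μ γ' ν : G.Arr) (h) (h') (e : G.conj γ μ h h' = γ') (k) (k') (l) (l') :
    G.conj γ (G.mul μ ν l) h l' = G.conj γ' ν k k' := by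
  subst e; exact conj_mul _ _ _ _ _ _ _ _ _

/-- The loop (inertia) groupoid `LG`: its objects are the arrows `γ` with equal source and range
(`LG⁰ = G⁰ ×_{G⁰ × G⁰} G¹`), its arrows are the pairs `(γ, μ)` of such a loop `γ` and an arrow `μ`
starting where `γ` does (`LG¹ = LG⁰ ×_{G⁰} G¹`); the source of `(γ, μ)` is `γ`, its range is the
conjugate loop `μ ∘ γ ∘ μ⁻¹`, and composition is that of the `μ`. -/
def loop (G : TopGroupoid.{u}) : TopGroupoid.{u} where
  Obj := TopCat.of {γ : G.Arr // G.src γ = G.tgt γ}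
  Arr := TopCat.of {p : {γ : G.Arr // G.src γ = G.tgt γ} × G.Arr // G.src p.1.1 = G.src p.2}
  src := TopCat.ofHom ⟨fun p ↦ p.1.1, continuous_fst.comp continuous_subtype_val⟩
  tgt := TopCat.ofHom ⟨fun p ↦ ⟨G.conj p.1.1.1 p.1.2 p.1.1.2 p.2,
      (src_conj _ _ p.1.1.2 p.2).trans (tgt_conj _ _ p.1.1.2 p.2).symm⟩,
    (continuous_conj (continuous_subtype_val.comp (continuous_fst.comp continuous_subtype_val))
      (continuous_snd.comp continuous_subtype_val) _ _).subtype_mk _⟩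
  one := TopCat.ofHom ⟨fun γ ↦ ⟨(γ, G.one (G.src γ.1)), (G.src_one _).symm⟩,
    (continuous_id.prodMk (G.one.hom.continuous.comp
      (G.src.hom.continuous.comp continuous_subtype_val))).subtype_mk _⟩
  inv := TopCat.ofHom ⟨fun p ↦ ⟨(⟨G.conj p.1.1.1 p.1.2 p.1.1.2 p.2,
      (src_conj _ _ p.1.1.2 p.2).trans (tgt_conj _ _ p.1.1.2 p.2).symm⟩, G.inv p.1.2),
      (src_conj _ _ p.1.1.2 p.2).trans (G.src_inv p.1.2).symm⟩,
    (((continuous_conj (continuous_subtype_val.comp (continuous_fst.comp continuous_subtype_val))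
      (continuous_snd.comp continuous_subtype_val) _ _).subtype_mk _).prodMk
        (G.inv.hom.continuous.comp (continuous_snd.comp continuous_subtype_val))).subtype_mk
          fun p ↦ (src_conj _ _ p.1.1.2 p.2).trans (G.src_inv p.1.2).symm⟩
  comp := TopCat.ofHom ⟨fun q ↦ ⟨(q.1.1.1.1, G.mul q.1.1.1.2 q.1.2.1.2
      ((src_conj _ _ q.1.1.1.1.2 q.1.1.2).symm.trans
        ((congrArg (fun γ ↦ G.src γ.1) q.2).trans q.1.2.2))),
      q.1.1.2.trans (src_mul _ _ _).symm⟩,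
    ((continuous_fst.comp (continuous_subtype_val.comp (continuous_fst.comp
      continuous_subtype_val))).prodMk (continuous_mul
        (continuous_snd.comp (continuous_subtype_val.comp (continuous_fst.comp
          continuous_subtype_val)))
        (continuous_snd.comp (continuous_subtype_val.comp (continuous_snd.comp
          continuous_subtype_val))) _)).subtype_mk _⟩
  src_one _ := rfl
  tgt_one γ := Subtype.ext (conj_one γ.1 (G.src γ.1) γ.2 (G.src_one _).symm)
  src_inv _ := rfl
  tgt_inv p := Subtype.ext (conj_conj_inv p.1.1.1 p.1.2 p.1.1.2 p.2
    ((src_conj _ _ p.1.1.2 p.2).trans (tgt_conj _ _ p.1.1.2 p.2).symm)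
    ((src_conj _ _ p.1.1.2 p.2).trans (G.src_inv p.1.2).symm))
  src_comp _ _ _ := rfl
  tgt_comp p q h := Subtype.ext (conj_mul' p.1.1.1 p.1.2 q.1.1.1 q.1.2 p.1.1.2 p.2
    (congrArg Subtype.val h) q.1.1.2 q.2
      ((src_conj _ _ p.1.1.2 p.2).symm.trans ((congrArg (fun γ ↦ G.src γ.1) h).trans q.2))
      (p.2.trans (src_mul _ _ _).symm))
  one_comp p := Subtype.ext (Prod.ext rfl
    (one_mul p.1.2 (G.src p.1.1.1) ((G.tgt_one _).trans p.2)))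
  comp_one p := Subtype.ext (Prod.ext rfl (mul_one p.1.2 (G.src (G.conj p.1.1.1 p.1.2 p.1.1.2 p.2))
      ((src_conj _ _ p.1.1.2 p.2).symm.trans (G.src_one _).symm)))
  inv_comp p := Subtype.ext (Prod.ext rfl ((inv_mul p.1.2 (G.tgt_inv _)).trans
    (congrArg G.one (src_conj _ _ p.1.1.2 p.2).symm)))
  comp_inv p := Subtype.ext (Prod.ext rfl ((mul_inv p.1.2 (G.src_inv _).symm).trans (congrArg G.one p.2.symm)))
  assoc p q r h h' := Subtype.ext (Prod.ext rfl (G.assoc _ _ _ _ _))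

end TopGroupoid

/-! ### The stack of principal bundles of a topological groupoid -/

/-- A principal bundle over the space `T` for the topological groupoid `G`: a space `total` over `T`
with an anchor map to `G⁰` and a fibrewise action of `G` along the anchor, such that
`total → T` has local sections and `G` acts freely and transitively on the fibres, in the
sense that `(p, γ) ↦ (p, γ p)` is a homeomorphism onto `total ×_T total`. -/
structure PrincipalBundle (G : TopGroupoid.{u}) (T : TopCat.{u}) where
  /-- the total space -/
  total : TopCat.{u}
  /-- the projection to the base -/
  proj : total ⟶ T
  /-- the anchor map -/
  anchor : total ⟶ G.Obj
  /-- the action: `act (p, γ)` is the result of acting by `γ` on `p` -/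
  act : TopCat.of {p : total × G.Arr // anchor p.1 = G.src p.2} ⟶ total
  proj_act (p : total) (γ : G.Arr) (h : anchor p = G.src γ) : proj (act ⟨(p, γ), h⟩) = proj p
  anchor_act (p : total) (γ : G.Arr) (h : anchor p = G.src γ) :
    anchor (act ⟨(p, γ), h⟩) = G.tgt γ
  act_one (p : total) : act ⟨(p, G.one (anchor p)), (G.src_one _).symm⟩ = p
  act_act (p : total) (γ δ : G.Arr) (h : anchor p = G.src γ) (h' : G.tgt γ = G.src δ) :
    act ⟨(act ⟨(p, γ), h⟩, δ), (anchor_act p γ h).trans h'⟩ =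
      act ⟨(p, G.comp ⟨(γ, δ), h'⟩), h.trans (G.src_comp γ δ h').symm⟩
  localSections (t : T) : ∃ U : TopologicalSpace.Opens T, t ∈ U ∧
    ∃ s : C(U, total), ∀ x : U, proj (s x) = x
  principal : IsHomeomorph
    (fun q : {p : total × G.Arr // anchor p.1 = G.src p.2} ↦
      (⟨(q.1.1, act q), (proj_act q.1.1 q.1.2 q.2).symm⟩ :
        {p : total × total // proj p.1 = proj p.2}))

namespace PrincipalBundle

variable {G : TopGroupoid.{u}} {T : TopCat.{u}}

/-- A morphism of principal bundles over `T`: an equivariant map over `T`. -/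
@[ext]
structure Hom (P Q : PrincipalBundle G T) where
  /-- the map of total spaces -/
  hom : P.total ⟶ Q.total
  proj_hom (p : P.total) : Q.proj (hom p) = P.proj p
  anchor_hom (p : P.total) : Q.anchor (hom p) = P.anchor p
  hom_act (p : P.total) (γ : G.Arr) (h : P.anchor p = G.src γ) :
    hom (P.act ⟨(p, γ), h⟩) = Q.act ⟨(hom p, γ), (anchor_hom p).trans h⟩

instance : Category (PrincipalBundle G T) where
  Hom := Hom
  id P := ⟨𝟙 _, fun _ ↦ rfl, fun _ ↦ rfl, fun _ _ _ ↦ rfl⟩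
  comp f g := ⟨f.hom ≫ g.hom,
    fun p ↦ (g.proj_hom (f.hom p)).trans (f.proj_hom p),
    fun p ↦ (g.anchor_hom (f.hom p)).trans (f.anchor_hom p),
    fun p γ h ↦ (congrArg g.hom (f.hom_act p γ h)).trans (g.hom_act _ _ _)⟩

lemma hom_ext {P Q : PrincipalBundle G T} {f g : P ⟶ Q} (h : ∀ p, f.hom p = g.hom p) : f = g := by
  apply Hom.ext; ext p; exact h p

/-- The unique arrow that takes `p` to a point `p'` of the same fibre. -/
noncomputable def div (P : PrincipalBundle G T) (p p' : P.total) (h : P.proj p = P.proj p') :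
    G.Arr := (P.principal.homeomorph.symm ⟨(p, p'), h⟩).1.2

section div

variable (P : PrincipalBundle G T) (p p' : P.total) (h : P.proj p = P.proj p')

lemma principal_symm_fst :
    (P.principal.homeomorph.symm ⟨(p, p'), h⟩).1.1 = p :=
  congrArg (fun z ↦ z.1.1) (P.principal.homeomorph.apply_symm_apply ⟨(p, p'), h⟩)

lemma anchor_eq_src_div : P.anchor p = G.src (P.div p p' h) :=
  (congrArg P.anchor (P.principal_symm_fst p p' h).symm).trans
    (P.principal.homeomorph.symm ⟨(p, p'), h⟩).2

lemma act_div : P.act ⟨(p, P.div p p' h), P.anchor_eq_src_div p p' h⟩ = p' := by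
  have : (⟨(p, P.div p p' h), P.anchor_eq_src_div p p' h⟩ :
      {p : P.total × G.Arr // P.anchor p.1 = G.src p.2}) =
      P.principal.homeomorph.symm ⟨(p, p'), h⟩ :=
    Subtype.ext (Prod.ext (P.principal_symm_fst p p' h).symm rfl)
  exact (congrArg P.act this).trans
    (congrArg (fun z ↦ z.1.2) (P.principal.homeomorph.apply_symm_apply ⟨(p, p'), h⟩))

lemma div_act (γ : G.Arr) (k : P.anchor p = G.src γ) :
    P.div p (P.act ⟨(p, γ), k⟩) (P.proj_act p γ k).symm = γ :=
  congrArg (fun z ↦ z.1.2) (P.principal.homeomorph.symm_apply_apply ⟨(p, γ), k⟩)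

variable {P} in
lemma continuous_div {Z : Type*} [TopologicalSpace Z] {f g : Z → P.total} (hf : Continuous f)
    (hg : Continuous g) (h : ∀ z, P.proj (f z) = P.proj (g z)) :
    Continuous fun z ↦ P.div (f z) (g z) (h z) :=
  continuous_snd.comp (continuous_subtype_val.comp
    (P.principal.homeomorph.symm.continuous.comp ((hf.prodMk hg).subtype_mk _)))

end div

/-- The pull-back `S ×_T P` of a principal bundle along `f : S ⟶ T`. -/
def pullback {S : TopCat.{u}} (f : S ⟶ T) (P : PrincipalBundle G T) : PrincipalBundle G S where
  total := TopCat.of {q : S × P.total // f q.1 = P.proj q.2}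
  proj := TopCat.ofHom ⟨fun q ↦ q.1.1, continuous_fst.comp continuous_subtype_val⟩
  anchor := TopCat.ofHom ⟨fun q ↦ P.anchor q.1.2,
    P.anchor.hom.continuous.comp (continuous_snd.comp continuous_subtype_val)⟩
  act := TopCat.ofHom ⟨fun q ↦ ⟨(q.1.1.1.1, P.act ⟨(q.1.1.1.2, q.1.2), q.2⟩),
      q.1.1.2.trans (P.proj_act _ _ _).symm⟩,
    ((continuous_fst.comp (continuous_subtype_val.comp (continuous_fst.comp
      continuous_subtype_val))).prodMk (P.act.hom.continuous.comp
        (((continuous_snd.comp (continuous_subtype_val.comp (continuous_fst.comp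
          continuous_subtype_val))).prodMk (continuous_snd.comp
            continuous_subtype_val)).subtype_mk _))).subtype_mk _⟩
  proj_act _ _ _ := rfl
  anchor_act p γ h := P.anchor_act _ _ _
  act_one p := Subtype.ext (Prod.ext rfl (P.act_one _))
  act_act p γ δ h h' := Subtype.ext (Prod.ext rfl (P.act_act _ _ _ _ _))
  localSections t := by
    obtain ⟨U, hU, s, hs⟩ := P.localSections (f t)
    refine ⟨⟨f ⁻¹' U, U.2.preimage f.hom.continuous⟩, hU,
      ⟨fun x ↦ ⟨(x.1, s ⟨f x.1, x.2⟩), (hs ⟨f x.1, x.2⟩).symm⟩, ?_⟩, fun x ↦ rfl⟩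
    exact (continuous_subtype_val.prodMk (s.continuous.comp
      ((f.hom.continuous.comp continuous_subtype_val).subtype_mk _))).subtype_mk _
  principal := isHomeomorph_iff_exists_homeomorph.2 ⟨{
    toFun := _
    invFun r := ⟨(r.1.1, P.div r.1.1.1.2 r.1.2.1.2
        (r.1.1.2.symm.trans ((congrArg f r.2).trans r.1.2.2))),
      P.anchor_eq_src_div r.1.1.1.2 r.1.2.1.2
        (r.1.1.2.symm.trans ((congrArg f r.2).trans r.1.2.2))⟩
    left_inv q := Subtype.ext (Prod.ext rfl (P.div_act q.1.1.1.2 q.1.2 q.2))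
    right_inv r := Subtype.ext (Prod.ext rfl (Subtype.ext (Prod.ext r.2
      (P.act_div r.1.1.1.2 r.1.2.1.2
        (r.1.1.2.symm.trans ((congrArg f r.2).trans r.1.2.2))))))
    continuous_toFun := ((continuous_fst.comp continuous_subtype_val).prodMk
      (ContinuousMap.continuous _)).subtype_mk _
    continuous_invFun := ((continuous_fst.comp continuous_subtype_val).prodMk
      (continuous_div
        (continuous_snd.comp (continuous_subtype_val.comp (continuous_fst.comp
          continuous_subtype_val)))
        (continuous_snd.comp (continuous_subtype_val.comp (continuous_snd.comp
          continuous_subtype_val))) _)).subtype_mk _ }, rfl⟩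

/-- The pull-back functor on principal bundles. -/
def pullbackFunctor {S : TopCat.{u}} (f : S ⟶ T) : PrincipalBundle G T ⥤ PrincipalBundle G S where
  obj P := pullback f P
  map {P Q} φ :=
    { hom := TopCat.ofHom ⟨fun q ↦ ⟨(q.1.1, φ.hom q.1.2), q.2.trans (φ.proj_hom _).symm⟩,
        ((continuous_fst.comp continuous_subtype_val).prodMk
          (φ.hom.hom.continuous.comp (continuous_snd.comp continuous_subtype_val))).subtype_mk _⟩
      proj_hom _ := rfl
      anchor_hom _ := φ.anchor_hom _
      hom_act p γ h := Subtype.ext (Prod.ext rfl (φ.hom_act _ _ _)) }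
  map_id _ := rfl
  map_comp _ _ := rfl

/-- `id^* P ≅ P`. -/
def pullbackId (T : TopCat.{u}) : pullbackFunctor (G := G) (𝟙 T) ≅ 𝟭 _ :=
  NatIso.ofComponents (fun P ↦
    { hom :=
        { hom := TopCat.ofHom ⟨fun q ↦ q.1.2, continuous_snd.comp continuous_subtype_val⟩
          proj_hom q := q.2.symm
          anchor_hom _ := rfl
          hom_act _ _ _ := rfl }
      inv :=
        { hom := TopCat.ofHom ⟨fun p ↦ ⟨(P.proj p, p), rfl⟩,
            (P.proj.hom.continuous.prodMk continuous_id).subtype_mk _⟩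
          proj_hom _ := rfl
          anchor_hom _ := rfl
          hom_act p γ h := Subtype.ext (Prod.ext (P.proj_act p γ h) rfl) }
      hom_inv_id := hom_ext fun q ↦ Subtype.ext (Prod.ext q.2.symm rfl)
      inv_hom_id := rfl }) (fun _ ↦ rfl)

/-- The projection `S ×_T P ⟶ P`. -/
def pullbackSnd {S : TopCat.{u}} (f : S ⟶ T) (P : PrincipalBundle G T) :
    (pullback f P).total ⟶ P.total :=
  TopCat.ofHom ⟨fun q ↦ q.1.2, continuous_snd.comp continuous_subtype_val⟩

/-- The isomorphism `(g ≫ f)^* P ≅ g^* f^* P` for a bundle `P`. -/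
def pullbackCompObj {R S T : TopCat.{u}} (f : S ⟶ T) (g : R ⟶ S) (P : PrincipalBundle G T) :
    pullback (g ≫ f) P ≅ pullback g (pullback f P) where
  hom :=
    { hom := TopCat.ofHom ⟨fun q ↦ ⟨(q.1.1, ⟨(g q.1.1, q.1.2), q.2⟩), rfl⟩,
        ((continuous_fst.comp continuous_subtype_val).prodMk
          (((g.hom.continuous.comp (continuous_fst.comp continuous_subtype_val)).prodMk
            (continuous_snd.comp continuous_subtype_val)).subtype_mk _)).subtype_mk _⟩
      proj_hom _ := rfl
      anchor_hom _ := rfl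
      hom_act _ _ _ := rfl }
  inv :=
    { hom := TopCat.ofHom (ContinuousMap.mk
        (fun q : (pullback g (pullback f P)).total ↦
          (⟨(q.1.1, q.1.2.1.2), (congrArg f q.2).trans q.1.2.2⟩ : (pullback (g ≫ f) P).total))
        (((pullback g (pullback f P)).proj.hom.continuous.prodMk
          ((pullbackSnd f P).hom.continuous.comp
            (pullbackSnd g (pullback f P)).hom.continuous)).subtype_mk _))
      proj_hom _ := rfl
      anchor_hom _ := rfl
      hom_act _ _ _ := rfl }
  hom_inv_id := rfl
  inv_hom_id := hom_ext fun q ↦ Subtype.ext (Prod.ext rfl (Subtype.ext (Prod.ext q.2 rfl)))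

/-- The natural isomorphism `(g ≫ f)^* ≅ g^* f^*`. -/
def pullbackComp {R S T : TopCat.{u}} (f : S ⟶ T) (g : R ⟶ S) :
    pullbackFunctor (G := G) (g ≫ f) ≅ pullbackFunctor f ⋙ pullbackFunctor g :=
  NatIso.ofComponents (fun P ↦ pullbackCompObj f g P) (fun _ ↦ rfl)

lemma eqToHom_hom {S T : TopCat.{u}} {f g : S ⟶ T} (h : f = g) (P : PrincipalBundle G T)
    (q : (pullback f P).total) :
    ((eqToHom (congrArg (fun k ↦ (pullbackFunctor (G := G) k).toCatHom) h)).toNatTrans.app P).hom q =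
      (⟨q.1, by rw [← h]; exact q.2⟩ : {q : S × P.total // g q.1 = P.proj q.2}) := by
  subst h; rfl

end PrincipalBundle

/-- The classifying stack `𝓑G` of a topological groupoid: `𝓑G(T)` is the category of principal
`G`-bundles over `T`. -/
def classifyingStack (G : TopGroupoid.{u}) : Prestack.{u} :=
  LocallyDiscrete.mkPseudofunctor
    (fun T ↦ Cat.of (PrincipalBundle G T.unop))
    (fun f ↦ (PrincipalBundle.pullbackFunctor f.unop).toCatHom)
    (fun T ↦ Cat.Hom.isoMk (PrincipalBundle.pullbackId T.unop))
    (fun f g ↦ Cat.Hom.isoMk (PrincipalBundle.pullbackComp f.unop g.unop))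
    (fun f g h ↦ by
      apply Cat.Hom₂.ext; apply NatTrans.ext; funext P; apply PrincipalBundle.hom_ext; intro q
      refine Eq.trans ?_ (PrincipalBundle.eqToHom_hom
        (f := ((f ≫ g) ≫ h).unop) (g := (f ≫ g ≫ h).unop) rfl P q).symm
      rfl)
    (fun f ↦ by
      apply Cat.Hom₂.ext; apply NatTrans.ext; funext P; apply PrincipalBundle.hom_ext; intro q
      refine Eq.trans ?_ (PrincipalBundle.eqToHom_hom
        (f := (𝟙 _ ≫ f).unop) (g := f.unop) rfl P q).symm
      exact Subtype.ext (Prod.ext rfl rfl))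
    (fun f ↦ by
      apply Cat.Hom₂.ext; apply NatTrans.ext; funext P; apply PrincipalBundle.hom_ext; intro q
      refine Eq.trans ?_ (PrincipalBundle.eqToHom_hom
        (f := (f ≫ 𝟙 _).unop) (g := f.unop) rfl P q).symm
      exact Subtype.ext (Prod.ext rfl rfl))

/-! ### Atlases and the associated groupoid -/

namespace Prestack

open Pseudofunctor.LocallyDiscreteOpToCat

variable (X : Prestack.{u})

variable {X} in
lemma pullHom_comp {T₁ T₂ T₃ S S' : TopCat.{u}} {u₁ : X.fiber T₁} {u₂ : X.fiber T₂}
    {u₃ : X.fiber T₃} {f₁ : S ⟶ T₁} {f₂ : S ⟶ T₂} {f₃ : S ⟶ T₃}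
    (φ : (X.pull f₁).obj u₁ ⟶ (X.pull f₂).obj u₂) (ψ : (X.pull f₂).obj u₂ ⟶ (X.pull f₃).obj u₃)
    (k : S' ⟶ S) (kf₁ : S' ⟶ T₁) (kf₂ : S' ⟶ T₂) (kf₃ : S' ⟶ T₃)
    (h₁ : k ≫ f₁ = kf₁) (h₂ : k ≫ f₂ = kf₂) (h₃ : k ≫ f₃ = kf₃) :
    pullHom φ k kf₁ kf₂ h₁ h₂ ≫ pullHom ψ k kf₂ kf₃ h₂ h₃ = pullHom (φ ≫ ψ) k kf₁ kf₃ h₁ h₃ := by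
  simp [pullHom]

variable {X} in
lemma pullHom_one {T S S' : TopCat.{u}} {x : X.fiber T} {f : S ⟶ T} (k : S' ⟶ S) (kf : S' ⟶ T)
    (h : k ≫ f = kf) :
    pullHom (𝟙 ((X.pull f).obj x)) k kf kf h h = 𝟙 ((X.pull kf).obj x) := by
  simp [pullHom]

variable {X} in
/-- The pull-back of an isomorphism `f₁^* u₁ ≅ f₂^* u₂` along `k`, as an isomorphism
`(k ≫ f₁)^* u₁ ≅ (k ≫ f₂)^* u₂`. -/
def pullIso {T₁ T₂ S S' : TopCat.{u}} {u₁ : X.fiber T₁} {u₂ : X.fiber T₂}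
    {f₁ : S ⟶ T₁} {f₂ : S ⟶ T₂}
    (φ : (X.pull f₁).obj u₁ ≅ (X.pull f₂).obj u₂)
    (k : S' ⟶ S) (kf₁ : S' ⟶ T₁) (kf₂ : S' ⟶ T₂) (h₁ : k ≫ f₁ = kf₁) (h₂ : k ≫ f₂ = kf₂) :
    (X.pull kf₁).obj u₁ ≅ (X.pull kf₂).obj u₂ where
  hom := pullHom φ.hom k kf₁ kf₂ h₁ h₂
  inv := pullHom φ.inv k kf₂ kf₁ h₂ h₁
  hom_inv_id := by rw [pullHom_comp, φ.hom_inv_id, pullHom_one]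
  inv_hom_id := by rw [pullHom_comp, φ.inv_hom_id, pullHom_one]

/-- An `S`-valued point of the fibre product `T ×_X A` of two maps from spaces `T` and `A` to `X`,
given (Yoneda) by objects `x` of `X(T)` and `a` of `X(A)`: maps `f : S ⟶ T` and `g : S ⟶ A` with a
2-isomorphism `f^* x ≅ g^* a`. -/
structure FiberProdPt {T A : TopCat.{u}} (x : X.fiber T) (a : X.fiber A) (S : TopCat.{u}) where
  /-- the map to `T` -/
  fst : S ⟶ T
  /-- the map to `A` -/
  snd : S ⟶ A
  /-- the 2-isomorphism -/
  iso : (X.pull fst).obj x ≅ (X.pull snd).obj a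

variable {X}

lemma FiberProdPt.ext' {T A : TopCat.{u}} {x : X.fiber T} {a : X.fiber A} {S : TopCat.{u}}
    {p q : FiberProdPt X x a S} (h₁ : p.fst = q.fst) (h₂ : p.snd = q.snd)
    (h : pullHom p.iso.hom (𝟙 S) q.fst q.snd (by simp [h₁]) (by simp [h₂]) = q.iso.hom) :
    p = q := by
  obtain ⟨f, g, i⟩ := p
  obtain ⟨f', g', i'⟩ := q
  dsimp at h₁ h₂
  subst h₁ h₂
  rw [pullHom_id] at h
  congr 1
  exact Iso.ext h

/-- Restriction of points of `T ×_X A` along `k : S' ⟶ S`. -/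
def FiberProdPt.restrict {T A S S' : TopCat.{u}} {x : X.fiber T} {a : X.fiber A}
    (p : FiberProdPt X x a S) (k : S' ⟶ S) : FiberProdPt X x a S' :=
  ⟨k ≫ p.fst, k ≫ p.snd, pullIso p.iso k _ _ rfl rfl⟩

lemma FiberProdPt.restrict_id {T A S : TopCat.{u}} {x : X.fiber T} {a : X.fiber A}
    (p : FiberProdPt X x a S) : p.restrict (𝟙 S) = p := by
  refine FiberProdPt.ext' (Category.id_comp _) (Category.id_comp _) ?_
  refine (pullHom_pullHom p.iso.hom (𝟙 S) (𝟙 S ≫ p.fst) (𝟙 S ≫ p.snd) (𝟙 S) p.fst p.snd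
    rfl rfl (by simp) (by simp)).trans ?_
  simp

lemma FiberProdPt.restrict_restrict {T A S S' S'' : TopCat.{u}} {x : X.fiber T} {a : X.fiber A}
    (p : FiberProdPt X x a S) (k : S' ⟶ S) (l : S'' ⟶ S') :
    (p.restrict k).restrict l = p.restrict (l ≫ k) := by
  refine FiberProdPt.ext' (Category.assoc _ _ _).symm (Category.assoc _ _ _).symm ?_
  have e := pullHom_pullHom p.iso.hom k (k ≫ p.fst) (k ≫ p.snd) l (l ≫ k ≫ p.fst)
    (l ≫ k ≫ p.snd)
  refine (congrArg (fun z ↦ pullHom z (𝟙 S'') ((l ≫ k) ≫ p.fst) ((l ≫ k) ≫ p.snd)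
    (by simp) (by simp)) e).trans ?_
  refine (pullHom_pullHom p.iso.hom (l ≫ k) (l ≫ k ≫ p.fst) (l ≫ k ≫ p.snd) (𝟙 S'') _ _
    (by simp) (by simp) (by simp) (by simp)).trans ?_
  simp only [Category.id_comp]
  rfl

variable (X)

/-- The fibre product `T ×_X A` of two maps from spaces to a stack, as a presheaf of sets on spaces
(it has no non-trivial automorphisms). -/
def fiberProd {T A : TopCat.{u}} (x : X.fiber T) (a : X.fiber A) : TopCat.{u}ᵒᵖ ⥤ Type u where
  obj S := FiberProdPt X x a S.unop
  map k := ↾fun p ↦ p.restrict k.unop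
  map_id S := by
    ext p
    exact FiberProdPt.restrict_id (S := S.unop) p
  map_comp {S _ _} k l := by
    ext p
    exact (FiberProdPt.restrict_restrict (S := S.unop) p k.unop l.unop).symm

variable {X}

/-- The projection to `T` of a space representing `T ×_X A`. -/
def fiberProdProj {T A P : TopCat.{u}} {x : X.fiber T} {a : X.fiber A}
    (r : (X.fiberProd x a).RepresentableBy P) : P ⟶ T :=
  FiberProdPt.fst (r.homEquiv (𝟙 P))

/-- The map `A → X` given by the object `a` of `X(A)` is an atlas: it is representable, surjective
and admits local sections, i.e. for every map `x : T → X` from a space, the fibre product `T ×_X A`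
is a space and its projection to `T` is surjective and admits local sections. -/
structure IsAtlas {A : TopCat.{u}} (a : X.fiber A) : Prop where
  representable (T : TopCat.{u}) (x : X.fiber T) : (X.fiberProd x a).IsRepresentable
  surjective (T : TopCat.{u}) (x : X.fiber T) (P : TopCat.{u})
    (r : (X.fiberProd x a).RepresentableBy P) : Function.Surjective (fiberProdProj r)
  localSections (T : TopCat.{u}) (x : X.fiber T) (P : TopCat.{u})
    (r : (X.fiberProd x a).RepresentableBy P) (t : T) :
    ∃ U : TopologicalSpace.Opens T, t ∈ U ∧ ∃ s : C(U, P), ∀ y : U, fiberProdProj r (s y) = y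

variable {A : TopCat.{u}} {a : X.fiber A}

namespace FiberProdPt

variable {S S' : TopCat.{u}}

/-- The identity arrow at a point `g : S ⟶ A`. -/
def refl (a : X.fiber A) (g : S ⟶ A) : FiberProdPt X a a S := ⟨g, g, Iso.refl _⟩

/-- The inverse arrow. -/
def symm (p : FiberProdPt X a a S) : FiberProdPt X a a S := ⟨p.snd, p.fst, p.iso.symm⟩

/-- The composite arrow, `p` followed by `q`. -/
def trans (p q : FiberProdPt X a a S) (h : p.snd = q.fst) : FiberProdPt X a a S :=
  ⟨p.fst, q.snd, p.iso ≪≫ eqToIso (by rw [h]) ≪≫ q.iso⟩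

lemma restrict_refl (g : S ⟶ A) (k : S' ⟶ S) : (refl a g).restrict k = refl a (k ≫ g) := by
  refine ext' rfl rfl ?_
  refine (pullHom_id _).trans ?_
  exact pullHom_one k (k ≫ g) rfl

lemma restrict_symm (p : FiberProdPt X a a S) (k : S' ⟶ S) :
    p.symm.restrict k = (p.restrict k).symm := by
  refine ext' rfl rfl ?_
  exact pullHom_id _

lemma restrict_trans (p q : FiberProdPt X a a S) (h : p.snd = q.fst) (k : S' ⟶ S) :
    (p.trans q h).restrict k =
      (p.restrict k).trans (q.restrict k) (congrArg (fun z ↦ k ≫ z) h) := by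
  obtain ⟨f, g, i⟩ := p
  obtain ⟨g', f', j⟩ := q
  dsimp at h
  subst h
  refine ext' rfl rfl ?_
  refine (pullHom_id _).trans ?_
  simp [restrict, trans, pullIso, pullHom_comp]
  rfl

lemma refl_trans (p : FiberProdPt X a a S) (g : S ⟶ A) (h : g = p.fst) :
    (refl a g).trans p h = p := by
  subst h
  refine ext' rfl rfl ((pullHom_id _).trans ?_)
  simp [refl, trans]

lemma trans_refl (p : FiberProdPt X a a S) (g : S ⟶ A) (h : p.snd = g) :
    p.trans (refl a g) h = p := by
  subst h
  refine ext' rfl rfl ((pullHom_id _).trans ?_)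
  simp [refl, trans]

lemma symm_trans (p : FiberProdPt X a a S) : p.symm.trans p rfl = refl a p.snd := by
  refine ext' rfl rfl ((pullHom_id _).trans ?_)
  simp [refl, trans, symm]

lemma trans_symm (p : FiberProdPt X a a S) : p.trans p.symm rfl = refl a p.fst := by
  refine ext' rfl rfl ((pullHom_id _).trans ?_)
  simp [refl, trans, symm]

lemma trans_assoc (p q r : FiberProdPt X a a S) (h : p.snd = q.fst) (h' : q.snd = r.fst) :
    (p.trans q h).trans r h' = p.trans (q.trans r h') h := by
  refine ext' rfl rfl ((pullHom_id _).trans ?_)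
  simp [trans]

lemma trans_congr {p p' q q' : FiberProdPt X a a S} (e : p = p') (e' : q = q')
    (h : p.snd = q.fst) : p.trans q h = p'.trans q' (by rw [← e, ← e', h]) := by
  subst e e'; rfl

end FiberProdPt

variable {R : TopCat.{u}} (r : (X.fiberProd a a).RepresentableBy R)

/-- The universal point of `A ×_X A` over the representing space `R`. -/
def univPt : FiberProdPt X a a R := r.homEquiv (𝟙 R)

/-- The map to the representing space given by a point of `A ×_X A`. -/
def lift {S : TopCat.{u}} (p : FiberProdPt X a a S) : S ⟶ R := r.homEquiv.symm p

lemma restrict_lift {S : TopCat.{u}} (p : FiberProdPt X a a S) :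
    (univPt r).restrict (lift r p) = p :=
  (r.homEquiv_comp (lift r p) (𝟙 R)).symm.trans
    ((congrArg r.homEquiv (Category.comp_id _)).trans (r.homEquiv.apply_symm_apply p))

lemma hom_ext_of_restrict {S : TopCat.{u}} {k l : S ⟶ R}
    (h : (univPt r).restrict k = (univPt r).restrict l) : k = l := by
  apply r.homEquiv.injective
  have e : ∀ k : S ⟶ R, r.homEquiv k = (univPt r).restrict k := fun k ↦
    (congrArg r.homEquiv (Category.comp_id _)).symm.trans (r.homEquiv_comp k (𝟙 R))
  rw [e, e, h]

lemma lift_src {S : TopCat.{u}} (p : FiberProdPt X a a S) : lift r p ≫ (univPt r).fst = p.fst :=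
  congrArg FiberProdPt.fst (restrict_lift r p)

lemma lift_tgt {S : TopCat.{u}} (p : FiberProdPt X a a S) : lift r p ≫ (univPt r).snd = p.snd :=
  congrArg FiberProdPt.snd (restrict_lift r p)

/-- The space of composable pairs of points of `A ×_X A`. -/
abbrev CompSpace : TopCat.{u} :=
  TopCat.of {p : R × R // (univPt r).snd p.1 = (univPt r).fst p.2}

/-- The first of a composable pair. -/
def compFst : CompSpace r ⟶ R :=
  TopCat.ofHom ⟨fun p ↦ p.1.1, continuous_fst.comp continuous_subtype_val⟩

/-- The second of a composable pair. -/
def compSnd : CompSpace r ⟶ R :=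
  TopCat.ofHom ⟨fun p ↦ p.1.2, continuous_snd.comp continuous_subtype_val⟩

lemma compFst_snd : compFst r ≫ (univPt r).snd = compSnd r ≫ (univPt r).fst := by
  ext p; exact p.2

/-- The composite of the universal composable pair. -/
def compPt : FiberProdPt X a a (CompSpace r) :=
  ((univPt r).restrict (compFst r)).trans ((univPt r).restrict (compSnd r)) (compFst_snd r)

/-- A point of a space as a map from the one-point space. -/
def pointMap {Z : TopCat.{u}} (z : Z) : TopCat.of PUnit.{u + 1} ⟶ Z :=
  TopCat.ofHom (ContinuousMap.const _ z)

/-- The arrow `a_x ≅ a_y` in `X(pt)` given by a point of the representing space. -/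
def arrowAt (z : R) : FiberProdPt X a a (TopCat.of PUnit.{u + 1}) :=
  (univPt r).restrict (pointMap z)

lemma arrowAt_injective {z w : R} (h : arrowAt r z = arrowAt r w) : z = w :=
  congrArg (fun k ↦ k PUnit.unit) (hom_ext_of_restrict r h)

lemma arrowAt_lift {S : TopCat.{u}} (p : FiberProdPt X a a S) (s : S) :
    arrowAt r (lift r p s) = p.restrict (pointMap s) := by
  refine Eq.trans ?_ (congrArg (fun q ↦ FiberProdPt.restrict q (pointMap s)) (restrict_lift r p))
  rw [FiberProdPt.restrict_restrict]
  rfl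

lemma arrowAt_one (x : A) :
    arrowAt r (lift r (FiberProdPt.refl a (𝟙 A)) x) = FiberProdPt.refl a (pointMap x) := by
  rw [arrowAt_lift, FiberProdPt.restrict_refl]
  rfl

lemma arrowAt_inv (z : R) :
    arrowAt r (lift r (univPt r).symm z) = (arrowAt r z).symm := by
  rw [arrowAt_lift, FiberProdPt.restrict_symm]
  rfl

lemma arrowAt_comp (z w : R) (h : (univPt r).snd z = (univPt r).fst w) :
    arrowAt r (lift r (compPt r) ⟨(z, w), h⟩) =
      (arrowAt r z).trans (arrowAt r w) (congrArg pointMap h) := by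
  exact (arrowAt_lift r (compPt r) ⟨(z, w), h⟩).trans
    ((FiberProdPt.restrict_trans _ _ (compFst_snd r) _).trans
      (FiberProdPt.trans_congr (FiberProdPt.restrict_restrict _ _ _)
        (FiberProdPt.restrict_restrict _ _ _) _))

/-- The topological groupoid `A ×_X A ⇉ A` associated with `a : A → X`, on a space `R` that
represents `A ×_X A`. An arrow from `x` to `y` is an isomorphism `a_x ≅ a_y`. -/
def atlasGroupoid : TopGroupoid.{u} where
  Obj := A
  Arr := R
  src := (univPt r).fst
  tgt := (univPt r).snd
  one := lift r (FiberProdPt.refl a (𝟙 A))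
  inv := lift r (univPt r).symm
  comp := lift r (compPt r)
  src_one x := congrArg (fun k ↦ k x) (lift_src r (FiberProdPt.refl a (𝟙 A)))
  tgt_one x := congrArg (fun k ↦ k x) (lift_tgt r (FiberProdPt.refl a (𝟙 A)))
  src_inv z := congrArg (fun k ↦ k z) (lift_src r (univPt r).symm)
  tgt_inv z := congrArg (fun k ↦ k z) (lift_tgt r (univPt r).symm)
  src_comp z w h := congrArg (fun k ↦ k ⟨(z, w), h⟩) (lift_src r (compPt r))
  tgt_comp z w h := congrArg (fun k ↦ k ⟨(z, w), h⟩) (lift_tgt r (compPt r))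
  one_comp z := arrowAt_injective r ((arrowAt_comp r _ _ _).trans
    ((FiberProdPt.trans_congr (arrowAt_one r _) rfl _).trans (FiberProdPt.refl_trans (arrowAt r z) (pointMap ((univPt r).fst z)) rfl)))
  comp_one z := arrowAt_injective r ((arrowAt_comp r _ _ _).trans
    ((FiberProdPt.trans_congr rfl (arrowAt_one r _) _).trans (FiberProdPt.trans_refl (arrowAt r z) (pointMap ((univPt r).snd z)) rfl)))
  inv_comp z := arrowAt_injective r ((arrowAt_comp r _ _ _).trans
    ((FiberProdPt.trans_congr (arrowAt_inv r z) rfl _).trans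
      ((FiberProdPt.symm_trans _).trans (arrowAt_one r ((univPt r).snd z)).symm)))
  comp_inv z := arrowAt_injective r ((arrowAt_comp r _ _ _).trans
    ((FiberProdPt.trans_congr rfl (arrowAt_inv r z) _).trans
      ((FiberProdPt.trans_symm _).trans (arrowAt_one r ((univPt r).fst z)).symm)))
  assoc z w v h h' := arrowAt_injective r ((arrowAt_comp r _ _ _).trans
    ((FiberProdPt.trans_congr (arrowAt_comp r z w h) rfl _).trans
      ((FiberProdPt.trans_assoc _ _ _ (congrArg pointMap h) (congrArg pointMap h')).trans
        ((FiberProdPt.trans_congr rfl (arrowAt_comp r w v h').symm _).trans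
          (arrowAt_comp r _ _ _).symm))))

end Prestack

/-! ### Presentations and their comparison -/

/-- A map `G⁰ → Y` from the space of objects of a topological groupoid to a prestack, together with
a 2-morphism over `G¹` between its composites with source and range: an object `obj` of `Y(G⁰)` and
a morphism `s^* obj ⟶ t^* obj` in `Y(G¹)`. -/
structure GroupoidMap (G : TopGroupoid.{u}) (Y : Prestack.{u}) where
  /-- the object over `G⁰` -/
  obj : Y.fiber G.Obj
  /-- the 2-morphism over `G¹` -/
  glue : (Y.pull G.src).obj obj ⟶ (Y.pull G.tgt).obj obj

namespace GroupoidMap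

variable {G : TopGroupoid.{u}} {Y Z : Prestack.{u}}

/-- Composition of `G⁰ → Y` and its 2-morphism with a morphism of prestacks `e : Y → Z`. -/
def push (D : GroupoidMap G Y) (e : Y ⟶ Z) : GroupoidMap G Z where
  obj := (e.app ⟨op G.Obj⟩).toFunctor.obj D.obj
  glue := (e.naturality G.src.op.toLoc).inv.toNatTrans.app D.obj ≫
    (e.app ⟨op G.Arr⟩).toFunctor.map D.glue ≫
      (e.naturality G.tgt.op.toLoc).hom.toNatTrans.app D.obj

/-- Two maps `G⁰ → Y` are 2-isomorphic, compatibly with the 2-morphisms over `G¹`. -/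
def IsIsomorphic (D E : GroupoidMap G Y) : Prop :=
  ∃ κ : D.obj ≅ E.obj,
    D.glue ≫ (Y.pull G.tgt).map κ.hom = (Y.pull G.src).map κ.hom ≫ E.glue

end GroupoidMap

namespace TopGroupoid

variable (G : TopGroupoid.{u})

/-- The unit principal bundle `s : G¹ → G⁰`, with `G` acting by composition. -/
def unitBundle : PrincipalBundle G G.Obj where
  total := G.Arr
  proj := G.src
  anchor := G.tgt
  act := G.comp
  proj_act := G.src_comp
  anchor_act := G.tgt_comp
  act_one := G.comp_one
  act_act p γ δ h h' := G.assoc p γ δ h h'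
  localSections t := ⟨⊤, trivial, ⟨fun x ↦ G.one x.1,
    G.one.hom.continuous.comp continuous_subtype_val⟩, fun x ↦ G.src_one x.1⟩
  principal := isHomeomorph_iff_exists_homeomorph.2 ⟨{
    toFun := _
    invFun q := ⟨(q.1.1, G.mul (G.inv q.1.1) q.1.2 ((G.tgt_inv _).trans q.2)),
      (G.src_inv _).symm.trans (src_mul _ _ _).symm⟩
    left_inv q := Subtype.ext (Prod.ext rfl (inv_mul_cancel q.1.1 q.1.2 q.2 _))
    right_inv q := Subtype.ext (Prod.ext rfl (mul_inv_cancel q.1.1 q.1.2 _ _))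
    continuous_toFun := ((continuous_fst.comp continuous_subtype_val).prodMk
      (ContinuousMap.continuous _)).subtype_mk _
    continuous_invFun := ((continuous_fst.comp continuous_subtype_val).prodMk
      (continuous_mul (G.inv.hom.continuous.comp (continuous_fst.comp continuous_subtype_val))
        (continuous_snd.comp continuous_subtype_val) _)).subtype_mk _ }, rfl⟩

/-- The canonical isomorphism `s^* G¹ → t^* G¹` of principal bundles over `G¹`: over an arrow
`l : x → y`, it is the map `m ↦ m ∘ l⁻¹` from the arrows starting at `x` to those starting at `y`. -/
def unitGlue : PrincipalBundle.pullback G.src G.unitBundle ⟶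
    PrincipalBundle.pullback G.tgt G.unitBundle where
  hom := TopCat.ofHom (ContinuousMap.mk
    (fun q : {q : G.Arr × G.Arr // G.src q.1 = G.src q.2} ↦
      (⟨(q.1.1, G.mul (G.inv q.1.1) q.1.2 ((G.tgt_inv _).trans q.2)),
        (G.src_inv _).symm.trans (src_mul _ _ _).symm⟩ :
          {q : G.Arr × G.Arr // G.tgt q.1 = G.src q.2}))
    (((continuous_fst.comp continuous_subtype_val).prodMk
      (continuous_mul (G.inv.hom.continuous.comp (continuous_fst.comp continuous_subtype_val))
        (continuous_snd.comp continuous_subtype_val) _)).subtype_mk _))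
  proj_hom _ := rfl
  anchor_hom q := tgt_mul _ _ _
  hom_act q γ h := Subtype.ext (Prod.ext rfl
    (mul_assoc (G.inv q.1.1) q.1.2 γ ((G.tgt_inv _).trans q.2) ((tgt_mul _ _ _).trans h)).symm)

/-- The canonical map `G⁰ → 𝓑G`, given by the unit bundle, with its canonical 2-isomorphism over
`G¹`. -/
def unitMap : GroupoidMap G (classifyingStack G) where
  obj := G.unitBundle
  glue := G.unitGlue

end TopGroupoid

namespace Prestack

open Pseudofunctor.LocallyDiscreteOpToCat

variable {X : Prestack.{u}} {A : TopCat.{u}} {a : X.fiber A}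
variable {R : TopCat.{u}} (r : (X.fiberProd a a).RepresentableBy R)

/-- The inclusion of the space of loops `W = (L𝒜)⁰` into the space of arrows of `𝒜`. -/
def loopIncl : (atlasGroupoid r).loop.Obj ⟶ R := TopCat.ofHom ⟨Subtype.val, continuous_subtype_val⟩

/-- The projection `(L𝒜)¹ → 𝒜¹`, `(γ, μ) ↦ μ`. -/
def loopArrow : (atlasGroupoid r).loop.Arr ⟶ R :=
  TopCat.ofHom ⟨fun p ↦ p.1.2, continuous_snd.comp continuous_subtype_val⟩

/-- The projection `W = (L𝒜)⁰ → A` sending a loop to its base point. -/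
def loopBase : (atlasGroupoid r).loop.Obj ⟶ A := loopIncl r ≫ (univPt r).fst

lemma loopIncl_tgt : loopIncl r ≫ (univPt r).snd = loopBase r := by
  ext γ; exact γ.2.symm

lemma loopArrow_src :
    loopArrow r ≫ (univPt r).fst = (atlasGroupoid r).loop.src ≫ loopBase r := by
  ext p; exact p.2.symm

lemma loopArrow_tgt :
    loopArrow r ≫ (univPt r).snd = (atlasGroupoid r).loop.tgt ≫ loopBase r := by
  ext p; exact (TopGroupoid.src_conj (G := atlasGroupoid r) _ _ p.1.1.2 p.2).symm

/-- The object of `(LX)(W)` given by the pull-back of `a` to `W` with its tautological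
automorphism. -/
def loopAtlas : (loopStack X).fiber (atlasGroupoid r).loop.Obj :=
  LoopObj.mk ((X.pull (loopBase r)).obj a)
    (pullIso (univPt r).iso (loopIncl r) (loopBase r) (loopBase r) rfl (loopIncl_tgt r))

/-- The composite `s^* w^* a ≅ (s ≫ w)^* a ≅ (t ≫ w)^* a ≅ t^* w^* a` over `(L𝒜)¹`, where
`w : W → A` sends a loop to its base point: over `(γ, μ)`, it is the isomorphism `a_x ≅ a_y`
that the arrow `μ : x → y` is. -/
def loopGlueBase :
    (X.pull (atlasGroupoid r).loop.src).obj ((X.pull (loopBase r)).obj a) ⟶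
      (X.pull (atlasGroupoid r).loop.tgt).obj ((X.pull (loopBase r)).obj a) :=
  (X.mapComp' (loopBase r).op.toLoc (atlasGroupoid r).loop.src.op.toLoc
      ((atlasGroupoid r).loop.src ≫ loopBase r).op.toLoc rfl).inv.toNatTrans.app a ≫
    pullHom (univPt r).iso.hom (loopArrow r) ((atlasGroupoid r).loop.src ≫ loopBase r)
      ((atlasGroupoid r).loop.tgt ≫ loopBase r) (loopArrow_src r) (loopArrow_tgt r) ≫
    (X.mapComp' (loopBase r).op.toLoc (atlasGroupoid r).loop.tgt.op.toLoc
      ((atlasGroupoid r).loop.tgt ≫ loopBase r).op.toLoc rfl).hom.toNatTrans.app a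

lemma pullHom_eq {S : TopCat.{u}} {f g : S ⟶ A} (k : S ⟶ R)
    (hk : k ≫ (univPt r).fst = f) (hk' : k ≫ (univPt r).snd = g) :
    pullHom (univPt r).iso.hom k f g hk hk' =
      eqToHom (by rw [← hk]; rfl) ≫ ((univPt r).restrict k).iso.hom ≫
        eqToHom (by rw [← hk']; rfl) := by
  subst hk hk'
  exact ((Category.id_comp _).trans (Category.comp_id _)).symm

lemma eqToHom_aux {C : Type*} [Category C] {x x₁ x₂ y y' y₁ z z₁ z₂ : C} (i : x ⟶ y) (j : y' ⟶ z)
    (h₁ : x₁ = x) (h₂ : y = y₁) (h₂' : y₁ = y') (h₃ : z = z₁) (g₁ : x₁ = x₂) (g₂ : x₂ = x)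
    (g : y = y') (g₃ : z = z₂) (g₄ : z₂ = z₁) :
    (eqToHom h₁ ≫ i ≫ eqToHom h₂) ≫ eqToHom h₂' ≫ j ≫ eqToHom h₃ =
      eqToHom g₁ ≫ (eqToHom g₂ ≫ (i ≫ eqToHom g ≫ j) ≫ eqToHom g₃) ≫ eqToHom g₄ := by
  subst h₁ h₂ h₂' h₃ g₁ g₃
  simp

lemma pullHom_mul {S : TopCat.{u}} {f g h : S ⟶ A} (k l : S ⟶ R)
    (hk : k ≫ (univPt r).fst = f) (hk' : k ≫ (univPt r).snd = g)
    (hl : l ≫ (univPt r).fst = g) (hl' : l ≫ (univPt r).snd = h) (n : S ⟶ R)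
    (hn : n ≫ (univPt r).fst = f) (hn' : n ≫ (univPt r).snd = h)
    (e : ∀ s : S, n s = (atlasGroupoid r).mul (k s) (l s)
      (congrArg (fun m ↦ m s) (hk'.trans hl.symm))) :
    pullHom (univPt r).iso.hom k f g hk hk' ≫ pullHom (univPt r).iso.hom l g h hl hl' =
      pullHom (univPt r).iso.hom n f h hn hn' := by
  have c := hk'.trans hl.symm
  have key : (univPt r).restrict n =
      ((univPt r).restrict k).trans ((univPt r).restrict l) c := by
    let m : S ⟶ CompSpace r := TopCat.ofHom ⟨fun s ↦ ⟨(k s, l s), congrArg (fun m ↦ m s) c⟩,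
      (k.hom.continuous.prodMk l.hom.continuous).subtype_mk fun s ↦ congrArg (fun m ↦ m s) c⟩
    have hm : (univPt r).restrict (m ≫ lift r (compPt r)) = (compPt r).restrict m := by
      rw [← FiberProdPt.restrict_restrict, restrict_lift]
    have hnm : n = m ≫ lift r (compPt r) := TopCat.hom_ext (ContinuousMap.ext e)
    exact (congrArg (univPt r).restrict hnm).trans
      (hm.trans ((FiberProdPt.restrict_trans _ _ (compFst_snd r) _).trans
      (FiberProdPt.trans_congr (FiberProdPt.restrict_restrict _ _ _)
        (FiberProdPt.restrict_restrict _ _ _) _)))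
  have ext_iso : ∀ (p q : FiberProdPt X a a S) (h₁ : p.fst = q.fst) (h₂ : p.snd = q.snd),
      p = q → p.iso.hom = eqToHom (by rw [h₁]) ≫ q.iso.hom ≫ eqToHom (by rw [h₂]) := by
    rintro p _ _ _ rfl; simp
  have E := ext_iso _ _ (hn.trans hk.symm) (hn'.trans hl'.symm) key
  rw [pullHom_eq r n, E, pullHom_eq r k, pullHom_eq r l]
  exact eqToHom_aux ((univPt r).restrict k).iso.hom ((univPt r).restrict l).iso.hom _ _ _ _ _ _
    (congrArg (fun z ↦ (X.pull z).obj a) c) _ _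

/-- The map `(L𝒜)¹ → 𝒜¹`, `(γ, μ) ↦ γ μ`. -/
def loopMul : (atlasGroupoid r).loop.Arr ⟶ R :=
  TopCat.ofHom ⟨fun p ↦ (atlasGroupoid r).mul p.1.1.1 p.1.2 (p.1.1.2.symm.trans p.2),
    TopGroupoid.continuous_mul (continuous_subtype_val.comp (continuous_fst.comp
      continuous_subtype_val)) (continuous_snd.comp continuous_subtype_val) _⟩

lemma loopMul_src : loopMul r ≫ (univPt r).fst = (atlasGroupoid r).loop.src ≫ loopBase r := by
  ext p
  exact TopGroupoid.src_mul (G := atlasGroupoid r) p.1.1.1 p.1.2 (p.1.1.2.symm.trans p.2)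

lemma loopMul_tgt : loopMul r ≫ (univPt r).snd = (atlasGroupoid r).loop.tgt ≫ loopBase r := by
  rw [← loopArrow_tgt]
  ext p
  exact TopGroupoid.tgt_mul (G := atlasGroupoid r) p.1.1.1 p.1.2 (p.1.1.2.symm.trans p.2)

lemma comm_aux {C : Type*} [Category C] {x y x' y' : C} (i : x ⟶ y) (p : y ⟶ y) (j : y ⟶ x)
    (i' : x' ⟶ y') (p' : y' ⟶ y') (j' : y' ⟶ x') (q : y ⟶ y') (hj : j ≫ i = 𝟙 y)
    (hj' : j' ≫ i' = 𝟙 y') {p₀ : y ⟶ y} {p₀' : y' ⟶ y'} (h : p = p₀) (h' : p' = p₀')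
    (e : p₀ ≫ q = q ≫ p₀') :
    (i ≫ p ≫ j) ≫ i ≫ q ≫ j' = (i ≫ q ≫ j') ≫ i' ≫ p' ≫ j' := by
  subst h h'
  simp only [Category.assoc, reassoc_of% hj, reassoc_of% hj', reassoc_of% e]

/-- The 2-morphism over `(L𝒜)¹` between the two maps `(L𝒜)¹ ⇉ W → LX`. -/
def loopGlue :
    ((loopStack X).pull (atlasGroupoid r).loop.src).obj (loopAtlas r) ⟶
      ((loopStack X).pull (atlasGroupoid r).loop.tgt).obj (loopAtlas r) :=
  LoopObj.Hom.mk (loopGlueBase r) (by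
    have e₁ := map_eq_pullHom (F := X) (loopAtlas r).aut.hom (atlasGroupoid r).loop.src
      ((atlasGroupoid r).loop.src ≫ loopBase r) ((atlasGroupoid r).loop.src ≫ loopBase r) rfl rfl
    have e₂ := map_eq_pullHom (F := X) (loopAtlas r).aut.hom (atlasGroupoid r).loop.tgt
      ((atlasGroupoid r).loop.tgt ≫ loopBase r) ((atlasGroupoid r).loop.tgt ≫ loopBase r) rfl rfl
    have f₁ := pullHom_pullHom (F := X) (univPt r).iso.hom (loopIncl r) (loopBase r) (loopBase r)
      (atlasGroupoid r).loop.src ((atlasGroupoid r).loop.src ≫ loopBase r)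
      ((atlasGroupoid r).loop.src ≫ loopBase r) rfl (loopIncl_tgt r) rfl rfl
    have f₂ := pullHom_pullHom (F := X) (univPt r).iso.hom (loopIncl r) (loopBase r) (loopBase r)
      (atlasGroupoid r).loop.tgt ((atlasGroupoid r).loop.tgt ≫ loopBase r)
      ((atlasGroupoid r).loop.tgt ≫ loopBase r) rfl (loopIncl_tgt r) rfl rfl
    have m := (pullHom_mul r ((atlasGroupoid r).loop.src ≫ loopIncl r) (loopArrow r) rfl
      (congrArg (fun z ↦ (atlasGroupoid r).loop.src ≫ z) (loopIncl_tgt r)) (loopArrow_src r)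
      (loopArrow_tgt r) (loopMul r) (loopMul_src r) (loopMul_tgt r) (fun _ ↦ rfl)).trans
      (pullHom_mul r (loopArrow r) ((atlasGroupoid r).loop.tgt ≫ loopIncl r) (loopArrow_src r)
        (loopArrow_tgt r) rfl (congrArg (fun z ↦ (atlasGroupoid r).loop.tgt ≫ z)
          (loopIncl_tgt r)) (loopMul r) (loopMul_src r) (loopMul_tgt r)
          (fun p ↦ (TopGroupoid.mul_conj (G := atlasGroupoid r) p.1.1.1 p.1.2 p.1.1.2 p.2 _
            _).symm)).symm
    change (X.pull (atlasGroupoid r).loop.src).map (loopAtlas r).aut.hom ≫ loopGlueBase r =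
      loopGlueBase r ≫ (X.pull (atlasGroupoid r).loop.tgt).map (loopAtlas r).aut.hom
    exact ((congrArg (fun z ↦ z ≫ loopGlueBase r) e₁).trans (comm_aux _ _ _ _ _ _ _
      (Cat.Hom.hom_inv_id_toNatTrans_app _ _) (Cat.Hom.hom_inv_id_toNatTrans_app _ _)
      f₁ f₂ m)).trans
      (congrArg (fun z ↦ loopGlueBase r ≫ z) e₂).symm)

/-- The canonical map `W = (L𝒜)⁰ → LX`, with its 2-isomorphism over `(L𝒜)¹`. -/
def loopMap : GroupoidMap (atlasGroupoid r).loop (loopStack X) where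
  obj := loopAtlas r
  glue := loopGlue r

end Prestack

end TopStack

/-! The proof combines a general fact on presentations of stacks with a computation for loops.

Let `Y` be a stack in groupoids and let `D` be a map `G⁰ → Y` with a multiplicative 2-morphism over
`G¹` such that `G¹` is `G⁰ ×_Y G⁰` and every `T ×_Y G⁰` is a space with local sections over `T`
(`GroupoidMap.IsPresentation`). An object `y` of `Y(T)` goes to `T ×_Y G⁰`, whose points over `t`
are the isomorphisms from `y_t` to fibres of `D.obj`. The groupoid acts by composition, and two
points of a fibre differ by a unique arrow because `G¹` is `G⁰ ×_Y G⁰`; so this is a principal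
bundle (`isHomeomorph_act`).

The space `T ×_Y G⁰` is known only through its universal property. Hence a map of bundles is handled
through the morphism `θ` of `Y` that it lies over (`IsOver`): `θ` determines the map
(`exists_isOver`, `IsOver.unique`), and functoriality, compatibility with pull-backs and the
comparison with the unit bundle are all proved by computing `θ` on both sides.

The resulting functor is an equivalence by descent along the projection of a bundle, a covering
since it has local sections. A map of bundles comes from a morphism on the total space that is
constant along the fibres (`pullHom_eq_pullHom`), and any bundle supplies a cocycle on the pull-back
of `D.obj` along its anchor, namely `glue` at the arrow between two points of a fibre
(`exists_framing`). A pointwise equivalence is an equivalence (`equivalenceOfPointwise`) and carries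
the stack property along (`isStack_of_pointwise`), so `𝓑G` is a stack.

It remains to see that `W = (L𝒜)⁰ → LX` is a presentation (`isPresentation_loopMap`). An isomorphism
`y_t ≅ a_x` transports an automorphism of `y` to exactly one loop at `x`, so `T ×_{LX} W` is `T ×_X
A` again. A morphism `a_x → a_y` that intertwines the loops `γ` and `γ'` is an arrow `μ` with `γ' =
μ γ μ⁻¹`, so `W ×_{LX} W` is `(L𝒜)¹`. Finally `LX` is a stack because a descent datum for `LX` is a
descent datum for `X` with an automorphism. -/

namespace CategoryTheory.Pseudofunctor

-- Pointwise equivalences of pseudofunctors.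

universe w v v' u₁ u'

variable {B : Type u₁} [Bicategory.{w, v} B] (F : B ⥤ᵖ Cat.{v', u'})

/-- The isomorphism `𝟙^* x ≅ x`. -/
def idIsoApp (a : B) (x : F.obj a) : (F.map (𝟙 a)).toFunctor.obj x ≅ x :=
  (Cat.Hom.toNatIso (F.mapId a)).app x

/-- The isomorphism `(f ≫ g)^* x ≅ g^* f^* x`. -/
def compIsoApp {a b c : B} (f : a ⟶ b) (g : b ⟶ c) (x : F.obj a) :
    (F.map (f ≫ g)).toFunctor.obj x ≅ (F.map g).toFunctor.obj ((F.map f).toFunctor.obj x) :=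
  (Cat.Hom.toNatIso (F.mapComp f g)).app x

lemma idIsoApp_naturality (a : B) {x y : F.obj a} (φ : x ⟶ y) :
    (F.map (𝟙 a)).toFunctor.map φ ≫ (F.idIsoApp a y).hom = (F.idIsoApp a x).hom ≫ φ :=
  (F.mapId a).hom.toNatTrans.naturality φ

lemma compIsoApp_naturality {a b c : B} (f : a ⟶ b) (g : b ⟶ c) {x y : F.obj a} (φ : x ⟶ y) :
    (F.map (f ≫ g)).toFunctor.map φ ≫ (F.compIsoApp f g y).hom =
      (F.compIsoApp f g x).hom ≫ (F.map g).toFunctor.map ((F.map f).toFunctor.map φ) :=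
  (F.mapComp f g).hom.toNatTrans.naturality φ

namespace StrongTrans

variable {F} {G : B ⥤ᵖ Cat.{v', u'}} (e : F ⟶ G)

/-- The components of a strong transformation at a 1-morphism and an object, as isomorphisms. -/
def natIsoApp {a b : B} (f : a ⟶ b) (x : F.obj a) :
    (e.app b).toFunctor.obj ((F.map f).toFunctor.obj x) ≅
      (G.map f).toFunctor.obj ((e.app a).toFunctor.obj x) :=
  (Cat.Hom.toNatIso (e.naturality f)).app x

lemma natIsoApp_map₂ {a b : B} {f g : a ⟶ b} (η : f ⟶ g) (x : F.obj a) :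
    (e.app b).toFunctor.map ((F.map₂ η).toNatTrans.app x) ≫ (natIsoApp e g x).hom =
    (natIsoApp e f x).hom ≫ (G.map₂ η).toNatTrans.app ((e.app a).toFunctor.obj x) :=
  congrArg (fun t ↦ t.toNatTrans.app x) (e.naturality_naturality η)

lemma natIsoApp_map₂_assoc {a b : B} {f g : a ⟶ b} (η : f ⟶ g) (x : F.obj a) {z : G.obj b}
    (h : (G.map g).toFunctor.obj ((e.app a).toFunctor.obj x) ⟶ z) :
    (e.app b).toFunctor.map ((F.map₂ η).toNatTrans.app x) ≫ (natIsoApp e g x).hom ≫ h =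
    (natIsoApp e f x).hom ≫ (G.map₂ η).toNatTrans.app ((e.app a).toFunctor.obj x) ≫ h := by
  simpa only [Category.assoc] using congrArg (· ≫ h) (natIsoApp_map₂ e η x)

lemma natIsoApp_id (a : B) (x : F.obj a) :
    (natIsoApp e (𝟙 a) x).hom ≫ (G.idIsoApp a ((e.app a).toFunctor.obj x)).hom =
    (e.app a).toFunctor.map (F.idIsoApp a x).hom :=
  (congrArg (fun t ↦ t.toNatTrans.app x) (e.naturality_id a)).trans
    ((congrArg (_ ≫ ·) (Category.id_comp _)).trans (Category.comp_id _))

lemma natIsoApp_comp {a b c : B} (f : a ⟶ b) (g : b ⟶ c) (x : F.obj a) :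
    (natIsoApp e (f ≫ g) x).hom ≫ (G.compIsoApp f g ((e.app a).toFunctor.obj x)).hom =
    (e.app c).toFunctor.map (F.compIsoApp f g x).hom ≫
      (natIsoApp e g ((F.map f).toFunctor.obj x)).hom ≫
        (G.map g).toFunctor.map (natIsoApp e f x).hom := by
  refine (congrArg (fun t ↦ t.toNatTrans.app x) (e.naturality_comp f g)).trans ?_
  -- The associators of `Cat` have identity components, which are cancelled here.
  refine congrArg (_ ≫ ·) ((Category.id_comp _).trans (congrArg (_ ≫ ·) ?_))
  exact (Category.id_comp _).trans (Category.comp_id _)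

lemma natIsoApp_comp_assoc {a b c : B} (f : a ⟶ b) (g : b ⟶ c) (x : F.obj a) {z : G.obj c}
    (h : (G.map g).toFunctor.obj ((G.map f).toFunctor.obj ((e.app a).toFunctor.obj x)) ⟶ z) :
    (natIsoApp e (f ≫ g) x).hom ≫ (G.compIsoApp f g ((e.app a).toFunctor.obj x)).hom ≫ h =
    (e.app c).toFunctor.map (F.compIsoApp f g x).hom ≫
      (natIsoApp e g ((F.map f).toFunctor.obj x)).hom ≫
        (G.map g).toFunctor.map (natIsoApp e f x).hom ≫ h := by
  simpa only [Category.assoc] using congrArg (· ≫ h) (natIsoApp_comp e f g x)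

lemma natIsoApp_naturality {a b : B} (f : a ⟶ b) {x y : F.obj a} (φ : x ⟶ y) :
    (e.app b).toFunctor.map ((F.map f).toFunctor.map φ) ≫ (natIsoApp e f y).hom =
    (natIsoApp e f x).hom ≫ (G.map f).toFunctor.map ((e.app a).toFunctor.map φ) :=
  (e.naturality f).hom.toNatTrans.naturality φ

lemma natIsoApp_naturality_assoc {a b : B} (f : a ⟶ b) {x y : F.obj a} (φ : x ⟶ y) {z : G.obj b}
    (h : (G.map f).toFunctor.obj ((e.app a).toFunctor.obj y) ⟶ z) :
    (e.app b).toFunctor.map ((F.map f).toFunctor.map φ) ≫ (natIsoApp e f y).hom ≫ h =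
      (natIsoApp e f x).hom ≫ (G.map f).toFunctor.map ((e.app a).toFunctor.map φ) ≫ h := by
  simpa only [Category.assoc] using congrArg (· ≫ h) (natIsoApp_naturality e f φ)

/-- Constructor for strong transformations between `Cat`-valued pseudofunctors on a locally discrete
bicategory. -/
def mkOfLocallyDiscrete {C : Type*} [Category* C] {F G : LocallyDiscrete C ⥤ᵖ Cat.{v', u'}}
    (E : ∀ a, F.obj a ⥤ G.obj a)
    (ν : ∀ {a b : LocallyDiscrete C} (f : a ⟶ b) (x : F.obj a),
      (E b).obj ((F.map f).toFunctor.obj x) ≅ (G.map f).toFunctor.obj ((E a).obj x))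
    (naturality : ∀ {a b : LocallyDiscrete C} (f : a ⟶ b) {x y : F.obj a} (φ : x ⟶ y),
      (E b).map ((F.map f).toFunctor.map φ) ≫ (ν f y).hom =
        (ν f x).hom ≫ (G.map f).toFunctor.map ((E a).map φ))
    (id : ∀ (a : LocallyDiscrete C) (x : F.obj a),
      (ν (𝟙 a) x).hom ≫ (G.idIsoApp a ((E a).obj x)).hom = (E a).map (F.idIsoApp a x).hom)
    (comp : ∀ {a b c : LocallyDiscrete C} (f : a ⟶ b) (g : b ⟶ c) (x : F.obj a),
      (ν (f ≫ g) x).hom ≫ (G.compIsoApp f g ((E a).obj x)).hom =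
      (E c).map (F.compIsoApp f g x).hom ≫ (ν g ((F.map f).toFunctor.obj x)).hom ≫
        (G.map g).toFunctor.map (ν f x).hom) : F ⟶ G where
  app a := (E a).toCatHom
  naturality f := Cat.Hom.isoMk (NatIso.ofComponents (ν f) (naturality f))
  naturality_naturality η := by
    -- A 2-morphism of a locally discrete bicategory is an identity.
    obtain rfl := obj_ext_of_isDiscrete η
    obtain rfl : η = 𝟙 _ := Subsingleton.elim _ _
    rw [F.map₂_id, G.map₂_id]
    apply Cat.Hom₂.ext; apply NatTrans.ext; funext x
    exact (congrArg (· ≫ _) ((E _).map_id _)).trans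
      ((Category.id_comp _).trans (Category.comp_id _).symm)
  naturality_id a := by
    apply Cat.Hom₂.ext; apply NatTrans.ext; funext x
    exact (id a x).trans ((congrArg (_ ≫ ·) (Category.id_comp _)).trans (Category.comp_id _)).symm
  naturality_comp f g := by
    apply Cat.Hom₂.ext; apply NatTrans.ext; funext x
    exact (comp f g x).trans (congrArg (_ ≫ ·) ((Category.id_comp _).trans
      (congrArg (_ ≫ ·) ((Category.id_comp _).trans (Category.comp_id _))))).symm

section equivalence

variable [∀ b, (e.app b).toFunctor.IsEquivalence]

/-- The counit at an object of the pointwise inverse. -/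
noncomputable def counitApp {a : B} (y : G.obj a) :
    (e.app a).toFunctor.obj ((e.app a).toFunctor.inv.obj y) ≅ y :=
  (e.app a).toFunctor.asEquivalence.counitIso.app y

lemma counitApp_naturality {a : B} {y z : G.obj a} (φ : y ⟶ z) :
    (e.app a).toFunctor.map ((e.app a).toFunctor.inv.map φ) ≫ (counitApp e z).hom =
      (counitApp e y).hom ≫ φ :=
  (e.app a).toFunctor.asEquivalence.counitIso.hom.naturality φ

/-- The unit at an object of the pointwise inverse. -/
noncomputable def unitApp {a : B} (x : F.obj a) :
    x ≅ (e.app a).toFunctor.inv.obj ((e.app a).toFunctor.obj x) :=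
  (e.app a).toFunctor.asEquivalence.unitIso.app x

lemma map_unitApp_comp {a : B} (x : F.obj a) :
    (e.app a).toFunctor.map (unitApp e x).hom ≫ (counitApp e ((e.app a).toFunctor.obj x)).hom =
      𝟙 _ :=
  (e.app a).toFunctor.asEquivalence.functor_unitIso_comp x

lemma map_unitApp_comp_assoc {a : B} (x : F.obj a) {z : G.obj a}
    (h : (e.app a).toFunctor.obj x ⟶ z) :
    (e.app a).toFunctor.map (unitApp e x).hom ≫
      (counitApp e ((e.app a).toFunctor.obj x)).hom ≫ h = h := by
  simpa only [Category.assoc, Category.id_comp] using congrArg (· ≫ h) (map_unitApp_comp e x)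

/-- The naturality isomorphism of the inverse of a pointwise equivalence. -/
noncomputable def invNatIso {a b : B} (f : a ⟶ b) (y : G.obj a) :
    (e.app b).toFunctor.inv.obj ((G.map f).toFunctor.obj y) ≅
      (F.map f).toFunctor.obj ((e.app a).toFunctor.inv.obj y) :=
  (e.app b).toFunctor.preimageIso
    (counitApp e _ ≪≫ (G.map f).toFunctor.mapIso (counitApp e y).symm ≪≫ (natIsoApp e f _).symm)

/-- `invNatIso` is a preimage under a fully faithful functor, hence determined by its image. Solved
for the counit, that image takes this form, in which `invNatIso` is used below. -/
lemma map_invNatIso_hom_comp {a b : B} (f : a ⟶ b) (y : G.obj a) :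
    (e.app b).toFunctor.map (invNatIso e f y).hom ≫ (natIsoApp e f _).hom ≫
      (G.map f).toFunctor.map (counitApp e y).hom = (counitApp e _).hom := by
  have : (e.app b).toFunctor.map (invNatIso e f y).hom = (counitApp e _).hom ≫
      (G.map f).toFunctor.map (counitApp e y).inv ≫ (natIsoApp e f _).inv :=
    (e.app b).toFunctor.map_preimage _
  rw [this]
  simp only [Category.assoc, Iso.inv_hom_id_assoc, ← Functor.map_comp, Iso.inv_hom_id,
    Functor.map_id, Category.comp_id]

lemma map_invNatIso_hom_comp_assoc {a b : B} (f : a ⟶ b) (y : G.obj a) {z : G.obj b}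
    (h : (G.map f).toFunctor.obj y ⟶ z) :
    (e.app b).toFunctor.map (invNatIso e f y).hom ≫ (natIsoApp e f _).hom ≫
      (G.map f).toFunctor.map (counitApp e y).hom ≫ h = (counitApp e _).hom ≫ h := by
  simpa only [Category.assoc] using congrArg (· ≫ h) (map_invNatIso_hom_comp e f y)

/-- Faithfulness of `e.app b`, after composing with an isomorphism chosen so that
`map_invNatIso_hom_comp` applies. It reduces a coherence of the inverse to the same coherence for
`e`. -/
lemma hom_ext_of_map {a b : B} (f : a ⟶ b) {x : F.obj b} {y : G.obj a}
    {φ ψ : x ⟶ (F.map f).toFunctor.obj ((e.app a).toFunctor.inv.obj y)}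
    (h : (e.app b).toFunctor.map φ ≫ (natIsoApp e f _).hom ≫
        (G.map f).toFunctor.map (counitApp e y).hom =
      (e.app b).toFunctor.map ψ ≫ (natIsoApp e f _).hom ≫
        (G.map f).toFunctor.map (counitApp e y).hom) : φ = ψ :=
  (e.app b).toFunctor.map_injective ((cancel_mono _).1 h)

lemma invNatIso_naturality {a b : B} (f : a ⟶ b) {y z : G.obj a} (φ : y ⟶ z) :
    (e.app b).toFunctor.inv.map ((G.map f).toFunctor.map φ) ≫ (invNatIso e f z).hom =
      (invNatIso e f y).hom ≫ (F.map f).toFunctor.map ((e.app a).toFunctor.inv.map φ) := by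
  apply hom_ext_of_map e f
  simp only [Functor.map_comp, Category.assoc, map_invNatIso_hom_comp, counitApp_naturality,
    natIsoApp_naturality_assoc]
  rw [← Functor.map_comp (G.map f).toFunctor, counitApp_naturality, Functor.map_comp,
    map_invNatIso_hom_comp_assoc]

lemma invNatIso_map₂ {a b : B} {f g : a ⟶ b} (η : f ⟶ g) (y : G.obj a) :
    (e.app b).toFunctor.inv.map ((G.map₂ η).toNatTrans.app y) ≫ (invNatIso e g y).hom =
    (invNatIso e f y).hom ≫ (F.map₂ η).toNatTrans.app ((e.app a).toFunctor.inv.obj y) := by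
  apply hom_ext_of_map e g
  simp only [Functor.map_comp, Category.assoc, map_invNatIso_hom_comp, counitApp_naturality,
    natIsoApp_map₂_assoc]
  rw [← NatTrans.naturality, map_invNatIso_hom_comp_assoc]

lemma invNatIso_id (a : B) (y : G.obj a) :
    (invNatIso e (𝟙 a) y).hom ≫ (F.idIsoApp a ((e.app a).toFunctor.inv.obj y)).hom =
    (e.app a).toFunctor.inv.map (G.idIsoApp a y).hom := by
  apply (e.app a).toFunctor.map_injective
  rw [← cancel_mono (counitApp e y).hom]
  simp only [Functor.map_comp, Category.assoc, counitApp_naturality]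
  rw [← natIsoApp_id, Category.assoc, ← idIsoApp_naturality, map_invNatIso_hom_comp_assoc]

lemma invNatIso_comp {a b c : B} (f : a ⟶ b) (g : b ⟶ c) (y : G.obj a) :
    (invNatIso e (f ≫ g) y).hom ≫ (F.compIsoApp f g ((e.app a).toFunctor.inv.obj y)).hom =
    (e.app c).toFunctor.inv.map (G.compIsoApp f g y).hom ≫
      (invNatIso e g ((G.map f).toFunctor.obj y)).hom ≫
        (F.map g).toFunctor.map (invNatIso e f y).hom := by
  apply (e.app c).toFunctor.map_injective
  -- With this isomorphism appended, both sides reduce to the counit followed by `compIsoApp`.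
  rw [← cancel_mono ((natIsoApp e g _).hom ≫ (G.map g).toFunctor.map ((natIsoApp e f _).hom ≫
    (G.map f).toFunctor.map (counitApp e y).hom))]
  simp only [Functor.map_comp, Category.assoc, natIsoApp_naturality_assoc]
  rw [← natIsoApp_comp_assoc, ← compIsoApp_naturality, map_invNatIso_hom_comp_assoc]
  simp only [← Functor.map_comp (G.map g).toFunctor, map_invNatIso_hom_comp]
  simp only [counitApp_naturality]

/-- The inverse of a pointwise equivalence. -/
noncomputable def inverse : G ⟶ F where
  app a := (e.app a).toFunctor.inv.toCatHom
  naturality f := Cat.Hom.isoMk (NatIso.ofComponents (invNatIso e f) (invNatIso_naturality e f))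
  naturality_naturality η := by
    apply Cat.Hom₂.ext; apply NatTrans.ext; funext x
    exact invNatIso_map₂ e η x
  naturality_id a := by
    apply Cat.Hom₂.ext; apply NatTrans.ext; funext x
    exact (invNatIso_id e a x).trans
      ((congrArg (_ ≫ ·) (Category.id_comp _)).trans (Category.comp_id _)).symm
  naturality_comp f g := by
    apply Cat.Hom₂.ext; apply NatTrans.ext; funext x
    exact (invNatIso_comp e f g x).trans (congrArg (_ ≫ ·) ((Category.id_comp _).trans
      (congrArg (_ ≫ ·) ((Category.id_comp _).trans (Category.comp_id _))))).symm

/-- The counit of a pointwise equivalence. -/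
noncomputable def inverseComp : inverse e ≫ e ≅ 𝟙 G :=
  isoMk (fun a ↦ Cat.Hom.isoMk (e.app a).toFunctor.asEquivalence.counitIso) fun {a b} f ↦ by
    apply Cat.Hom₂.ext; apply NatTrans.ext; funext y
    change (counitApp e _).hom ≫ 𝟙 _ ≫ 𝟙 _ =
      (𝟙 _ ≫ (e.app b).toFunctor.map (invNatIso e f y).hom ≫ 𝟙 _ ≫ (natIsoApp e f _).hom ≫ 𝟙 _) ≫
        (G.map f).toFunctor.map (counitApp e y).hom
    simp only [Category.id_comp, Category.comp_id, Category.assoc, map_invNatIso_hom_comp]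

/-- The unit of a pointwise equivalence. -/
noncomputable def compInverse : 𝟙 F ≅ e ≫ inverse e :=
  isoMk (fun a ↦ Cat.Hom.isoMk (e.app a).toFunctor.asEquivalence.unitIso) fun {a b} f ↦ by
    apply Cat.Hom₂.ext; apply NatTrans.ext; funext x
    change (unitApp e _).hom ≫ 𝟙 _ ≫ (e.app b).toFunctor.inv.map (natIsoApp e f x).hom ≫ 𝟙 _ ≫
      (invNatIso e f _).hom ≫ 𝟙 _ = (𝟙 _ ≫ 𝟙 _) ≫ (F.map f).toFunctor.map (unitApp e x).hom
    simp only [Category.id_comp, Category.comp_id]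
    apply hom_ext_of_map e f
    simp only [Functor.map_comp, Category.assoc, map_invNatIso_hom_comp, counitApp_naturality,
      natIsoApp_naturality_assoc, map_unitApp_comp_assoc]
    rw [← Functor.map_comp, map_unitApp_comp, Functor.map_id, Category.comp_id]

/-- A strong transformation between pseudofunctors to `Cat` that is a pointwise equivalence is an
equivalence. -/
noncomputable def equivalenceOfPointwise : F ≌ G :=
  -- The counit is adjusted to satisfy the triangle identities; the forward morphism remains `e`
  -- itself, on which the naturality claim of the theorem depends.
  Bicategory.Equivalence.mkOfAdjointifyCounit (compInverse e) (inverseComp e)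

end equivalence

end StrongTrans

end CategoryTheory.Pseudofunctor

/-! ### Descent data and the stack condition under pointwise equivalences. -/

namespace CategoryTheory.Pseudofunctor

open LocallyDiscreteOpToCat

universe v v' u₁ u' t

variable {C : Type u₁} [Category.{v} C] {F : LocallyDiscrete Cᵒᵖ ⥤ᵖ Cat.{v', u'}}

/-- The isomorphism `gf^* x ≅ g^* f^* x` for `gf = g ≫ f`. -/
def pullComp (F : LocallyDiscrete Cᵒᵖ ⥤ᵖ Cat.{v', u'}) {R S T : C}
    (f : S ⟶ T) (g : R ⟶ S) (gf : R ⟶ T) (h : g ≫ f = gf) (x : F.obj ⟨op T⟩) :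
    (F.map gf.op.toLoc).toFunctor.obj x ≅
      (F.map g.op.toLoc).toFunctor.obj ((F.map f.op.toLoc).toFunctor.obj x) :=
  (Cat.Hom.toNatIso (F.mapComp' f.op.toLoc g.op.toLoc gf.op.toLoc (by rw [← h]; rfl))).app x

lemma pullComp_rfl {R S T : C} (f : S ⟶ T) (g : R ⟶ S) (x : F.obj ⟨op T⟩) :
    F.pullComp f g _ rfl x = F.compIsoApp f.op.toLoc g.op.toLoc x := by
  have := mapComp'_eq_mapComp F f.op.toLoc g.op.toLoc
  exact congrArg (fun t ↦ (Cat.Hom.toNatIso t).app x) this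

lemma pullComp_inv_naturality {R S T : C} (f : S ⟶ T) (g : R ⟶ S) (gf : R ⟶ T) (h : g ≫ f = gf)
    {x y : F.obj ⟨op T⟩} (φ : x ⟶ y) :
    (F.map g.op.toLoc).toFunctor.map ((F.map f.op.toLoc).toFunctor.map φ) ≫
      (F.pullComp f g gf h y).inv =
      (F.pullComp f g gf h x).inv ≫ (F.map gf.op.toLoc).toFunctor.map φ :=
  (F.mapComp' f.op.toLoc g.op.toLoc gf.op.toLoc (by rw [← h]; rfl)).inv.toNatTrans.naturality φ

lemma pullHom_eq_pullComp {X₁ X₂ Y Y' : C} {x₁ : F.obj ⟨op X₁⟩} {x₂ : F.obj ⟨op X₂⟩}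
    {f₁ : Y ⟶ X₁} {f₂ : Y ⟶ X₂}
    (φ : (F.map f₁.op.toLoc).toFunctor.obj x₁ ⟶ (F.map f₂.op.toLoc).toFunctor.obj x₂)
    (g : Y' ⟶ Y) (gf₁ : Y' ⟶ X₁) (gf₂ : Y' ⟶ X₂) (hgf₁ : g ≫ f₁ = gf₁) (hgf₂ : g ≫ f₂ = gf₂) :
    pullHom φ g gf₁ gf₂ hgf₁ hgf₂ =
      (F.pullComp f₁ g gf₁ hgf₁ x₁).hom ≫
        (F.map g.op.toLoc).toFunctor.map φ ≫ (F.pullComp f₂ g gf₂ hgf₂ x₂).inv :=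
  rfl

namespace StrongTrans

variable {G : LocallyDiscrete Cᵒᵖ ⥤ᵖ Cat.{v', u'}} (e : F ⟶ G)

lemma natIsoApp_pullComp {R S T : C} (f : S ⟶ T) (g : R ⟶ S) (gf : R ⟶ T) (h : g ≫ f = gf)
    (x : F.obj ⟨op T⟩) :
    (natIsoApp e gf.op.toLoc x).hom ≫ (G.pullComp f g gf h ((e.app _).toFunctor.obj x)).hom =
    (e.app _).toFunctor.map (F.pullComp f g gf h x).hom ≫
      (natIsoApp e g.op.toLoc ((F.map f.op.toLoc).toFunctor.obj x)).hom ≫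
        (G.map g.op.toLoc).toFunctor.map (natIsoApp e f.op.toLoc x).hom := by
  subst h
  rw [pullComp_rfl, pullComp_rfl]
  exact natIsoApp_comp e f.op.toLoc g.op.toLoc x

lemma natIsoApp_pullComp_assoc {R S T : C} (f : S ⟶ T) (g : R ⟶ S) (gf : R ⟶ T)
    (h : g ≫ f = gf) (x : F.obj ⟨op T⟩) {z : G.obj ⟨op R⟩}
    (φ : (G.map g.op.toLoc).toFunctor.obj ((G.map f.op.toLoc).toFunctor.obj
      ((e.app _).toFunctor.obj x)) ⟶ z) :
    (natIsoApp e gf.op.toLoc x).hom ≫ (G.pullComp f g gf h ((e.app _).toFunctor.obj x)).hom ≫ φ =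
    (e.app _).toFunctor.map (F.pullComp f g gf h x).hom ≫
      (natIsoApp e g.op.toLoc ((F.map f.op.toLoc).toFunctor.obj x)).hom ≫
        (G.map g.op.toLoc).toFunctor.map (natIsoApp e f.op.toLoc x).hom ≫ φ := by
  simpa only [Category.assoc] using congrArg (· ≫ φ) (natIsoApp_pullComp e f g gf h x)

/-- The image under a strong transformation of a morphism `f₁^* x₁ ⟶ f₂^* x₂`. -/
def mapHom {a₁ a₂ b : LocallyDiscrete Cᵒᵖ} {f₁ : a₁ ⟶ b} {f₂ : a₂ ⟶ b} {x₁ : F.obj a₁}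
    {x₂ : F.obj a₂} (φ : (F.map f₁).toFunctor.obj x₁ ⟶ (F.map f₂).toFunctor.obj x₂) :
    (G.map f₁).toFunctor.obj ((e.app a₁).toFunctor.obj x₁) ⟶
      (G.map f₂).toFunctor.obj ((e.app a₂).toFunctor.obj x₂) :=
  (natIsoApp e f₁ x₁).inv ≫ (e.app b).toFunctor.map φ ≫ (natIsoApp e f₂ x₂).hom

lemma mapHom_id {a b : LocallyDiscrete Cᵒᵖ} (f : a ⟶ b) (x : F.obj a) :
    mapHom e (𝟙 ((F.map f).toFunctor.obj x)) = 𝟙 _ := by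
  simp [mapHom]

lemma mapHom_comp {a₁ a₂ a₃ b : LocallyDiscrete Cᵒᵖ} {f₁ : a₁ ⟶ b} {f₂ : a₂ ⟶ b} {f₃ : a₃ ⟶ b}
    {x₁ : F.obj a₁} {x₂ : F.obj a₂} {x₃ : F.obj a₃}
    (φ : (F.map f₁).toFunctor.obj x₁ ⟶ (F.map f₂).toFunctor.obj x₂)
    (ψ : (F.map f₂).toFunctor.obj x₂ ⟶ (F.map f₃).toFunctor.obj x₃) :
    mapHom e (φ ≫ ψ) = mapHom e φ ≫ mapHom e ψ := by
  simp [mapHom]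

lemma mapHom_map {a b : LocallyDiscrete Cᵒᵖ} (f : a ⟶ b) {x y : F.obj a} (φ : x ⟶ y) :
    mapHom e ((F.map f).toFunctor.map φ) = (G.map f).toFunctor.map ((e.app a).toFunctor.map φ) := by
  rw [mapHom, natIsoApp_naturality, Iso.inv_hom_id_assoc]

lemma mapHom_injective [∀ b, (e.app b).toFunctor.Faithful] {a₁ a₂ b : LocallyDiscrete Cᵒᵖ}
    {f₁ : a₁ ⟶ b} {f₂ : a₂ ⟶ b} {x₁ : F.obj a₁} {x₂ : F.obj a₂}
    {φ ψ : (F.map f₁).toFunctor.obj x₁ ⟶ (F.map f₂).toFunctor.obj x₂}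
    (h : mapHom e φ = mapHom e ψ) : φ = ψ :=
  (e.app b).toFunctor.map_injective ((cancel_mono _).1 ((cancel_epi _).1 h))

/-- Compatibility of `e` with composite pull-backs, used once at each end of `φ`. Together with
`mapHom_id` and `mapHom_comp`, it makes the image of a cocycle a cocycle. -/
lemma pullHom_mapHom {X₁ X₂ Y Y' : C} {x₁ : F.obj ⟨op X₁⟩} {x₂ : F.obj ⟨op X₂⟩} {f₁ : Y ⟶ X₁}
    {f₂ : Y ⟶ X₂} (φ : (F.map f₁.op.toLoc).toFunctor.obj x₁ ⟶ (F.map f₂.op.toLoc).toFunctor.obj x₂)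
    (g : Y' ⟶ Y) (gf₁ : Y' ⟶ X₁) (gf₂ : Y' ⟶ X₂) (hgf₁ : g ≫ f₁ = gf₁) (hgf₂ : g ≫ f₂ = gf₂) :
    pullHom (mapHom e φ) g gf₁ gf₂ hgf₁ hgf₂ = mapHom e (pullHom φ g gf₁ gf₂ hgf₁ hgf₂) := by
  have h₁ := natIsoApp_pullComp e f₁ g gf₁ hgf₁ x₁
  have h₂ := natIsoApp_pullComp e f₂ g gf₂ hgf₂ x₂
  rw [pullHom_eq_pullComp, pullHom_eq_pullComp, ← cancel_epi (natIsoApp e gf₁.op.toLoc x₁).hom,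
    ← cancel_mono (G.pullComp f₂ g gf₂ hgf₂ _).hom]
  simp only [mapHom, Category.assoc, Iso.hom_inv_id_assoc, h₂, Iso.inv_hom_id, Category.comp_id,
    Functor.map_comp]
  rw [reassoc_of% h₁, ← Functor.map_comp_assoc (G.map _).toFunctor, Iso.hom_inv_id,
    Functor.map_id, Category.id_comp, ← natIsoApp_naturality_assoc,
    ← Functor.map_comp_assoc (e.app _).toFunctor _ (F.pullComp _ _ _ _ _).hom, Iso.inv_hom_id,
    Functor.map_id, Category.id_comp]

/-- The composites of two `pullComp` are the transition maps of the descent datum of a global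
object; that `natIsoApp` respects them makes `toDescentDataCompMapDescentData` well defined. -/
lemma map_natIsoApp_comp_pullComp {R S T₁ T₂ : C} (f₁ : S ⟶ T₁) (f₂ : S ⟶ T₂) (p₁ : T₁ ⟶ R)
    (p₂ : T₂ ⟶ R) (q : S ⟶ R) (h₁ : f₁ ≫ p₁ = q) (h₂ : f₂ ≫ p₂ = q) (x : F.obj ⟨op R⟩) :
    (G.map f₁.op.toLoc).toFunctor.map (natIsoApp e p₁.op.toLoc x).hom ≫
      (G.pullComp p₁ f₁ q h₁ _).inv ≫ (G.pullComp p₂ f₂ q h₂ _).hom =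
      mapHom e ((F.pullComp p₁ f₁ q h₁ x).inv ≫ (F.pullComp p₂ f₂ q h₂ x).hom) ≫
        (G.map f₂.op.toLoc).toFunctor.map (natIsoApp e p₂.op.toLoc x).hom := by
  simp only [mapHom, Functor.map_comp, Category.assoc]
  rw [← natIsoApp_pullComp, ← cancel_epi (natIsoApp e f₁.op.toLoc _).hom,
    ← cancel_epi ((e.app _).toFunctor.map (F.pullComp p₁ f₁ q h₁ x).hom), Iso.hom_inv_id_assoc,
    ← Functor.map_comp_assoc (e.app _).toFunctor, Iso.hom_inv_id, Functor.map_id,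
    Category.id_comp, ← natIsoApp_pullComp_assoc, Iso.hom_inv_id_assoc]

section

variable [∀ b, (e.app b).toFunctor.IsEquivalence]

/-- The argument of `mapHom` is the transition map of the image of a descent datum under `inverse
e`. Hence the counits form an isomorphism of descent data, and `mapDescentData e` is essentially
surjective. -/
lemma map_counitApp_comp {S T₁ T₂ : C} (f₁ : S ⟶ T₁) (f₂ : S ⟶ T₂) {x₁ : G.obj ⟨op T₁⟩}
    {x₂ : G.obj ⟨op T₂⟩}
    (φ : (G.map f₁.op.toLoc).toFunctor.obj x₁ ⟶ (G.map f₂.op.toLoc).toFunctor.obj x₂) :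
    (G.map f₁.op.toLoc).toFunctor.map (counitApp e x₁).hom ≫ φ =
      mapHom e ((invNatIso e f₁.op.toLoc x₁).inv ≫ (e.app _).toFunctor.inv.map φ ≫
        (invNatIso e f₂.op.toLoc x₂).hom) ≫
        (G.map f₂.op.toLoc).toFunctor.map (counitApp e x₂).hom := by
  rw [← cancel_epi (natIsoApp e f₁.op.toLoc _).hom,
    ← cancel_epi ((e.app _).toFunctor.map (invNatIso e f₁.op.toLoc _).hom)]
  simp only [mapHom, Functor.map_comp, Category.assoc, Iso.hom_inv_id_assoc]
  rw [map_invNatIso_hom_comp_assoc, map_invNatIso_hom_comp, counitApp_naturality,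
    ← Functor.map_comp_assoc (e.app _).toFunctor, Iso.hom_inv_id, Functor.map_id,
    Category.id_comp]

end

section descent

variable {ι : Type t} {S : C} {X : ι → C} (f : ∀ i, X i ⟶ S)

/-- The functor between categories of descent data induced by a strong transformation. -/
def mapDescentData : F.DescentData f ⥤ G.DescentData f where
  obj D :=
    { obj i := (e.app _).toFunctor.obj (D.obj i)
      hom _ q _ _ f₁ f₂ hf₁ hf₂ := mapHom e (D.hom q f₁ f₂ hf₁ hf₂)
      pullHom_hom _ _ g q q' hq _ _ f₁ f₂ hf₁ hf₂ gf₁ gf₂ hgf₁ hgf₂ := by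
        rw [pullHom_mapHom, D.pullHom_hom g q q' hq f₁ f₂ hf₁ hf₂ gf₁ gf₂ hgf₁ hgf₂]
      hom_self _ q _ g hg := by rw [D.hom_self q g hg, mapHom_id]
      hom_comp _ q _ _ _ f₁ f₂ f₃ hf₁ hf₂ hf₃ := by rw [← mapHom_comp, D.hom_comp] }
  map φ :=
    { hom i := (e.app _).toFunctor.map (φ.hom i)
      comm _ q _ _ f₁ f₂ hf₁ hf₂ := by
        rw [← mapHom_map, ← mapHom_map, ← mapHom_comp, ← mapHom_comp, φ.comm q f₁ f₂ hf₁ hf₂] }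
  map_id D := by ext i; exact (e.app _).toFunctor.map_id _
  map_comp φ ψ := by ext i; exact (e.app _).toFunctor.map_comp _ _

/-- Compatibility of `mapDescentData` with the functors `toDescentData`. -/
def toDescentDataCompMapDescentData :
    F.toDescentData f ⋙ mapDescentData e f ≅ (e.app ⟨op S⟩).toFunctor ⋙ G.toDescentData f :=
  NatIso.ofComponents (fun x ↦ DescentData.isoMk (fun i ↦ natIsoApp e (f i).op.toLoc x)
    fun _ q i₁ i₂ f₁ f₂ hf₁ hf₂ ↦
      map_natIsoApp_comp_pullComp e f₁ f₂ (f i₁) (f i₂) q hf₁ hf₂ x)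
    fun φ ↦ by ext i; exact natIsoApp_naturality e _ φ

variable [∀ b, (e.app b).toFunctor.IsEquivalence]

instance : (mapDescentData e f).Faithful where
  map_injective {D₁ D₂ φ ψ} h := by
    ext i
    exact (e.app _).toFunctor.map_injective (congrArg (fun t ↦ DescentData.Hom.hom t i) h)

lemma map_preimage_comm {S T₁ T₂ : C} (f₁ : S ⟶ T₁) (f₂ : S ⟶ T₂) {x₁ y₁ : F.obj ⟨op T₁⟩}
    {x₂ y₂ : F.obj ⟨op T₂⟩}
    (α : (e.app _).toFunctor.obj x₁ ⟶ (e.app _).toFunctor.obj y₁)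
    (β : (e.app _).toFunctor.obj x₂ ⟶ (e.app _).toFunctor.obj y₂)
    (φ : (F.map f₁.op.toLoc).toFunctor.obj x₁ ⟶ (F.map f₂.op.toLoc).toFunctor.obj x₂)
    (ψ : (F.map f₁.op.toLoc).toFunctor.obj y₁ ⟶ (F.map f₂.op.toLoc).toFunctor.obj y₂)
    (h : (G.map f₁.op.toLoc).toFunctor.map α ≫ mapHom e ψ =
      mapHom e φ ≫ (G.map f₂.op.toLoc).toFunctor.map β) :
    (F.map f₁.op.toLoc).toFunctor.map ((e.app _).toFunctor.preimage α) ≫ ψ =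
      φ ≫ (F.map f₂.op.toLoc).toFunctor.map ((e.app _).toFunctor.preimage β) := by
  apply mapHom_injective e
  rwa [mapHom_comp, mapHom_comp, mapHom_map, mapHom_map, Functor.map_preimage,
    Functor.map_preimage]

instance : (mapDescentData e f).Full where
  map_surjective {D₁ D₂} φ :=
    ⟨{  hom i := (e.app _).toFunctor.preimage (φ.hom i)
        comm _ q _ _ f₁ f₂ hf₁ hf₂ := map_preimage_comm e f₁ f₂ _ _ _ _ (φ.comm q f₁ f₂ hf₁ hf₂) },
      by ext i; exact (e.app _).toFunctor.map_preimage _⟩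

instance : (mapDescentData e f).EssSurj where
  mem_essImage D := ⟨(mapDescentData (inverse e) f).obj D,
    ⟨DescentData.isoMk (fun i ↦ counitApp e (D.obj i)) fun _ q _ _ f₁ f₂ hf₁ hf₂ ↦
      map_counitApp_comp e f₁ f₂ (D.hom q f₁ f₂ hf₁ hf₂)⟩⟩

instance : (mapDescentData e f).IsEquivalence where

end descent

/-- In the square `toDescentDataCompMapDescentData` three sides are equivalences, hence so is the
fourth. -/
lemma isEquivalence_toDescentData_of_pointwise (e : F ⟶ G)
    [∀ b, (e.app b).toFunctor.IsEquivalence] {ι : Type t} {S : C} {X : ι → C} (f : ∀ i, X i ⟶ S)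
    [(F.toDescentData f).IsEquivalence] :
    (G.toDescentData f).IsEquivalence := by
  have : ((e.app ⟨op S⟩).toFunctor ⋙ G.toDescentData f).IsEquivalence :=
    Functor.isEquivalence_of_iso (toDescentDataCompMapDescentData e f)
  exact Functor.isEquivalence_of_comp_left (e.app ⟨op S⟩).toFunctor _

lemma isStack_of_pointwise (e : F ⟶ G) [∀ b, (e.app b).toFunctor.IsEquivalence]
    (J : GrothendieckTopology C) [F.IsStack J] : G.IsStack J :=
  .of_isStackFor fun _ R hR ↦ by
    have := (isStackFor_iff _ _).1 (F.isStackFor' (J := J) R hR)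
    exact (isStackFor_iff _ _).2 (isEquivalence_toDescentData_of_pointwise e _)

end StrongTrans

end CategoryTheory.Pseudofunctor

/-! ### The loop stack is a stack. -/

namespace TopStack

open Pseudofunctor.LocallyDiscreteOpToCat

lemma isIso_of_isIso_hom {C : Type (u + 1)} [Category.{u} C] {x y : LoopObj C} (f : x ⟶ y)
    [IsIso f.hom] : IsIso f :=
  ⟨⟨inv f.hom, by rw [IsIso.comp_inv_eq, Category.assoc, IsIso.eq_inv_comp, f.comm]⟩,
    LoopObj.hom_ext (IsIso.hom_inv_id _), LoopObj.hom_ext (IsIso.inv_hom_id _)⟩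

/-- Constructor for isomorphisms of loops. -/
def LoopObj.isoMk {C : Type (u + 1)} [Category.{u} C] {x y : LoopObj C} (f : x.base ≅ y.base)
    (h : x.aut.hom ≫ f.hom = f.hom ≫ y.aut.hom) : x ≅ y where
  hom := ⟨f.hom, h⟩
  inv := ⟨f.inv, by rw [Iso.comp_inv_eq, Category.assoc, Iso.eq_inv_comp, h]⟩
  hom_inv_id := LoopObj.hom_ext f.hom_inv_id
  inv_hom_id := LoopObj.hom_ext f.inv_hom_id

lemma isGroupoid_loopObj (C : Type (u + 1)) [Category.{u} C] [IsGroupoid C] :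
    IsGroupoid (LoopObj C) :=
  ⟨fun f ↦ isIso_of_isIso_hom f⟩

namespace Prestack

variable {X : Prestack.{u}}

lemma pullComp_loopStack_hom {R S T : TopCat.{u}} (f : S ⟶ T) (g : R ⟶ S) (gf : R ⟶ T)
    (h : g ≫ f = gf) (x : (loopStack X).fiber T) :
    LoopObj.Hom.hom ((loopStack X).pullComp f g gf h x).hom =
      (X.pullComp f g gf h (LoopObj.base x)).hom := by
  subst h
  rw [Pseudofunctor.pullComp_rfl, Pseudofunctor.pullComp_rfl]
  -- The second factor is the coherence of the strict 2-functor `loopFunctor`, an identity.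
  exact Category.comp_id _

lemma pullComp_loopStack_inv {R S T : TopCat.{u}} (f : S ⟶ T) (g : R ⟶ S) (gf : R ⟶ T)
    (h : g ≫ f = gf) (x : (loopStack X).fiber T) :
    LoopObj.Hom.hom ((loopStack X).pullComp f g gf h x).inv =
      (X.pullComp f g gf h (LoopObj.base x)).inv := by
  refine (cancel_epi (X.pullComp f g gf h (LoopObj.base x)).hom).1 ?_
  refine (congrArg (· ≫ _) (pullComp_loopStack_hom f g gf h x).symm).trans ?_
  exact (congrArg LoopObj.Hom.hom ((loopStack X).pullComp f g gf h x).hom_inv_id).trans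
    (Iso.hom_inv_id _).symm

lemma pullHom_loopStack_hom {X₁ X₂ Y Y' : TopCat.{u}} {x₁ : (loopStack X).fiber X₁}
    {x₂ : (loopStack X).fiber X₂} {f₁ : Y ⟶ X₁} {f₂ : Y ⟶ X₂}
    (φ : ((loopStack X).pull f₁).obj x₁ ⟶ ((loopStack X).pull f₂).obj x₂)
    (g : Y' ⟶ Y) (gf₁ : Y' ⟶ X₁) (gf₂ : Y' ⟶ X₂) (hgf₁ : g ≫ f₁ = gf₁) (hgf₂ : g ≫ f₂ = gf₂) :
    LoopObj.Hom.hom (pullHom φ g gf₁ gf₂ hgf₁ hgf₂) =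
      pullHom (F := X) (M₁ := LoopObj.base x₁) (M₂ := LoopObj.base x₂) (f₁ := f₁) (f₂ := f₂)
        (LoopObj.Hom.hom φ) g gf₁ gf₂ hgf₁ hgf₂ := by
  exact congrArg₂ (fun s t ↦ s ≫ (X.pull g).map (LoopObj.Hom.hom φ) ≫ t)
    (pullComp_loopStack_hom f₁ g gf₁ hgf₁ x₁) (pullComp_loopStack_inv f₂ g gf₂ hgf₂ x₂)

section descent

universe t

variable {ι : Type t} {S : TopCat.{u}} {U : ι → TopCat.{u}} (f : ∀ i, U i ⟶ S)

/-- The functor forgetting the automorphisms in descent data for the loop stack. -/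
def forgetDescentData : (loopStack X).DescentData f ⥤ X.DescentData f where
  obj D :=
    { obj i := LoopObj.base (D.obj i)
      hom _ q _ _ f₁ f₂ hf₁ hf₂ := LoopObj.Hom.hom (D.hom q f₁ f₂ hf₁ hf₂)
      pullHom_hom _ _ g q q' hq _ _ f₁ f₂ hf₁ hf₂ gf₁ gf₂ hgf₁ hgf₂ :=
        (pullHom_loopStack_hom _ _ _ _ _ _).symm.trans
          (congrArg LoopObj.Hom.hom (D.pullHom_hom g q q' hq f₁ f₂ hf₁ hf₂ gf₁ gf₂ hgf₁ hgf₂))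
      hom_self _ q _ g hg := congrArg LoopObj.Hom.hom (D.hom_self q g hg)
      hom_comp _ q _ _ _ f₁ f₂ f₃ hf₁ hf₂ hf₃ :=
        congrArg LoopObj.Hom.hom (D.hom_comp q f₁ f₂ f₃ hf₁ hf₂ hf₃) }
  map φ :=
    { hom i := LoopObj.Hom.hom (φ.hom i)
      comm _ q _ _ f₁ f₂ hf₁ hf₂ := congrArg LoopObj.Hom.hom (φ.comm q f₁ f₂ hf₁ hf₂) }

lemma toDescentData_loopStack_hom (x : (loopStack X).fiber S) {Y : TopCat.{u}} (q : Y ⟶ S)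
    {i₁ i₂ : ι} (f₁ : Y ⟶ U i₁) (f₂ : Y ⟶ U i₂) (hf₁ : f₁ ≫ f i₁ = q) (hf₂ : f₂ ≫ f i₂ = q) :
    LoopObj.Hom.hom ((((loopStack X).toDescentData f).obj x).hom q f₁ f₂ hf₁ hf₂) =
      ((X.toDescentData f).obj (LoopObj.base x)).hom q f₁ f₂ hf₁ hf₂ :=
  congrArg₂ (· ≫ ·) (pullComp_loopStack_inv (f i₁) f₁ q hf₁ x)
    (pullComp_loopStack_hom (f i₂) f₂ q hf₂ x)

/-- The automorphism of the descent datum underlying a descent datum for the loop stack. -/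
def autDescentData (D : (loopStack X).DescentData f) :
    (forgetDescentData f).obj D ≅ (forgetDescentData f).obj D :=
  Pseudofunctor.DescentData.isoMk (fun i ↦ LoopObj.aut (D.obj i)) fun _ q _ _ f₁ f₂ hf₁ hf₂ ↦
    (D.hom q f₁ f₂ hf₁ hf₂).comm

/-- A descent datum for the loop stack is a descent datum for `X` with an automorphism of it. The
underlying object descends by essential surjectivity for `X`, then morphisms and automorphisms
descend by full faithfulness. -/
lemma isEquivalence_toDescentData_loopStack [(X.toDescentData f).IsEquivalence] :
    ((loopStack X).toDescentData f).IsEquivalence where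
  faithful := ⟨fun {x y φ ψ} h ↦ LoopObj.hom_ext ((X.toDescentData f).map_injective (by
    ext i
    exact congrArg LoopObj.Hom.hom (congrArg (fun t ↦ Pseudofunctor.DescentData.Hom.hom t i) h)))⟩
  full := ⟨fun {x y} φ ↦ by
    let φ' : (X.toDescentData f).obj (LoopObj.base x) ⟶ (X.toDescentData f).obj (LoopObj.base y) :=
      { hom i := LoopObj.Hom.hom (φ.hom i)
        comm _ q _ _ f₁ f₂ hf₁ hf₂ := by
          rw [← toDescentData_loopStack_hom, ← toDescentData_loopStack_hom]
          exact congrArg LoopObj.Hom.hom (φ.comm q f₁ f₂ hf₁ hf₂) }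
    refine ⟨LoopObj.Hom.mk ((X.toDescentData f).preimage φ') ?_, ?_⟩
    · apply (X.toDescentData f).map_injective
      rw [Functor.map_comp, Functor.map_comp, Functor.map_preimage]
      ext i
      exact (φ.hom i).comm
    · ext i
      apply LoopObj.hom_ext
      exact congrArg (fun t ↦ Pseudofunctor.DescentData.Hom.hom t i)
        ((X.toDescentData f).map_preimage φ')⟩
  essSurj := ⟨fun D ↦ by
    let D' := (forgetDescentData f).obj D
    let j := (X.toDescentData f).objObjPreimageIso D'
    -- The automorphism of the descent datum is conjugated by `j` and then lifted by full
    -- faithfulness.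
    let a := (X.toDescentData f).preimageIso (j ≪≫ autDescentData f D ≪≫ j.symm)
    have ha : (X.toDescentData f).map a.hom ≫ j.hom = j.hom ≫ (autDescentData f D).hom := by
      simp [a]
    refine ⟨LoopObj.mk ((X.toDescentData f).objPreimage D') a, ⟨?_⟩⟩
    refine Pseudofunctor.DescentData.isoMk (fun i ↦ LoopObj.isoMk
      ⟨j.hom.hom i, j.inv.hom i, ?_, ?_⟩ ?_) ?_
    · exact congrArg (fun t ↦ Pseudofunctor.DescentData.Hom.hom t i) j.hom_inv_id
    · exact congrArg (fun t ↦ Pseudofunctor.DescentData.Hom.hom t i) j.inv_hom_id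
    · exact congrArg (fun t ↦ Pseudofunctor.DescentData.Hom.hom t i) ha
    · intro Y q i₁ i₂ f₁ f₂ hf₁ hf₂
      apply LoopObj.hom_ext
      refine (j.hom.comm q f₁ f₂ hf₁ hf₂).trans ?_
      exact congrArg (· ≫ _) 
        (toDescentData_loopStack_hom (X := X) f (LoopObj.mk _ a) q f₁ f₂ hf₁ hf₂).symm⟩

end descent

lemma isStackInGroupoids_loopStack (hX : X.IsStackInGroupoids) :
    (loopStack X).IsStackInGroupoids where
  isGroupoid T := by
    have := hX.isGroupoid T
    exact isGroupoid_loopObj (X.fiber T)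
  isStack := by
    have := hX.isStack
    exact .of_isStackFor fun _ R hR ↦ by
      have := (Pseudofunctor.isStackFor_iff _ _).1
        (Pseudofunctor.isStackFor' X (J := TopCat.grothendieckTopology.{u}) R hR)
      exact (Pseudofunctor.isStackFor_iff _ _).2 (isEquivalence_toDescentData_loopStack _)

end Prestack

end TopStack

/-! ### Coverings by local sections, and morphisms of principal bundles. -/

namespace TopStack

/-- A map of spaces that admits local sections generates a covering sieve. -/
lemma ofArrows_mem_of_localSections {P T : TopCat.{u}} (π : P ⟶ T)
    (h : ∀ t : T, ∃ U : TopologicalSpace.Opens T, t ∈ U ∧ ∃ s : C(U, P), ∀ x : U, π (s x) = x) :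
    Sieve.ofArrows (fun _ : PUnit.{1} ↦ P) (fun _ ↦ π) ∈
      TopCat.grothendieckTopology.{u} T := by
  choose U hU s hs using h
  let V : T → TopCat.{u} := fun t ↦ TopCat.of (U t)
  let i : ∀ t, V t ⟶ T := fun t ↦ TopCat.ofHom ⟨Subtype.val, continuous_subtype_val⟩
  have hR : Presieve.ofArrows V i ∈ TopCat.precoverage.{u} T := by
    refine ⟨?_, ?_⟩
    · rw [Precoverage.mem_comap_iff, Presieve.map_ofArrows,
        Types.ofArrows_mem_jointlySurjectivePrecoverage_iff]
      exact fun t ↦ ⟨t, ⟨t, hU t⟩, rfl⟩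
    · rw [MorphismProperty.ofArrows_mem_precoverage]
      exact fun t ↦ (U t).2.isOpenEmbedding_subtypeVal
  -- A section over `U t` factors the inclusion of `U t` through `π`, so the sieve of `π` contains
  -- the one generated by the open cover.
  refine GrothendieckTopology.superset_covering _ ?_
    (Precoverage.generate_mem_toGrothendieck hR)
  rw [Sieve.generate_le_iff]
  rintro _ _ ⟨t⟩
  exact ⟨P, TopCat.ofHom (s t), π, ⟨PUnit.unit⟩, TopCat.hom_ext (ContinuousMap.ext (hs t))⟩

namespace PrincipalBundle

variable {G : TopGroupoid.{u}} {T : TopCat.{u}}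

lemma act_congr (P : PrincipalBundle G T) {p p' : P.total} {γ γ' : G.Arr} (hp : p = p')
    (hγ : γ = γ') (h : P.anchor p = G.src γ) :
    P.act ⟨(p, γ), h⟩ = P.act ⟨(p', γ'), by rw [← hp, ← hγ, h]⟩ := by
  subst hp hγ; rfl

lemma proj_surjective (P : PrincipalBundle G T) : Function.Surjective P.proj := fun t ↦ by
  obtain ⟨U, hU, s, hs⟩ := P.localSections t
  exact ⟨s ⟨t, hU⟩, hs _⟩

lemma continuous_act (P : PrincipalBundle G T) {Z : Type*} [TopologicalSpace Z] {f : Z → P.total}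
    {g : Z → G.Arr} (hf : Continuous f) (hg : Continuous g)
    (h : ∀ z, P.anchor (f z) = G.src (g z)) :
    Continuous fun z ↦ P.act ⟨(f z, g z), h z⟩ :=
  P.act.hom.continuous.comp ((hf.prodMk hg).subtype_mk _)

/-- An equivariant map carries `p · γ = p'` to `φ p · γ = φ p'`, and the arrow between two points of
a fibre is unique. -/
lemma div_hom {P Q : PrincipalBundle G T} (φ : P ⟶ Q) (p p' : P.total)
    (h : P.proj p = P.proj p') (h' : Q.proj (φ.hom p) = Q.proj (φ.hom p')) :
    Q.div (φ.hom p) (φ.hom p') h' = P.div p p' h := by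
  have e : Q.act ⟨(φ.hom p, P.div p p' h),
      (φ.anchor_hom p).trans (P.anchor_eq_src_div p p' h)⟩ = φ.hom p' := by
    rw [← φ.hom_act p _ (P.anchor_eq_src_div p p' h), P.act_div]
  have := Q.div_act (φ.hom p) (P.div p p' h) ((φ.anchor_hom p).trans (P.anchor_eq_src_div p p' h))
  simp only [e] at this
  exact this

/-- Torsor argument. If `φ p = φ p'`, the arrow from `p` to `p'` is an identity by `div_hom`. A
point `q` is reached from the image of any point of `P` over the same base point by acting with the
arrow between them. -/
lemma hom_bijective {P Q : PrincipalBundle G T} (φ : P ⟶ Q) : Function.Bijective φ.hom := by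
  refine ⟨fun p p' h ↦ ?_, fun q ↦ ?_⟩
  · have h₀ : P.proj p = P.proj p' := by rw [← φ.proj_hom, h, φ.proj_hom]
    have h₁ := div_hom φ p p' h₀ (by rw [h])
    have h₂ : Q.div (φ.hom p) (φ.hom p') (by rw [h]) = G.one (Q.anchor (φ.hom p)) := by
      have := Q.div_act (φ.hom p) (G.one (Q.anchor (φ.hom p))) (G.src_one _).symm
      simp only [Q.act_one] at this
      simpa only [← h] using this
    have h₃ := P.act_div p p' h₀
    rw [P.act_congr rfl (h₁.symm.trans (h₂.trans (congrArg G.one (φ.anchor_hom p)))),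
      P.act_one] at h₃
    exact h₃
  · obtain ⟨p, hp⟩ := P.proj_surjective (Q.proj q)
    have h : Q.proj (φ.hom p) = Q.proj q := by rw [φ.proj_hom, hp]
    exact ⟨P.act ⟨(p, Q.div (φ.hom p) q h),
      (φ.anchor_hom p).symm.trans (Q.anchor_eq_src_div _ _ _)⟩, by rw [φ.hom_act, Q.act_div]⟩

/-- Continuity of the inverse is local on the base: over an open set with a section `s` of `P`, the
inverse sends `q` over `x` to `s x` acted on by the arrow from `φ (s x)` to `q`. -/
lemma isHomeomorph_hom {P Q : PrincipalBundle G T} (φ : P ⟶ Q) : IsHomeomorph φ.hom := by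
  let E := Equiv.ofBijective _ (hom_bijective φ)
  have hE : ∀ q, φ.hom (E.symm q) = q := E.apply_symm_apply
  refine isHomeomorph_iff_exists_homeomorph.2 ⟨⟨E, φ.hom.hom.continuous, ?_⟩, rfl⟩
  rw [continuous_iff_continuousAt]
  intro q₀
  obtain ⟨U, hU, s, hs⟩ := P.localSections (Q.proj q₀)
  let V : Set Q.total := Q.proj ⁻¹' U
  have hV : IsOpen V := U.2.preimage Q.proj.hom.continuous
  refine ContinuousOn.continuousAt (s := V) ?_ (hV.mem_nhds hU)
  rw [continuousOn_iff_continuous_domRestrict]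
  have hs' : ∀ z : V, P.proj (s ⟨Q.proj z.1, z.2⟩) = Q.proj z.1 := fun z ↦ hs _
  have hq : ∀ z : V, Q.proj (φ.hom (s ⟨Q.proj z.1, z.2⟩)) = Q.proj z.1 := fun z ↦ by
    rw [φ.proj_hom, hs']
  have hcs : Continuous fun z : V ↦ s ⟨Q.proj z.1, z.2⟩ :=
    s.continuous.comp ((Q.proj.hom.continuous.comp continuous_subtype_val).subtype_mk _)
  have hc : Continuous fun z : V ↦ P.act ⟨(s ⟨Q.proj z.1, z.2⟩,
      Q.div (φ.hom (s ⟨Q.proj z.1, z.2⟩)) z.1 (hq z)),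
      (φ.anchor_hom _).symm.trans (Q.anchor_eq_src_div _ _ _)⟩ :=
    P.continuous_act hcs (continuous_div (φ.hom.hom.continuous.comp hcs)
      continuous_subtype_val _) _
  refine hc.congr fun z ↦ (hom_bijective φ).1 ?_
  rw [φ.hom_act, Q.act_div]
  exact (hE z.1).symm

lemma isIso_of_hom {P Q : PrincipalBundle G T} (φ : P ⟶ Q) : IsIso φ := by
  let E := (isHomeomorph_hom φ).homeomorph
  have hE : ∀ q, φ.hom (E.symm q) = q := E.apply_symm_apply
  let ψ : Q ⟶ P :=
    { hom := TopCat.ofHom ⟨E.symm, E.symm.continuous⟩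
      proj_hom q := (φ.proj_hom _).symm.trans (congrArg Q.proj (hE q))
      anchor_hom q := (φ.anchor_hom _).symm.trans (congrArg Q.anchor (hE q))
      hom_act q γ h := (hom_bijective φ).1 ((hE _).trans
        ((φ.hom_act _ _ ((φ.anchor_hom _).symm.trans
          ((congrArg Q.anchor (hE q)).trans h))).trans (Q.act_congr (hE q) rfl _)).symm) }
  exact ⟨ψ, hom_ext E.symm_apply_apply, hom_ext E.apply_symm_apply⟩

lemma isGroupoid : IsGroupoid (PrincipalBundle G T) := ⟨isIso_of_hom⟩

end PrincipalBundle

end TopStack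

/-! ### Coherence of pull-backs, and descent along one map with local sections. -/

namespace CategoryTheory.Pseudofunctor

open LocallyDiscreteOpToCat

universe v v' u₁ u'

variable {C : Type u₁} [Category.{v} C] {F : LocallyDiscrete Cᵒᵖ ⥤ᵖ Cat.{v', u'}}

/-- A morphism that comes from the base has restrictions that depend only on the map `q` to the
base, not on `k`. This is why the induced maps of bundles are equivariant. -/
lemma pullHom_map {P S T : C} {y y' : F.obj ⟨op T⟩} (χ : y ⟶ y') (π : P ⟶ T) (k : S ⟶ P)
    (q : S ⟶ T) (h h' : k ≫ π = q) :
    pullHom ((F.map π.op.toLoc).toFunctor.map χ) k q q h h' = (F.map q.op.toLoc).toFunctor.map χ :=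
  mapComp'_naturality_2 F π.op.toLoc k.op.toLoc q.op.toLoc (by rw [← h]; rfl) χ

lemma pullComp_id_inv {S T : C} (π : S ⟶ T) (h : π ≫ 𝟙 T = π) (y : F.obj ⟨op T⟩) :
    (F.pullComp (𝟙 T) π π h y).inv =
      (F.map π.op.toLoc).toFunctor.map (F.idIsoApp ⟨op T⟩ y).hom := by
  have := F.mapComp'_id_comp_inv_app π.op.toLoc y
  exact this

lemma map_pullComp_hom_comp {R S T U : C} (f : T ⟶ U) (g : S ⟶ T) (k : R ⟶ S) (gf : S ⟶ U)
    (kg : R ⟶ T) (kgf : R ⟶ U) (h₁ : g ≫ f = gf) (h₂ : k ≫ g = kg) (h₃ : kg ≫ f = kgf)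
    (h₄ : k ≫ gf = kgf) (x : F.obj ⟨op U⟩) :
    (F.map k.op.toLoc).toFunctor.map (F.pullComp f g gf h₁ x).hom ≫
      (F.pullComp g k kg h₂ _).inv ≫ (F.pullComp f kg kgf h₃ x).inv =
      (F.pullComp gf k kgf h₄ x).inv := by
  have := F.mapComp'₀₂₃_inv_app f.op.toLoc g.op.toLoc k.op.toLoc gf.op.toLoc kg.op.toLoc
    kgf.op.toLoc (by rw [← h₁]; rfl) (by rw [← h₂]; rfl) (by rw [← h₄]; rfl) x
  exact this.symm

/-- Associativity of iterated pull-backs: a comparison isomorphism restricts to a comparison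
isomorphism. The composites `gf`, `kg`, `kgf` are variables, so that no transport along equalities
of maps arises. -/
lemma pullHom_pullComp_inv {R S T U : C} (f : T ⟶ U) (g : S ⟶ T) (k : R ⟶ S) (gf : S ⟶ U)
    (kg : R ⟶ T) (kgf : R ⟶ U) (h₁ : g ≫ f = gf) (h₂ : k ≫ g = kg) (h₃ : kg ≫ f = kgf)
    (h₄ : k ≫ gf = kgf) (x : F.obj ⟨op U⟩) :
    pullHom (F.pullComp f g gf h₁ x).inv k kg kgf h₂ h₄ = (F.pullComp f kg kgf h₃ x).inv := by
  rw [pullHom_eq_pullComp, ← map_pullComp_hom_comp f g k gf kg kgf h₁ h₂ h₃ h₄,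
    ← Functor.map_comp_assoc, Iso.inv_hom_id, Functor.map_id, Category.id_comp,
    Iso.hom_inv_id_assoc]

lemma pullHom_pullComp_hom {R S T U : C} (f : T ⟶ U) (g : S ⟶ T) (k : R ⟶ S) (gf : S ⟶ U)
    (kg : R ⟶ T) (kgf : R ⟶ U) (h₁ : g ≫ f = gf) (h₂ : k ≫ g = kg) (h₃ : kg ≫ f = kgf)
    (h₄ : k ≫ gf = kgf) (x : F.obj ⟨op U⟩) :
    pullHom (F.pullComp f g gf h₁ x).hom k kgf kg h₄ h₂ = (F.pullComp f kg kgf h₃ x).hom := by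
  rw [← cancel_mono (F.pullComp f kg kgf h₃ x).inv, Iso.hom_inv_id, pullHom_eq_pullComp,
    Category.assoc, Category.assoc, map_pullComp_hom_comp f g k gf kg kgf h₁ h₂ h₃ h₄,
    Iso.hom_inv_id]

end CategoryTheory.Pseudofunctor

namespace TopStack

open Pseudofunctor Pseudofunctor.LocallyDiscreteOpToCat

namespace Prestack

variable {Y : Prestack.{u}}

section descent

variable [Y.IsStack TopCat.grothendieckTopology.{u}] {P T : TopCat.{u}} (π : P ⟶ T)
  (hπ : Sieve.ofArrows (fun _ : PUnit.{1} ↦ P) (fun _ ↦ π) ∈ TopCat.grothendieckTopology.{u} T)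

include hπ

lemma pull_map_injective {y y' : Y.fiber T} {ψ ψ' : y ⟶ y'}
    (h : (Y.pull π).map ψ = (Y.pull π).map ψ') : ψ = ψ' := by
  have := Y.isEquivalence_toDescentData (fun _ : PUnit.{1} ↦ π) hπ
  apply (Y.toDescentData (fun _ : PUnit.{1} ↦ π)).map_injective
  ext
  exact h

/-- Descent of morphisms for the one-element cover `π`. Testing on all pairs `k`, `k'` replaces the
two projections of `P ×_T P`. -/
lemma exists_pull_map_eq {y y' : Y.fiber T} (θ : (Y.pull π).obj y ⟶ (Y.pull π).obj y')
    (hθ : ∀ {S : TopCat.{u}} (k k' : S ⟶ P) (q : S ⟶ T) (h : k ≫ π = q) (h' : k' ≫ π = q),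
      pullHom θ k q q h h = pullHom θ k' q q h' h') :
    ∃ ψ : y ⟶ y', (Y.pull π).map ψ = θ := by
  have := Y.isEquivalence_toDescentData (fun _ : PUnit.{1} ↦ π) hπ
  let φ : (Y.toDescentData (fun _ : PUnit.{1} ↦ π)).obj y ⟶
      (Y.toDescentData (fun _ : PUnit.{1} ↦ π)).obj y' :=
    { hom _ := θ
      comm _ q _ _ f₁ f₂ hf₁ hf₂ := by
        have e₁ := map_eq_pullHom (F := Y) θ f₁ q q hf₁ hf₁
        have e₂ := map_eq_pullHom (F := Y) θ f₂ q q hf₂ hf₂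
        rw [hθ f₁ f₂ q hf₁ hf₂] at e₁
        refine (congrArg (· ≫ _) e₁).trans (Eq.trans ?_ (congrArg (_ ≫ ·) e₂).symm)
        change ((Y.pullComp π f₁ q hf₁ y).inv ≫ pullHom θ f₂ q q hf₂ hf₂ ≫
          (Y.pullComp π f₁ q hf₁ y').hom) ≫ (Y.pullComp π f₁ q hf₁ y').inv ≫
          (Y.pullComp π f₂ q hf₂ y').hom = ((Y.pullComp π f₁ q hf₁ y).inv ≫
          (Y.pullComp π f₂ q hf₂ y).hom) ≫ (Y.pullComp π f₂ q hf₂ y).inv ≫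
          pullHom θ f₂ q q hf₂ hf₂ ≫ (Y.pullComp π f₂ q hf₂ y').hom
        simp only [Category.assoc, Iso.hom_inv_id_assoc] }
  obtain ⟨ψ, hψ⟩ := (Y.toDescentData (fun _ : PUnit.{1} ↦ π)).map_surjective φ
  exact ⟨ψ, congrArg (fun t ↦ DescentData.Hom.hom t PUnit.unit) hψ⟩

/-- Descent of objects for the cover `π`, applied to `α^* b`. The cocycle `ρ` is written between
pull-backs of `b` along composites `k ≫ α`, the form in which arrows of a groupoid provide it;
`pullComp` converts it into a descent datum. -/
lemma exists_descent {B : TopCat.{u}} (α : P ⟶ B) (b : Y.fiber B)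
    (ρ : ∀ {S : TopCat.{u}} (k k' : S ⟶ P), k ≫ π = k' ≫ π →
      ((Y.pull (k ≫ α)).obj b ⟶ (Y.pull (k' ≫ α)).obj b))
    (ρ_pull : ∀ {S S' : TopCat.{u}} (l : S' ⟶ S) (k k' : S ⟶ P) (h : k ≫ π = k' ≫ π)
      (lk lk' : S' ⟶ P) (hk : l ≫ k = lk) (hk' : l ≫ k' = lk') (h' : lk ≫ π = lk' ≫ π),
      pullHom (ρ k k' h) l (lk ≫ α) (lk' ≫ α) (by rw [← hk, Category.assoc])
        (by rw [← hk', Category.assoc]) = ρ lk lk' h')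
    (ρ_self : ∀ {S : TopCat.{u}} (k : S ⟶ P), ρ k k rfl = 𝟙 _)
    (ρ_comp : ∀ {S : TopCat.{u}} (k k' k'' : S ⟶ P) (h : k ≫ π = k' ≫ π)
      (h' : k' ≫ π = k'' ≫ π), ρ k k' h ≫ ρ k' k'' h' = ρ k k'' (h.trans h')) :
    ∃ (y : Y.fiber T) (j : (Y.pull π).obj y ≅ (Y.pull α).obj b),
      ∀ {S : TopCat.{u}} (k k' : S ⟶ P) (h : k ≫ π = k' ≫ π),
        pullHom j.hom k (k ≫ π) (k ≫ α) rfl rfl ≫ ρ k k' h =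
          pullHom j.hom k' (k ≫ π) (k' ≫ α) h.symm rfl := by
  have := Y.isEquivalence_toDescentData (fun _ : PUnit.{1} ↦ π) hπ
  let D : Y.DescentData (fun _ : PUnit.{1} ↦ π) :=
    { obj _ := (Y.pull α).obj b
      hom _ q _ _ f₁ f₂ hf₁ hf₂ := (Y.pullComp α f₁ _ rfl b).inv ≫ ρ f₁ f₂ (hf₁.trans hf₂.symm) ≫
        (Y.pullComp α f₂ _ rfl b).hom
      pullHom_hom S' S g q q' hq _ _ f₁ f₂ hf₁ hf₂ gf₁ gf₂ hgf₁ hgf₂ := by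
        rw [← pullHom_comp (f₂ := f₁ ≫ α) (kf₂ := gf₁ ≫ α) (h₂ := by rw [← hgf₁, Category.assoc]),
          ← pullHom_comp (f₂ := f₂ ≫ α) (kf₂ := gf₂ ≫ α) (h₂ := by rw [← hgf₂, Category.assoc]),
          pullHom_pullComp_inv α f₁ g _ gf₁ _ rfl hgf₁ rfl,
          pullHom_pullComp_hom α f₂ g _ gf₂ _ rfl hgf₂ rfl,
          ρ_pull g f₁ f₂ _ gf₁ gf₂ hgf₁ hgf₂]
      hom_self _ q _ g hg := by rw [ρ_self, Category.id_comp, Iso.inv_hom_id]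
      hom_comp _ q _ _ _ f₁ f₂ f₃ hf₁ hf₂ hf₃ := by
        simp only [Category.assoc, Iso.hom_inv_id_assoc]
        rw [reassoc_of% ρ_comp] }
  let i := (Y.toDescentData (fun _ : PUnit.{1} ↦ π)).objObjPreimageIso D
  let j : (Y.pull π).obj ((Y.toDescentData (fun _ : PUnit.{1} ↦ π)).objPreimage D) ≅
      (Y.pull α).obj b :=
    ⟨i.hom.hom PUnit.unit, i.inv.hom PUnit.unit,
      congrArg (fun t ↦ DescentData.Hom.hom t PUnit.unit) i.hom_inv_id,
      congrArg (fun t ↦ DescentData.Hom.hom t PUnit.unit) i.inv_hom_id⟩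
  refine ⟨_, j, fun {S} k k' h ↦ ?_⟩
  have e₁ := map_eq_pullHom (F := Y) j.hom k (k ≫ π) (k ≫ α) rfl rfl
  have e₂ := map_eq_pullHom (F := Y) j.hom k' (k ≫ π) (k' ≫ α) h.symm rfl
  have e := i.hom.comm (i₁ := PUnit.unit) (i₂ := PUnit.unit) (k ≫ π) k k' rfl h.symm
  replace e := (congrArg (· ≫ _) e₁).symm.trans (e.trans (congrArg (_ ≫ ·) e₂))
  change ((Y.pullComp π k _ rfl _).inv ≫ pullHom j.hom k (k ≫ π) (k ≫ α) rfl rfl ≫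
    (Y.pullComp α k _ rfl _).hom) ≫ (Y.pullComp α k _ rfl b).inv ≫ ρ k k' _ ≫
        (Y.pullComp α k' _ rfl b).hom = ((Y.pullComp π k _ rfl _).inv ≫
          (Y.pullComp π k' _ h.symm _).hom) ≫ (Y.pullComp π k' _ h.symm _).inv ≫
          pullHom j.hom k' (k ≫ π) (k' ≫ α) h.symm rfl ≫ (Y.pullComp α k' _ rfl _).hom at e
  simp only [Category.assoc, Iso.hom_inv_id_assoc, cancel_epi] at e
  rwa [← Category.assoc, cancel_mono] at e

end descent

end Prestack

end TopStack

/-! ### Universal frames and the principal bundles they carry. -/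

namespace TopStack

open Pseudofunctor Pseudofunctor.LocallyDiscreteOpToCat

lemma apply_eq_of_comp_eq {S Z Z' B : TopCat.{u}} {k : S ⟶ Z} {l : S ⟶ Z'} {α : Z ⟶ B}
    {β : Z' ⟶ B} (h : k ≫ α = l ≫ β) (s : S) : α (k s) = β (l s) :=
  congrArg (fun m : S ⟶ B ↦ m s) h

namespace Prestack

variable {Y : Prestack.{u}}

lemma pullHom_congr {T₁ T₂ S S' : TopCat.{u}} {u₁ : Y.fiber T₁} {u₂ : Y.fiber T₂}
    {f₁ : S ⟶ T₁} {f₂ : S ⟶ T₂} (φ : (Y.pull f₁).obj u₁ ⟶ (Y.pull f₂).obj u₂)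
    {k k' : S' ⟶ S} (e : k = k') (kf₁ : S' ⟶ T₁) (kf₂ : S' ⟶ T₂)
    (h₁ : k ≫ f₁ = kf₁) (h₂ : k ≫ f₂ = kf₂) (h₁' : k' ≫ f₁ = kf₁) (h₂' : k' ≫ f₂ = kf₂) :
    pullHom φ k kf₁ kf₂ h₁ h₂ = pullHom φ k' kf₁ kf₂ h₁' h₂' := by
  subst e; rfl

instance isIso_pullHom {T₁ T₂ S S' : TopCat.{u}} {u₁ : Y.fiber T₁} {u₂ : Y.fiber T₂}
    {f₁ : S ⟶ T₁} {f₂ : S ⟶ T₂} (φ : (Y.pull f₁).obj u₁ ⟶ (Y.pull f₂).obj u₂) [IsIso φ]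
    (k : S' ⟶ S) (kf₁ : S' ⟶ T₁) (kf₂ : S' ⟶ T₂) (h₁ : k ≫ f₁ = kf₁) (h₂ : k ≫ f₂ = kf₂) :
    IsIso (pullHom φ k kf₁ kf₂ h₁ h₂) :=
  (pullIso (asIso φ) k kf₁ kf₂ h₁ h₂).isIso_hom

/-- Maps from a space to `T` and to `B`, with a morphism between the pull-backs of `y` and `b`. -/
structure Frame {T B : TopCat.{u}} (y : Y.fiber T) (b : Y.fiber B) where
  /-- the space -/
  total : TopCat.{u}
  /-- the map to `T` -/
  proj : total ⟶ T
  /-- the map to `B` -/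
  anchor : total ⟶ B
  /-- the morphism -/
  hom : (Y.pull proj).obj y ⟶ (Y.pull anchor).obj b

/-- A frame is universal if it represents the presheaf of all frames. -/
structure Frame.IsUniversal {T B : TopCat.{u}} {y : Y.fiber T} {b : Y.fiber B}
    (E : Frame y b) : Prop where
  exists_lift {S : TopCat.{u}} (f : S ⟶ T) (g : S ⟶ B)
    (φ : (Y.pull f).obj y ⟶ (Y.pull g).obj b) :
    ∃ (k : S ⟶ E.total) (h : k ≫ E.proj = f) (h' : k ≫ E.anchor = g),
      pullHom E.hom k f g h h' = φ
  hom_ext {S : TopCat.{u}} (k k' : S ⟶ E.total) (f : S ⟶ T) (g : S ⟶ B) (h : k ≫ E.proj = f)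
    (h' : k ≫ E.anchor = g) (l : k' ≫ E.proj = f) (l' : k' ≫ E.anchor = g)
    (e : pullHom E.hom k f g h h' = pullHom E.hom k' f g l l') : k = k'

end Prestack

namespace TopGroupoid

variable {G : TopGroupoid.{u}} {S : TopCat.{u}}

/-- The product of two families of arrows. -/
def mulMap (k l : S ⟶ G.Arr) (h : k ≫ G.tgt = l ≫ G.src) : S ⟶ G.Arr :=
  TopCat.ofHom ⟨fun s ↦ G.mul (k s) (l s) (apply_eq_of_comp_eq h s),
    continuous_mul k.hom.continuous l.hom.continuous (apply_eq_of_comp_eq h)⟩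

lemma mulMap_src (k l : S ⟶ G.Arr) (h : k ≫ G.tgt = l ≫ G.src) :
    mulMap k l h ≫ G.src = k ≫ G.src := by
  ext s; exact src_mul (k s) (l s) _

lemma mulMap_tgt (k l : S ⟶ G.Arr) (h : k ≫ G.tgt = l ≫ G.src) :
    mulMap k l h ≫ G.tgt = l ≫ G.tgt := by
  ext s; exact tgt_mul (k s) (l s) _

end TopGroupoid

namespace PrincipalBundle

variable {G : TopGroupoid.{u}} {S T : TopCat.{u}} (P : PrincipalBundle G T)

/-- The action of a family of arrows on a family of points of a principal bundle. -/
def actMap (k : S ⟶ P.total) (l : S ⟶ G.Arr) (h : k ≫ P.anchor = l ≫ G.src) : S ⟶ P.total :=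
  TopCat.ofHom ⟨fun s ↦ P.act ⟨(k s, l s), apply_eq_of_comp_eq h s⟩,
    P.continuous_act k.hom.continuous l.hom.continuous (apply_eq_of_comp_eq h)⟩

lemma actMap_proj (k : S ⟶ P.total) (l : S ⟶ G.Arr) (h : k ≫ P.anchor = l ≫ G.src) :
    P.actMap k l h ≫ P.proj = k ≫ P.proj := by
  ext s; exact P.proj_act (k s) (l s) _

lemma actMap_anchor (k : S ⟶ P.total) (l : S ⟶ G.Arr) (h : k ≫ P.anchor = l ≫ G.src) :
    P.actMap k l h ≫ P.anchor = l ≫ G.tgt := by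
  ext s; exact P.anchor_act (k s) (l s) _

end PrincipalBundle

namespace GroupoidMap

open Prestack

variable {G : TopGroupoid.{u}} {Y : Prestack.{u}} (D : GroupoidMap G Y)

/-- The frame of `D.obj` on the space of arrows given by `D.glue`. -/
def unitFrame : Frame D.obj D.obj := ⟨G.Arr, G.src, G.tgt, D.glue⟩

/-- `D : G⁰ → Y` presents `Y`: the 2-morphism over `G¹` is multiplicative, `G¹` represents
`G⁰ ×_Y G⁰`, and the fibre products `T ×_Y G⁰` are spaces with local sections over `T`. -/
structure IsPresentation : Prop where
  glue_mul {S : TopCat.{u}} (k l : S ⟶ G.Arr) (f g g' : S ⟶ G.Obj) (hk : k ≫ G.src = f)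
    (hk' : k ≫ G.tgt = g) (hl : l ≫ G.src = g) (hl' : l ≫ G.tgt = g') :
    pullHom D.glue k f g hk hk' ≫ pullHom D.glue l g g' hl hl' =
      pullHom D.glue (TopGroupoid.mulMap k l (hk'.trans hl.symm)) f g'
        ((TopGroupoid.mulMap_src _ _ _).trans hk) ((TopGroupoid.mulMap_tgt _ _ _).trans hl')
  isUniversal_unitFrame : D.unitFrame.IsUniversal
  exists_frame {T : TopCat.{u}} (y : Y.fiber T) : ∃ E : Frame y D.obj, E.IsUniversal ∧
    ∀ t : T, ∃ U : TopologicalSpace.Opens T, t ∈ U ∧ ∃ s : C(U, E.total), ∀ x : U,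
      E.proj (s x) = x

/-- A principal bundle over `T` with an equivariant morphism over its total space between the
pull-backs of `y` and of `D.obj`. -/
structure FramedBundle {T : TopCat.{u}} (y : Y.fiber T) where
  /-- the principal bundle -/
  bundle : PrincipalBundle G T
  /-- the morphism -/
  hom : (Y.pull bundle.proj).obj y ⟶ (Y.pull bundle.anchor).obj D.obj
  hom_act {S : TopCat.{u}} (k : S ⟶ bundle.total) (l : S ⟶ G.Arr) (f : S ⟶ T) (g g' : S ⟶ G.Obj)
    (hk : k ≫ bundle.proj = f) (hk' : k ≫ bundle.anchor = g) (hl : l ≫ G.src = g)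
    (hl' : l ≫ G.tgt = g') :
    pullHom hom k f g hk hk' ≫ pullHom D.glue l g g' hl hl' =
      pullHom hom (bundle.actMap k l (hk'.trans hl.symm)) f g'
        ((bundle.actMap_proj _ _ _).trans hk) ((bundle.actMap_anchor _ _ _).trans hl')

/-- The frame underlying a framed bundle. -/
def FramedBundle.frame {D : GroupoidMap G Y} {T : TopCat.{u}} {y : Y.fiber T}
    (P : D.FramedBundle y) : Frame y D.obj :=
  ⟨P.bundle.total, P.bundle.proj, P.bundle.anchor, P.hom⟩

variable {D}

namespace IsPresentation

lemma exists_arrow (hD : D.IsPresentation) {S : TopCat.{u}} (f g : S ⟶ G.Obj)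
    (φ : (Y.pull f).obj D.obj ⟶ (Y.pull g).obj D.obj) :
    ∃ (d : S ⟶ G.Arr) (h : d ≫ G.src = f) (h' : d ≫ G.tgt = g), pullHom D.glue d f g h h' = φ :=
  hD.isUniversal_unitFrame.exists_lift f g φ

lemma arrow_ext (hD : D.IsPresentation) {S : TopCat.{u}} (d d' : S ⟶ G.Arr) (f g : S ⟶ G.Obj)
    (h : d ≫ G.src = f) (h' : d ≫ G.tgt = g) (l : d' ≫ G.src = f) (l' : d' ≫ G.tgt = g)
    (e : pullHom D.glue d f g h h' = pullHom D.glue d' f g l l') : d = d' :=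
  hD.isUniversal_unitFrame.hom_ext d d' f g h h' l l' e

/-- Since `1 · 1 = 1`, multiplicativity makes this isomorphism idempotent, and an idempotent
isomorphism is the identity. -/
lemma pullHom_one_glue [∀ T, IsGroupoid (Y.fiber T)] (hD : D.IsPresentation)
    {S : TopCat.{u}} (x : S ⟶ G.Obj) (h : (x ≫ G.one) ≫ G.src = x)
    (h' : (x ≫ G.one) ≫ G.tgt = x) :
    pullHom D.glue (x ≫ G.one) x x h h' = 𝟙 _ := by
  have e := hD.glue_mul (x ≫ G.one) (x ≫ G.one) x x x h h' h h'
  replace e := e.trans (pullHom_congr D.glue (k' := x ≫ G.one) (by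
    ext s
    exact TopGroupoid.one_mul _ (x s) _) x x _ _ h h')
  have : IsIso D.glue := IsGroupoid.all_isIso _
  rwa [← cancel_epi (pullHom D.glue (x ≫ G.one) x x h h'), Category.comp_id]

section

variable {T : TopCat.{u}} {y : Y.fiber T} {E : Frame y D.obj} (hE : E.IsUniversal)

/-- The space of pairs of a point of a frame and an arrow that can act on it. -/
abbrev ActSpace (E : Frame y D.obj) : TopCat.{u} :=
  TopCat.of {p : E.total × G.Arr // E.anchor p.1 = G.src p.2}

/-- The projection to the frame. -/
def actFst (E : Frame y D.obj) : ActSpace E ⟶ E.total :=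
  TopCat.ofHom ⟨fun q ↦ q.1.1, continuous_fst.comp continuous_subtype_val⟩

/-- The projection to the space of arrows. -/
def actSnd (E : Frame y D.obj) : ActSpace E ⟶ G.Arr :=
  TopCat.ofHom ⟨fun q ↦ q.1.2, continuous_snd.comp continuous_subtype_val⟩

lemma actFst_anchor (E : Frame y D.obj) : actFst E ≫ E.anchor = actSnd E ≫ G.src := by
  ext q; exact q.2

include hE in
-- A frame followed by an arrow is again a frame, and the universal property turns it into a point
-- of `E.total`.
lemma exists_act : ∃ (m : ActSpace E ⟶ E.total) (h : m ≫ E.proj = actFst E ≫ E.proj)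
    (h' : m ≫ E.anchor = actSnd E ≫ G.tgt),
    pullHom E.hom m (actFst E ≫ E.proj) (actSnd E ≫ G.tgt) h h' =
      pullHom E.hom (actFst E) _ (actFst E ≫ E.anchor) rfl rfl ≫
        pullHom D.glue (actSnd E) (actFst E ≫ E.anchor) (actSnd E ≫ G.tgt)
          (actFst_anchor E).symm rfl :=
  hE.exists_lift _ _ _

/-- The action of arrows on a universal frame. -/
noncomputable def act : ActSpace E ⟶ E.total := (exists_act hE).choose

lemma act_proj : act hE ≫ E.proj = actFst E ≫ E.proj := (exists_act hE).choose_spec.choose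

lemma act_anchor : act hE ≫ E.anchor = actSnd E ≫ G.tgt :=
  (exists_act hE).choose_spec.choose_spec.choose

lemma act_proj_apply (q : ActSpace E) : E.proj (act hE q) = E.proj q.1.1 :=
  congrArg (fun m : ActSpace E ⟶ T ↦ m q) (act_proj hE)

lemma act_anchor_apply (q : ActSpace E) : E.anchor (act hE q) = G.tgt q.1.2 :=
  congrArg (fun m : ActSpace E ⟶ G.Obj ↦ m q) (act_anchor hE)

/-- The map to the space of pairs of a point and an arrow given by its components. -/
def actLift {S : TopCat.{u}} (k : S ⟶ E.total) (l : S ⟶ G.Arr)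
    (h : k ≫ E.anchor = l ≫ G.src) : S ⟶ ActSpace E :=
  TopCat.ofHom ⟨fun s ↦ ⟨(k s, l s), apply_eq_of_comp_eq h s⟩,
    (k.hom.continuous.prodMk l.hom.continuous).subtype_mk (apply_eq_of_comp_eq h)⟩

/-- The action of a family of arrows on a family of points of a universal frame. -/
noncomputable def actMap {S : TopCat.{u}} (k : S ⟶ E.total) (l : S ⟶ G.Arr)
    (h : k ≫ E.anchor = l ≫ G.src) : S ⟶ E.total :=
  actLift k l h ≫ act hE

lemma actMap_proj {S : TopCat.{u}} (k : S ⟶ E.total) (l : S ⟶ G.Arr)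
    (h : k ≫ E.anchor = l ≫ G.src) : actMap hE k l h ≫ E.proj = k ≫ E.proj :=
  (Category.assoc _ _ _).trans (congrArg (_ ≫ ·) (act_proj hE))

lemma actMap_anchor {S : TopCat.{u}} (k : S ⟶ E.total) (l : S ⟶ G.Arr)
    (h : k ≫ E.anchor = l ≫ G.src) : actMap hE k l h ≫ E.anchor = l ≫ G.tgt :=
  (Category.assoc _ _ _).trans (congrArg (_ ≫ ·) (act_anchor hE))

/-- Restriction along `(k, l)` of the identity that defines `act`. The laws of the action follow
from this form by uniqueness of lifts. -/
lemma pullHom_actMap {S : TopCat.{u}} (k : S ⟶ E.total) (l : S ⟶ G.Arr) (f : S ⟶ T)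
    (g g' : S ⟶ G.Obj) (hk : k ≫ E.proj = f) (hk' : k ≫ E.anchor = g) (hl : l ≫ G.src = g)
    (hl' : l ≫ G.tgt = g') :
    pullHom E.hom k f g hk hk' ≫ pullHom D.glue l g g' hl hl' =
      pullHom E.hom (actMap hE k l (hk'.trans hl.symm)) f g'
        ((actMap_proj _ _ _ _).trans hk) ((actMap_anchor _ _ _ _).trans hl') := by
  have e := congrArg (fun t ↦ pullHom t (actLift k l (hk'.trans hl.symm)) f g' hk hl')
    (exists_act hE).choose_spec.choose_spec.choose_spec
  have e₁ := pullHom_pullHom E.hom (actFst E) (actFst E ≫ E.proj) (actFst E ≫ E.anchor)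
    (actLift k l (hk'.trans hl.symm)) f g rfl rfl hk hk'
  have e₂ := pullHom_pullHom D.glue (actSnd E) (actFst E ≫ E.anchor) (actSnd E ≫ G.tgt)
    (actLift k l (hk'.trans hl.symm)) g g' (actFst_anchor E).symm rfl hk' hl'
  have e₃ := pullHom_pullHom E.hom (act hE) (actFst E ≫ E.proj) (actSnd E ≫ G.tgt)
    (actLift k l (hk'.trans hl.symm)) f g' (act_proj hE) (act_anchor hE) hk hl'
  have e₄ := Prestack.pullHom_comp
    (pullHom E.hom (actFst E) (actFst E ≫ E.proj) (actFst E ≫ E.anchor) rfl rfl)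
    (pullHom D.glue (actSnd E) (actFst E ≫ E.anchor) (actSnd E ≫ G.tgt) (actFst_anchor E).symm rfl)
    (actLift k l (hk'.trans hl.symm)) f g g' hk hk' hl'
  exact (congrArg₂ (· ≫ ·) e₁ e₂).symm.trans (e₄.trans (e.symm.trans e₃))

variable (hD : D.IsPresentation)

include hD

/-- Multiplicativity of `glue` shows that both sides pull the universal frame back to the same
morphism. -/
lemma actMap_actMap {S : TopCat.{u}} (k : S ⟶ E.total) (l l' : S ⟶ G.Arr)
    (h : k ≫ E.anchor = l ≫ G.src) (h' : l ≫ G.tgt = l' ≫ G.src) :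
    actMap hE (actMap hE k l h) l' ((actMap_anchor hE k l h).trans h') =
      actMap hE k (TopGroupoid.mulMap l l' h')
        (h.trans (TopGroupoid.mulMap_src l l' h').symm) := by
  refine hE.hom_ext _ _ (k ≫ E.proj) (l' ≫ G.tgt)
    ((actMap_proj hE _ _ _).trans (actMap_proj hE _ _ _)) (actMap_anchor hE _ _ _)
    (actMap_proj hE _ _ _)
    ((actMap_anchor hE _ _ _).trans (TopGroupoid.mulMap_tgt l l' h')) ?_
  refine (pullHom_actMap hE _ l' (k ≫ E.proj) (l ≫ G.tgt) _ (actMap_proj hE _ _ _)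
    (actMap_anchor hE _ _ _) h'.symm rfl).symm.trans ?_
  refine Eq.trans ?_ (pullHom_actMap hE k _ (k ≫ E.proj) (k ≫ E.anchor) _ rfl rfl
    ((TopGroupoid.mulMap_src l l' h').trans h.symm) (TopGroupoid.mulMap_tgt l l' h'))
  rw [← hD.glue_mul l l' _ _ _ h.symm rfl h'.symm rfl,
    ← pullHom_actMap hE k l _ _ _ rfl rfl h.symm rfl, Category.assoc]

lemma act_act (p : E.total) (γ δ : G.Arr) (h : E.anchor p = G.src γ) (h' : G.tgt γ = G.src δ)
    (k : E.anchor (act hE ⟨(p, γ), h⟩) = G.src δ)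
    (k' : E.anchor p = G.src (G.comp ⟨(γ, δ), h'⟩)) :
    act hE ⟨(act hE ⟨(p, γ), h⟩, δ), k⟩ = act hE ⟨(p, G.comp ⟨(γ, δ), h'⟩), k'⟩ :=
  congrArg (fun k ↦ k PUnit.unit) (actMap_actMap hE hD (pointMap p) (pointMap γ) (pointMap δ)
    (congrArg pointMap h) (congrArg pointMap h'))

variable [∀ T, IsGroupoid (Y.fiber T)]

lemma actMap_one {S : TopCat.{u}} (k : S ⟶ E.total)
    (h : k ≫ E.anchor = ((k ≫ E.anchor) ≫ G.one) ≫ G.src) :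
    actMap hE k ((k ≫ E.anchor) ≫ G.one) h = k := by
  have h₁ : ((k ≫ E.anchor) ≫ G.one) ≫ G.tgt = k ≫ E.anchor := by ext s; exact G.tgt_one _
  refine hE.hom_ext _ _ (k ≫ E.proj) (k ≫ E.anchor) (actMap_proj hE _ _ h)
    ((actMap_anchor hE _ _ h).trans h₁) rfl rfl ?_
  refine (pullHom_actMap hE k _ _ _ _ rfl rfl h.symm h₁).symm.trans ?_
  rw [hD.pullHom_one_glue _ h.symm h₁, Category.comp_id]

lemma act_one (p : E.total) : act hE ⟨(p, G.one (E.anchor p)), (G.src_one _).symm⟩ = p :=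
  congrArg (fun k ↦ k PUnit.unit) (actMap_one hE hD (pointMap p) (by
    ext; exact (G.src_one _).symm))

/-- Over `E ×_T E` the two tautological frames differ by a morphism between pull-backs of `D.obj`,
hence by a unique family of arrows `d`. This `d` is the continuous division map, and both inverse
laws are instances of uniqueness of lifts. -/
lemma isHomeomorph_act : IsHomeomorph
    (fun q : {p : E.total × G.Arr // E.anchor p.1 = G.src p.2} ↦
      (⟨(q.1.1, act hE q), (act_proj_apply hE q).symm⟩ :
        {p : E.total × E.total // E.proj p.1 = E.proj p.2})) := by
  have : IsIso E.hom := IsGroupoid.all_isIso _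
  let Z : TopCat.{u} := TopCat.of {p : E.total × E.total // E.proj p.1 = E.proj p.2}
  let p₁ : Z ⟶ E.total := TopCat.ofHom ⟨fun z ↦ z.1.1, continuous_fst.comp continuous_subtype_val⟩
  let p₂ : Z ⟶ E.total := TopCat.ofHom ⟨fun z ↦ z.1.2, continuous_snd.comp continuous_subtype_val⟩
  have hp : p₂ ≫ E.proj = p₁ ≫ E.proj := by ext z; exact z.2.symm
  obtain ⟨d, hd, hd', e⟩ := hD.exists_arrow (p₁ ≫ E.anchor) (p₂ ≫ E.anchor)
    (inv (pullHom E.hom p₁ (p₁ ≫ E.proj) (p₁ ≫ E.anchor) rfl rfl) ≫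
      pullHom E.hom p₂ (p₁ ≫ E.proj) (p₂ ≫ E.anchor) hp rfl)
  have hr : actMap hE p₁ d hd.symm = p₂ := by
    refine hE.hom_ext _ _ (p₁ ≫ E.proj) (p₂ ≫ E.anchor) (actMap_proj hE _ _ _)
      ((actMap_anchor hE _ _ _).trans hd') hp rfl ?_
    refine (pullHom_actMap hE p₁ d _ _ _ rfl rfl hd hd').symm.trans ?_
    exact (congrArg (_ ≫ ·) e).trans (IsIso.hom_inv_id_assoc _ _)
  let c : ActSpace E ⟶ Z := TopCat.ofHom ⟨fun q ↦ ⟨(q.1.1, act hE q),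
    (act_proj_apply hE q).symm⟩,
    ((continuous_fst.comp continuous_subtype_val).prodMk (act hE).hom.continuous).subtype_mk _⟩
  have hl : c ≫ d = actSnd E := by
    have h₁ : (c ≫ d) ≫ G.src = actFst E ≫ E.anchor := by
      rw [Category.assoc]; exact congrArg (c ≫ ·) hd
    have h₂ : (c ≫ d) ≫ G.tgt = actSnd E ≫ G.tgt := by
      rw [Category.assoc]; exact (congrArg (c ≫ ·) hd').trans (act_anchor hE)
    refine hD.arrow_ext _ _ (actFst E ≫ E.anchor) (actSnd E ≫ G.tgt) h₁ h₂
      (actFst_anchor E).symm rfl ?_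
    have e₁ := pullHom_actMap hE (actFst E) (c ≫ d) (actFst E ≫ E.proj) _ _ rfl rfl h₁ h₂
    have e₂ := pullHom_actMap hE (actFst E) (actSnd E) (actFst E ≫ E.proj) _ _ rfl rfl
      (actFst_anchor E).symm rfl
    -- This is `hr` restricted along `c`: the arrow from `p` to `p · γ`, applied to `p`, gives `p ·
    -- γ`.
    have : actMap hE (actFst E) (c ≫ d) h₁.symm =
        actMap hE (actFst E) (actSnd E) (actFst_anchor E) :=
      congrArg (c ≫ ·) hr
    have e₃ := e₁.trans ((pullHom_congr E.hom this _ _ _ _ _ _).trans e₂.symm)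
    exact (cancel_epi _).1 e₃
  refine isHomeomorph_iff_exists_homeomorph.2 ⟨{
    toFun := _
    invFun z := ⟨(p₁ z, d z), apply_eq_of_comp_eq hd.symm z⟩
    left_inv q := Subtype.ext (Prod.ext rfl (congrArg (fun k ↦ k q) hl))
    right_inv z := Subtype.ext (Prod.ext rfl (congrArg (fun k ↦ k z) hr))
    continuous_toFun := c.hom.continuous
    continuous_invFun := (p₁.hom.continuous.prodMk d.hom.continuous).subtype_mk _ }, rfl⟩

/-- The framed bundle given by a universal frame with local sections. -/
noncomputable def framedBundle
    (hs : ∀ t : T, ∃ U : TopologicalSpace.Opens T, t ∈ U ∧ ∃ s : C(U, E.total), ∀ x : U,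
      E.proj (s x) = x) : D.FramedBundle y where
  bundle :=
    { total := E.total
      proj := E.proj
      anchor := E.anchor
      act := act hE
      proj_act p γ h := act_proj_apply hE ⟨(p, γ), h⟩
      anchor_act p γ h := act_anchor_apply hE ⟨(p, γ), h⟩
      act_one := act_one hE hD
      act_act p γ δ h h' := act_act hE hD p γ δ h h' _ _
      localSections := hs
      principal := isHomeomorph_act hE hD }
  hom := E.hom
  hom_act k l f g g' hk hk' hl hl' := pullHom_actMap hE k l f g g' hk hk' hl hl'

lemma exists_framedBundle {T : TopCat.{u}} (y : Y.fiber T) :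
    ∃ P : D.FramedBundle y, P.frame.IsUniversal := by
  obtain ⟨E, hE, hs⟩ := hD.exists_frame y
  exact ⟨framedBundle hE hD hs, hE⟩

end

end IsPresentation

end GroupoidMap

end TopStack

/-! ### Maps between framed bundles. -/

namespace TopStack

open Pseudofunctor Pseudofunctor.LocallyDiscreteOpToCat

namespace PrincipalBundle

variable {G : TopGroupoid.{u}} {S T : TopCat.{u}}

/-- The morphism to a pull-back of a principal bundle given by an equivariant map. -/
def toPullback {P : PrincipalBundle G S} {Q : PrincipalBundle G T} (f : S ⟶ T)
    (m : P.total ⟶ Q.total) (h : m ≫ Q.proj = P.proj ≫ f) (h' : m ≫ Q.anchor = P.anchor)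
    (h_act : ∀ (p : P.total) (γ : G.Arr) (k : P.anchor p = G.src γ) (k' : Q.anchor (m p) = G.src γ),
      m (P.act ⟨(p, γ), k⟩) = Q.act ⟨(m p, γ), k'⟩) : P ⟶ pullback f Q where
  hom := TopCat.ofHom ⟨fun p ↦ ⟨(P.proj p, m p), (apply_eq_of_comp_eq h p).symm⟩,
    (P.proj.hom.continuous.prodMk m.hom.continuous).subtype_mk _⟩
  proj_hom _ := rfl
  anchor_hom p := congrArg (fun k : P.total ⟶ G.Obj ↦ k p) h'
  hom_act p γ k := Subtype.ext (Prod.ext (P.proj_act p γ k) (h_act p γ k _))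

/-- The morphism of principal bundles given by an equivariant map. -/
def mkHom {P Q : PrincipalBundle G T}
    (m : P.total ⟶ Q.total) (h : m ≫ Q.proj = P.proj) (h' : m ≫ Q.anchor = P.anchor)
    (h_act : ∀ (p : P.total) (γ : G.Arr) (k : P.anchor p = G.src γ) (k' : Q.anchor (m p) = G.src γ),
      m (P.act ⟨(p, γ), k⟩) = Q.act ⟨(m p, γ), k'⟩) : P ⟶ Q where
  hom := m
  proj_hom p := congrArg (fun k : P.total ⟶ T ↦ k p) h
  anchor_hom p := congrArg (fun k : P.total ⟶ G.Obj ↦ k p) h'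
  hom_act p γ k := h_act p γ k _

lemma hom_ext_total {P Q : PrincipalBundle G T} {f g : P ⟶ Q} (h : f.hom = g.hom) : f = g :=
  Hom.ext h

lemma hom_ext_pullback {P : PrincipalBundle G S} {Q : PrincipalBundle G T} {f : S ⟶ T}
    {φ ψ : P ⟶ pullback f Q} (h : φ.hom ≫ pullbackSnd f Q = ψ.hom ≫ pullbackSnd f Q) : φ = ψ :=
  hom_ext fun p ↦ Subtype.ext (Prod.ext ((φ.proj_hom p).trans (ψ.proj_hom p).symm)
    (congrArg (fun k : P.total ⟶ Q.total ↦ k p) h))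

lemma hom_ext_pullback₂ {R : TopCat.{u}} {P : PrincipalBundle G R} {Q : PrincipalBundle G T}
    {f : S ⟶ T} {g : R ⟶ S} {φ ψ : P ⟶ pullback g (pullback f Q)}
    (h : (φ.hom ≫ pullbackSnd g _) ≫ pullbackSnd f Q =
      (ψ.hom ≫ pullbackSnd g _) ≫ pullbackSnd f Q) :
    φ = ψ :=
  hom_ext fun p ↦ by
    have e : (φ.hom p).1.1 = (ψ.hom p).1.1 := (φ.proj_hom p).trans (ψ.proj_hom p).symm
    exact Subtype.ext (Prod.ext e (Subtype.ext (Prod.ext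
      ((φ.hom p).2.symm.trans ((congrArg g e).trans (ψ.hom p).2))
      (congrArg (fun k : P.total ⟶ Q.total ↦ k p) h))))

lemma hom_comp_proj {P Q : PrincipalBundle G T} (φ : P ⟶ Q) : φ.hom ≫ Q.proj = P.proj := by
  ext p; exact φ.proj_hom p

lemma hom_comp_anchor {P Q : PrincipalBundle G T} (φ : P ⟶ Q) :
    φ.hom ≫ Q.anchor = P.anchor := by
  ext p; exact φ.anchor_hom p

end PrincipalBundle

namespace GroupoidMap.FramedBundle

open Prestack

variable {G : TopGroupoid.{u}} {Y : Prestack.{u}} {D : GroupoidMap G Y}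
  {S T U : TopCat.{u}} {z : Y.fiber S} {y : Y.fiber T} {w : Y.fiber U}

/-- A map between the total spaces of framed bundles is over a morphism `θ` if it is compatible
with the frames. -/
structure IsOver (P : D.FramedBundle z) (Q : D.FramedBundle y) {r : P.bundle.total ⟶ T}
    (θ : (Y.pull P.bundle.proj).obj z ⟶ (Y.pull r).obj y) (m : P.bundle.total ⟶ Q.bundle.total) :
    Prop where
  comp_proj : m ≫ Q.bundle.proj = r
  comp_anchor : m ≫ Q.bundle.anchor = P.bundle.anchor
  comp_pullHom : θ ≫ pullHom Q.hom m r P.bundle.anchor comp_proj comp_anchor = P.hom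

section

variable {P : D.FramedBundle z} {Q : D.FramedBundle y} {R : D.FramedBundle w}
  {r : P.bundle.total ⟶ T}
  {θ : (Y.pull P.bundle.proj).obj z ⟶ (Y.pull r).obj y}

lemma isOver_id (P : D.FramedBundle z) : IsOver P P (𝟙 _) (𝟙 _) where
  comp_proj := Category.id_comp _
  comp_anchor := Category.id_comp _
  comp_pullHom := (Category.id_comp _).trans (pullHom_id _)

lemma IsOver.comp {m : P.bundle.total ⟶ Q.bundle.total} (h : IsOver P Q θ m)
    {s : Q.bundle.total ⟶ U} {θ' : (Y.pull Q.bundle.proj).obj y ⟶ (Y.pull s).obj w}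
    {n : Q.bundle.total ⟶ R.bundle.total} (h' : IsOver Q R θ' n) (s' : P.bundle.total ⟶ U)
    (hs : m ≫ s = s') :
    IsOver P R (θ ≫ pullHom θ' m r s' h.comp_proj hs) (m ≫ n) where
  comp_proj := by rw [Category.assoc, h'.comp_proj, hs]
  comp_anchor := by rw [Category.assoc, h'.comp_anchor, h.comp_anchor]
  comp_pullHom := by
    have e := pullHom_pullHom R.hom n s Q.bundle.anchor m s' P.bundle.anchor h'.comp_proj
      h'.comp_anchor hs h.comp_anchor
    rw [← e, Category.assoc, Prestack.pullHom_comp, h'.comp_pullHom, h.comp_pullHom]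

lemma IsOver.congr {m : P.bundle.total ⟶ Q.bundle.total} (h : IsOver P Q θ m)
    {θ' : (Y.pull P.bundle.proj).obj z ⟶ (Y.pull r).obj y} (e : θ = θ') : IsOver P Q θ' m :=
  e ▸ h

variable [∀ T, IsGroupoid (Y.fiber T)]

/-- `θ` is invertible, so it determines the pull-back of the frame of `Q` along `m`, and a universal
frame separates maps. Functoriality, naturality and coherence of `toBundle` all reduce to this. -/
lemma IsOver.unique (hQ : Q.frame.IsUniversal) {m m' : P.bundle.total ⟶ Q.bundle.total}
    (h : IsOver P Q θ m) (h' : IsOver P Q θ m') : m = m' := by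
  have : IsIso θ := IsGroupoid.all_isIso _
  exact hQ.hom_ext m m' _ _ h.comp_proj h.comp_anchor h'.comp_proj h'.comp_anchor
    ((cancel_epi θ).1 (h.comp_pullHom.trans h'.comp_pullHom.symm))

lemma exists_isOver (P : D.FramedBundle z) (hQ : Q.frame.IsUniversal) {r : P.bundle.total ⟶ T}
    (θ : (Y.pull P.bundle.proj).obj z ⟶ (Y.pull r).obj y) : ∃ m, IsOver P Q θ m := by
  have : IsIso θ := IsGroupoid.all_isIso _
  obtain ⟨m, h, h', e⟩ := hQ.exists_lift r P.bundle.anchor (inv θ ≫ P.hom)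
  exact ⟨m, h, h', by rw [← IsIso.eq_inv_comp]; exact e⟩

/-- The map between total spaces of framed bundles over a given morphism. -/
noncomputable def map (P : D.FramedBundle z) (hQ : Q.frame.IsUniversal) {r : P.bundle.total ⟶ T}
    (θ : (Y.pull P.bundle.proj).obj z ⟶ (Y.pull r).obj y) : P.bundle.total ⟶ Q.bundle.total :=
  (exists_isOver P hQ θ).choose

lemma isOver_map (P : D.FramedBundle z) (hQ : Q.frame.IsUniversal) {r : P.bundle.total ⟶ T}
    (θ : (Y.pull P.bundle.proj).obj z ⟶ (Y.pull r).obj y) : IsOver P Q θ (map P hQ θ) :=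
  (exists_isOver P hQ θ).choose_spec

/-- Both sides pull the frame of `Q` back to the same morphism after composition with the invertible
restriction of `θ`. The hypotheses on `r` and `θ` say that neither changes when a point of `P` is
moved by the action. -/
lemma IsOver.actMap (hQ : Q.frame.IsUniversal) {m : P.bundle.total ⟶ Q.bundle.total}
    (h : IsOver P Q θ m) {V : TopCat.{u}} (k : V ⟶ P.bundle.total) (l : V ⟶ G.Arr)
    (hk : k ≫ P.bundle.anchor = l ≫ G.src)
    (hr : P.bundle.actMap k l hk ≫ r = k ≫ r)
    (hθ : pullHom θ (P.bundle.actMap k l hk) (k ≫ P.bundle.proj) (k ≫ r)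
      (P.bundle.actMap_proj k l hk) hr = pullHom θ k (k ≫ P.bundle.proj) (k ≫ r) rfl rfl) :
    P.bundle.actMap k l hk ≫ m = Q.bundle.actMap (k ≫ m) l (by
      rw [Category.assoc, h.comp_anchor, hk]) := by
  have : IsIso θ := IsGroupoid.all_isIso _
  have hkm : (k ≫ m) ≫ Q.bundle.proj = k ≫ r := by rw [Category.assoc, h.comp_proj]
  have hkm' : (k ≫ m) ≫ Q.bundle.anchor = k ≫ P.bundle.anchor := by
    rw [Category.assoc, h.comp_anchor]
  have h₁ : (P.bundle.actMap k l hk ≫ m) ≫ Q.bundle.proj = k ≫ r := by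
    rw [Category.assoc, h.comp_proj, hr]
  have h₂ : (P.bundle.actMap k l hk ≫ m) ≫ Q.bundle.anchor = l ≫ G.tgt := by
    rw [Category.assoc, h.comp_anchor, P.bundle.actMap_anchor]
  -- The relation `comp_pullHom` restricted to a family `k` of points of `P`.
  have key : ∀ {V : TopCat.{u}} (k : V ⟶ P.bundle.total) (f : V ⟶ S) (f' : V ⟶ T)
      (g : V ⟶ G.Obj) (e₁ : k ≫ P.bundle.proj = f) (e₂ : k ≫ r = f')
      (e₃ : k ≫ P.bundle.anchor = g) (e₄ : (k ≫ m) ≫ Q.bundle.proj = f')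
      (e₅ : (k ≫ m) ≫ Q.bundle.anchor = g),
      pullHom θ k f f' e₁ e₂ ≫ pullHom Q.hom (k ≫ m) f' g e₄ e₅ = pullHom P.hom k f g e₁ e₃ := by
    intro V k f f' g e₁ e₂ e₃ e₄ e₅
    have e := pullHom_pullHom Q.hom m r P.bundle.anchor k f' g h.comp_proj h.comp_anchor e₂ e₃
    rw [← e, Prestack.pullHom_comp, h.comp_pullHom]
  refine hQ.hom_ext _ _ (k ≫ r) (l ≫ G.tgt) h₁ h₂
    ((Q.bundle.actMap_proj _ _ _).trans hkm) (Q.bundle.actMap_anchor _ _ _) ?_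
  refine Eq.trans ?_ (Q.hom_act (k ≫ m) l (k ≫ r) (k ≫ P.bundle.anchor) (l ≫ G.tgt) hkm hkm'
    hk.symm rfl)
  rw [← cancel_epi (pullHom θ k (k ≫ P.bundle.proj) (k ≫ r) rfl rfl)]
  refine Eq.trans ?_ (Category.assoc _ _ _)
  rw [key k _ _ _ rfl rfl rfl hkm hkm', ← hθ]
  refine (key _ _ _ _ (P.bundle.actMap_proj k l hk) hr (P.bundle.actMap_anchor k l hk) h₁
    h₂).trans ?_
  exact (P.hom_act k l _ _ _ rfl rfl hk.symm rfl).symm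

/-- Pointwise form of `IsOver.actMap`. The hypothesis, that restrictions of `θ` depend only on the
map to the base, holds for morphisms pulled back from the base and for comparison isomorphisms. -/
lemma IsOver.apply_act (hQ : Q.frame.IsUniversal) {m : P.bundle.total ⟶ Q.bundle.total}
    (h : IsOver P Q θ m)
    (hθ : ∀ {V : TopCat.{u}} (k k' : V ⟶ P.bundle.total)
        (_ : k' ≫ P.bundle.proj = k ≫ P.bundle.proj),
      ∃ hr : k' ≫ r = k ≫ r, pullHom θ k' (k ≫ P.bundle.proj) (k ≫ r) ‹_› hr =
        pullHom θ k (k ≫ P.bundle.proj) (k ≫ r) rfl rfl)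
    (p : P.bundle.total) (γ : G.Arr) (k : P.bundle.anchor p = G.src γ)
    (k' : Q.bundle.anchor (m p) = G.src γ) :
    m (P.bundle.act ⟨(p, γ), k⟩) = Q.bundle.act ⟨(m p, γ), k'⟩ := by
  have hk : pointMap p ≫ P.bundle.anchor = pointMap γ ≫ G.src := congrArg pointMap k
  obtain ⟨hr, hθ⟩ := hθ (pointMap p) _ (P.bundle.actMap_proj (pointMap p) (pointMap γ) hk)
  exact congrArg (fun k ↦ k PUnit.unit) (h.actMap hQ (pointMap p) (pointMap γ) hk hr hθ)

end

end GroupoidMap.FramedBundle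

end TopStack

/-! ### The morphism from a presented stack to the classifying stack. -/

namespace TopStack

open Pseudofunctor Pseudofunctor.LocallyDiscreteOpToCat

namespace GroupoidMap.IsPresentation

open Prestack FramedBundle PrincipalBundle

variable {G : TopGroupoid.{u}} {Y : Prestack.{u}} {D : GroupoidMap G Y}
  [∀ T, IsGroupoid (Y.fiber T)] (hD : D.IsPresentation) {S T : TopCat.{u}}

/-- A universal framed bundle of an object. -/
noncomputable def univBundle (y : Y.fiber T) : D.FramedBundle y := (hD.exists_framedBundle y).choose

lemma isUniversal (y : Y.fiber T) : (hD.univBundle y).frame.IsUniversal :=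
  (hD.exists_framedBundle y).choose_spec

/-- The morphism between framed bundles given by a morphism of objects. -/
noncomputable def bundleMap {y y' : Y.fiber T} (P : D.FramedBundle y) {Q : D.FramedBundle y'}
    (hQ : Q.frame.IsUniversal) (ψ : y ⟶ y') : P.bundle ⟶ Q.bundle :=
  have h := isOver_map P hQ ((Y.pull P.bundle.proj).map ψ)
  mkHom _ h.comp_proj h.comp_anchor (h.apply_act hQ fun k k' e ↦
    ⟨e, (pullHom_map ψ _ k' _ e e).trans (pullHom_map ψ _ k _ rfl rfl).symm⟩)

lemma isOver_bundleMap {y y' : Y.fiber T} (P : D.FramedBundle y) {Q : D.FramedBundle y'}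
    (hQ : Q.frame.IsUniversal) (ψ : y ⟶ y') :
    IsOver P Q ((Y.pull P.bundle.proj).map ψ) (bundleMap P hQ ψ).hom :=
  isOver_map P hQ _

/-- The comparison morphism from a framed bundle of a pull-back to the pull-back of a framed
bundle. -/
noncomputable def bundlePullback (f : S ⟶ T) {y : Y.fiber T}
    (P : D.FramedBundle ((Y.pull f).obj y)) {Q : D.FramedBundle y} (hQ : Q.frame.IsUniversal) :
    P.bundle ⟶ pullback f Q.bundle :=
  have h := isOver_map P hQ (Y.pullComp f P.bundle.proj _ rfl y).inv
  toPullback f _ h.comp_proj h.comp_anchor (h.apply_act hQ fun k k' e ↦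
    ⟨by rw [← Category.assoc, e, Category.assoc],
      (pullHom_pullComp_inv f _ k' _ _ (k ≫ P.bundle.proj ≫ f) rfl e (Category.assoc _ _ _)
        (by rw [← Category.assoc, e, Category.assoc]) y).trans
      (pullHom_pullComp_inv f _ k _ _ (k ≫ P.bundle.proj ≫ f) rfl rfl (Category.assoc _ _ _) rfl
        y).symm⟩)

lemma isOver_bundlePullback (f : S ⟶ T) {y : Y.fiber T}
    (P : D.FramedBundle ((Y.pull f).obj y)) {Q : D.FramedBundle y} (hQ : Q.frame.IsUniversal) :
    IsOver P Q (Y.pullComp f P.bundle.proj _ rfl y).inv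
      ((bundlePullback f P hQ).hom ≫ pullbackSnd f Q.bundle) :=
  isOver_map P hQ _

/-- The functor from `Y(T)` to principal bundles. -/
noncomputable def toBundle (T : TopCat.{u}) : Y.fiber T ⥤ PrincipalBundle G T where
  obj y := (hD.univBundle y).bundle
  map ψ := bundleMap (hD.univBundle _) (hD.isUniversal _) ψ
  map_id y := hom_ext_total ((isOver_bundleMap _ _ _).unique (hD.isUniversal y)
    ((isOver_id _).congr (CategoryTheory.Functor.map_id _ _).symm))
  map_comp {y y' y''} ψ ψ' := by
    have h₁ := isOver_bundleMap (hD.univBundle y) (hD.isUniversal y') ψ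
    have h₂ := isOver_bundleMap (hD.univBundle y') (hD.isUniversal y'') ψ'
    refine hom_ext_total ((isOver_bundleMap _ _ _).unique (hD.isUniversal y'')
      ((h₁.comp h₂ _ h₁.comp_proj).congr ?_))
    rw [pullHom_map]
    exact (Functor.map_comp _ _ _).symm

/-- The isomorphism comparing `toBundle` with pull-backs. -/
noncomputable def toBundlePullback (f : S ⟶ T) (y : Y.fiber T) :
    (hD.toBundle S).obj ((Y.pull f).obj y) ≅ (pullbackFunctor f).obj ((hD.toBundle T).obj y) :=
  @asIso _ _ _ _ (bundlePullback f (hD.univBundle ((Y.pull f).obj y)) (hD.isUniversal y))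
    (isIso_of_hom _)

lemma isOver_toBundlePullback (f : S ⟶ T) (y : Y.fiber T) :
    IsOver (hD.univBundle ((Y.pull f).obj y)) (hD.univBundle y)
      (Y.pullComp f (hD.univBundle ((Y.pull f).obj y)).bundle.proj _ rfl y).inv
      ((hD.toBundlePullback f y).hom.hom ≫ pullbackSnd f (hD.univBundle y).bundle) :=
  isOver_bundlePullback f _ _

/-- By naturality of `pullComp` both composites lie over the same morphism, so `IsOver.unique`
applies to their components in the universal bundle of `y'`. -/
lemma toBundlePullback_naturality (f : S ⟶ T) {y y' : Y.fiber T} (ψ : y ⟶ y') :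
    (hD.toBundle S).map ((Y.pull f).map ψ) ≫ (hD.toBundlePullback f y').hom =
      (hD.toBundlePullback f y).hom ≫ (pullbackFunctor f).map ((hD.toBundle T).map ψ) := by
  have h₁ := isOver_bundleMap (hD.univBundle ((Y.pull f).obj y))
    (hD.isUniversal ((Y.pull f).obj y')) ((Y.pull f).map ψ)
  have h₂ := hD.isOver_toBundlePullback f y'
  have h₃ := hD.isOver_toBundlePullback f y
  have h₄ := isOver_bundleMap (hD.univBundle y) (hD.isUniversal y') ψ
  have e : (bundleMap (hD.univBundle ((Y.pull f).obj y))
    (hD.isUniversal ((Y.pull f).obj y')) ((Y.pull f).map ψ)).hom ≫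
      (hD.univBundle ((Y.pull f).obj y')).bundle.proj ≫ f =
      (hD.univBundle ((Y.pull f).obj y)).bundle.proj ≫ f := by
    rw [← Category.assoc, h₁.comp_proj]
  refine hom_ext_pullback (((h₁.comp h₂ _ e).congr ?_).unique (hD.isUniversal y')
    (h₃.comp h₄ _ h₃.comp_proj))
  rw [pullHom_map, pullHom_pullComp_inv f _ _ _ _ _ rfl _ rfl]
  exact pullComp_inv_naturality f _ _ rfl ψ

lemma toBundlePullback_id (y : Y.fiber T) :
    (hD.toBundlePullback (𝟙 T) y).hom ≫ (pullbackId T).hom.app ((hD.toBundle T).obj y) =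
      (hD.toBundle T).map (Y.idIsoApp ⟨op T⟩ y).hom := by
  refine hom_ext_total ((hD.isOver_toBundlePullback (𝟙 T) y).unique (hD.isUniversal y)
    ((isOver_bundleMap (hD.univBundle ((Y.pull (𝟙 T)).obj y)) (hD.isUniversal y)
      (Y.idIsoApp ⟨op T⟩ y).hom).congr ?_))
  exact (pullComp_id_inv _ _ y).symm

/-- Both sides amount to maps to the universal bundle of `y`; the morphisms they lie over agree by
associativity of iterated pull-backs, `map_pullComp_hom_comp`. -/
lemma toBundlePullback_comp {R : TopCat.{u}} (f : S ⟶ T) (g : R ⟶ S) (y : Y.fiber T) :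
    (hD.toBundlePullback (g ≫ f) y).hom ≫ (pullbackComp f g).hom.app ((hD.toBundle T).obj y) =
      (hD.toBundle R).map (Y.compIsoApp f.op.toLoc g.op.toLoc y).hom ≫
        (hD.toBundlePullback g ((Y.pull f).obj y)).hom ≫
          (pullbackFunctor g).map (hD.toBundlePullback f y).hom := by
  rw [← pullComp_rfl]
  have h₀ := hD.isOver_toBundlePullback (g ≫ f) y
  have h₁ := isOver_bundleMap (hD.univBundle ((Y.pull (g ≫ f)).obj y))
    (hD.isUniversal ((Y.pull g).obj ((Y.pull f).obj y))) (Y.pullComp f g _ rfl y).hom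
  have h₂ := hD.isOver_toBundlePullback g ((Y.pull f).obj y)
  have h₃ := hD.isOver_toBundlePullback f y
  have e₁ := (congrArg (· ≫ g) h₁.comp_proj).symm.trans (Category.assoc _ _ _)
  have h₁₂ := (h₁.comp h₂ _ e₁.symm).congr (congrArg (_ ≫ ·)
    (pullHom_pullComp_inv g _ _ _ _ _ rfl h₁.comp_proj rfl _ _))
  have e₂ := (congrArg (· ≫ f) h₁₂.comp_proj).symm.trans (Category.assoc _ _ _)
  refine hom_ext_pullback₂ (h₀.unique (hD.isUniversal y) ((h₁₂.comp h₃ _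
    (e₂.symm.trans (Category.assoc _ _ _))).congr ?_))
  refine (congrArg (_ ≫ ·) (pullHom_pullComp_inv f _ _ _ _ _ rfl h₁₂.comp_proj
    (Category.assoc _ _ _) _ _)).trans ((Category.assoc _ _ _).trans ?_)
  exact map_pullComp_hom_comp f g _ _ _ _ rfl rfl _ _ y

/-- The morphism from `Y` to the classifying stack. -/
noncomputable def toClassifyingStack : Y ⟶ classifyingStack G :=
  StrongTrans.mkOfLocallyDiscrete (G := classifyingStack G)
    (fun a ↦ hD.toBundle a.as.unop)
    (fun f y ↦ hD.toBundlePullback f.as.unop y)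
    (fun f _ _ ψ ↦ hD.toBundlePullback_naturality f.as.unop ψ)
    (fun _ y ↦ hD.toBundlePullback_id y)
    (fun f g y ↦ hD.toBundlePullback_comp f.as.unop g.as.unop y)

end GroupoidMap.IsPresentation

end TopStack

/-! ### The morphism to the classifying stack is a pointwise equivalence. -/

namespace TopStack

open Pseudofunctor Pseudofunctor.LocallyDiscreteOpToCat

namespace PrincipalBundle

variable {G : TopGroupoid.{u}} {S S' T : TopCat.{u}} (P : PrincipalBundle G T)

lemma actMap_congr {k k' : S ⟶ P.total} {l l' : S ⟶ G.Arr} (hk : k = k') (hl : l = l')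
    (h : k ≫ P.anchor = l ≫ G.src) :
    P.actMap k l h = P.actMap k' l' (by rw [← hk, ← hl, h]) := by
  subst hk hl; rfl

/-- The family of arrows that takes a family of points to another one in the same fibres. -/
noncomputable def divMap (k k' : S ⟶ P.total) (h : k ≫ P.proj = k' ≫ P.proj) : S ⟶ G.Arr :=
  TopCat.ofHom ⟨fun s ↦ P.div (k s) (k' s) (apply_eq_of_comp_eq h s),
    continuous_div k.hom.continuous k'.hom.continuous (apply_eq_of_comp_eq h)⟩

lemma divMap_src (k k' : S ⟶ P.total) (h : k ≫ P.proj = k' ≫ P.proj) :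
    P.divMap k k' h ≫ G.src = k ≫ P.anchor := by
  ext s; exact (P.anchor_eq_src_div _ _ _).symm

lemma actMap_divMap (k k' : S ⟶ P.total) (h : k ≫ P.proj = k' ≫ P.proj) :
    P.actMap k (P.divMap k k' h) (P.divMap_src k k' h).symm = k' := by
  ext s; exact P.act_div _ _ _

lemma divMap_tgt (k k' : S ⟶ P.total) (h : k ≫ P.proj = k' ≫ P.proj) :
    P.divMap k k' h ≫ G.tgt = k' ≫ P.anchor := by
  rw [← P.actMap_anchor k _ (P.divMap_src k k' h).symm, actMap_divMap]

lemma divMap_eq (k k' : S ⟶ P.total) (h : k ≫ P.proj = k' ≫ P.proj) (l : S ⟶ G.Arr)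
    (hl : k ≫ P.anchor = l ≫ G.src) (e : P.actMap k l hl = k') : P.divMap k k' h = l := by
  subst e
  ext s; exact P.div_act _ _ _

lemma comp_divMap (i : S' ⟶ S) (k k' : S ⟶ P.total) (h : k ≫ P.proj = k' ≫ P.proj)
    (j j' : S' ⟶ P.total) (hj : i ≫ k = j) (hj' : i ≫ k' = j') (h' : j ≫ P.proj = j' ≫ P.proj) :
    i ≫ P.divMap k k' h = P.divMap j j' h' := by
  subst hj hj'; rfl

lemma divMap_self (k : S ⟶ P.total) : P.divMap k k rfl = (k ≫ P.anchor) ≫ G.one := by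
  refine P.divMap_eq _ _ _ _ ?_ ?_
  · ext s; exact (G.src_one _).symm
  · ext s; exact P.act_one _

/-- Acting with the two arrows in turn moves `k` to `k''`, and the arrow that does so is unique.
This is the cocycle condition in `exists_framing`. -/
lemma mulMap_divMap (k k' k'' : S ⟶ P.total) (h : k ≫ P.proj = k' ≫ P.proj)
    (h' : k' ≫ P.proj = k'' ≫ P.proj)
    (c : P.divMap k k' h ≫ G.tgt = P.divMap k' k'' h' ≫ G.src) :
    TopGroupoid.mulMap (P.divMap k k' h) (P.divMap k' k'' h') c = P.divMap k k'' (h.trans h') := by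
  refine (P.divMap_eq _ _ _ _ ((P.divMap_src k k' h).symm.trans
    (TopGroupoid.mulMap_src _ _ c).symm) ?_).symm
  have e : P.actMap k (TopGroupoid.mulMap (P.divMap k k' h) (P.divMap k' k'' h') c)
      ((P.divMap_src k k' h).symm.trans (TopGroupoid.mulMap_src _ _ c).symm) =
      P.actMap (P.actMap k (P.divMap k k' h) (P.divMap_src k k' h).symm) (P.divMap k' k'' h')
        ((P.actMap_anchor _ _ _).trans c) := by
    ext s
    exact (P.act_act (k s) _ _ _ (apply_eq_of_comp_eq c s)).symm
  rw [e, P.actMap_congr (P.actMap_divMap k k' h) rfl, actMap_divMap]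

lemma actMap_hom {P Q : PrincipalBundle G T} (φ : P ⟶ Q) (k : S ⟶ P.total) (l : S ⟶ G.Arr)
    (h : k ≫ P.anchor = l ≫ G.src) :
    P.actMap k l h ≫ φ.hom = Q.actMap (k ≫ φ.hom) l (by
      rw [Category.assoc, hom_comp_anchor, h]) := by
  ext s; exact φ.hom_act _ _ _

end PrincipalBundle

namespace GroupoidMap.IsPresentation

open Prestack FramedBundle PrincipalBundle

variable {G : TopGroupoid.{u}} {Y : Prestack.{u}} {D : GroupoidMap G Y}
  [∀ T, IsGroupoid (Y.fiber T)] (hD : D.IsPresentation) {S T : TopCat.{u}}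

/-- A morphism over which there is a morphism of principal bundles has the same pull-backs along
maps with the same projection to the base. -/
lemma pullHom_eq_pullHom {y y' : Y.fiber T} (P : D.FramedBundle y) (Q : D.FramedBundle y')
    (φ : P.bundle ⟶ Q.bundle)
    (θ : (Y.pull P.bundle.proj).obj y ⟶ (Y.pull P.bundle.proj).obj y')
    (h : IsOver P Q θ φ.hom)
    (k k' : S ⟶ P.bundle.total) (q : S ⟶ T) (hk : k ≫ P.bundle.proj = q)
    (hk' : k' ≫ P.bundle.proj = q) : pullHom θ k q q hk hk = pullHom θ k' q q hk' hk' := by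
  have : IsIso Q.hom := IsGroupoid.all_isIso _
  have : IsIso D.glue := IsGroupoid.all_isIso _
  have key : ∀ (k : S ⟶ P.bundle.total) (g : S ⟶ G.Obj) (e₁ : k ≫ P.bundle.proj = q)
      (e₃ : k ≫ P.bundle.anchor = g) (e₄ : (k ≫ φ.hom) ≫ Q.bundle.proj = q)
      (e₅ : (k ≫ φ.hom) ≫ Q.bundle.anchor = g),
      pullHom θ k q q e₁ e₁ ≫ pullHom Q.hom (k ≫ φ.hom) q g e₄ e₅ = pullHom P.hom k q g e₁ e₃ := by
    intro k g e₁ e₃ e₄ e₅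
    have e := pullHom_pullHom Q.hom φ.hom _ P.bundle.anchor k q g h.comp_proj h.comp_anchor e₁ e₃
    rw [← e, Prestack.pullHom_comp, h.comp_pullHom]
  have hp : ∀ (k : S ⟶ P.bundle.total) (_ : k ≫ P.bundle.proj = q),
      (k ≫ φ.hom) ≫ Q.bundle.proj = q := fun k hk ↦ by rw [Category.assoc, h.comp_proj, hk]
  have ha : ∀ (k : S ⟶ P.bundle.total), (k ≫ φ.hom) ≫ Q.bundle.anchor = k ≫ P.bundle.anchor :=
    fun k ↦ by rw [Category.assoc, h.comp_anchor]
  have c := hk.trans hk'.symm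
  -- Since `k' = k · l` and the two frames and `φ` are equivariant, the restrictions of `θ` along
  -- `k` and `k'` agree after composition with one and the same isomorphism.
  let l := P.bundle.divMap k k' c
  have hl : l ≫ G.src = k ≫ P.bundle.anchor := P.bundle.divMap_src k k' c
  have hl' : l ≫ G.tgt = k' ≫ P.bundle.anchor := P.bundle.divMap_tgt k k' c
  have e₁ := (P.hom_act k l q _ _ hk rfl hl hl').trans
    (pullHom_congr P.hom (P.bundle.actMap_divMap k k' c) _ _ _ _ hk' rfl)
  have e₂ := (Q.hom_act (k ≫ φ.hom) l q _ _ (hp k hk) (ha k) hl hl').trans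
    (pullHom_congr Q.hom ((actMap_hom φ k l hl.symm).symm.trans
      (congrArg (· ≫ φ.hom) (P.bundle.actMap_divMap k k' c))) _ _ _ _ (hp k' hk') (ha k'))
  rw [← key k _ hk rfl (hp k hk) (ha k), ← key k' _ hk' rfl (hp k' hk') (ha k'), ← e₂,
    Category.assoc] at e₁
  exact (cancel_mono _).1 e₁

variable [Y.IsStack TopCat.grothendieckTopology.{u}]

/-- The frame of the target is invertible, so the map of bundles determines the pull-back of `ψ` to
the total space, which determines `ψ` by descent. -/
instance : (hD.toBundle T).Faithful where
  map_injective {y y'} ψ ψ' h := by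
    have : IsIso (hD.univBundle y').hom := IsGroupoid.all_isIso _
    have h₁ := isOver_bundleMap (hD.univBundle y) (hD.isUniversal y') ψ
    have h₂ := isOver_bundleMap (hD.univBundle y) (hD.isUniversal y') ψ'
    have e : (bundleMap (hD.univBundle y) (hD.isUniversal y') ψ).hom =
      (bundleMap (hD.univBundle y) (hD.isUniversal y') ψ').hom := congrArg PrincipalBundle.Hom.hom h
    refine pull_map_injective _ (ofArrows_mem_of_localSections _
      (hD.univBundle y).bundle.localSections) ?_
    have e₂ := h₂.comp_pullHom
    rw [← pullHom_congr (hD.univBundle y').hom e _ _ h₁.comp_proj h₁.comp_anchor _ _,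
      ← h₁.comp_pullHom] at e₂
    exact ((cancel_mono _).1 e₂).symm

/-- The morphism that `φ` lies over is forced: the frame of the source followed by the inverse of
the pulled back frame of the target. It is constant along the fibres by `pullHom_eq_pullHom`, so it
descends. -/
instance : (hD.toBundle T).Full where
  map_surjective {y y'} (φ : (hD.univBundle y).bundle ⟶ (hD.univBundle y').bundle) := by
    have : IsIso (hD.univBundle y').hom := IsGroupoid.all_isIso _
    have hθ : IsOver (hD.univBundle y) (hD.univBundle y') ((hD.univBundle y).hom ≫
        inv (pullHom (hD.univBundle y').hom φ.hom _ _ (hom_comp_proj φ) (hom_comp_anchor φ)))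
        φ.hom :=
      ⟨hom_comp_proj φ, hom_comp_anchor φ, by rw [Category.assoc, IsIso.inv_hom_id,
        Category.comp_id]⟩
    obtain ⟨ψ, hψ⟩ := exists_pull_map_eq _ (ofArrows_mem_of_localSections _
      (hD.univBundle y).bundle.localSections) _ (fun k k' q h h' ↦
        pullHom_eq_pullHom _ _ φ _ hθ k k' q h h')
    exact ⟨ψ, hom_ext_total ((isOver_bundleMap _ (hD.isUniversal y') ψ).unique
      (hD.isUniversal y') (hθ.congr hψ.symm))⟩

include hD in
/-- Every principal bundle is framed by an object. -/
lemma exists_framing (Q : PrincipalBundle G T) :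
    ∃ (y : Y.fiber T) (P : D.FramedBundle y), P.bundle = Q := by
  -- The cocycle is `glue` at the arrow that takes `k` to `k'`. The object `y` that it defines
  -- becomes the pull-back of `D.obj` on the total space through `j`, which is the frame.
  obtain ⟨y, j, hj⟩ := exists_descent Q.proj
    (ofArrows_mem_of_localSections _ Q.localSections) Q.anchor D.obj
    (fun k k' h ↦ pullHom D.glue (Q.divMap k k' h) (k ≫ Q.anchor) (k' ≫ Q.anchor)
      (Q.divMap_src k k' h) (Q.divMap_tgt k k' h))
    (fun {S S'} l k k' h lk lk' hk hk' h' ↦ by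
      have e := Q.comp_divMap l k k' h lk lk' hk hk' h'
      rw [pullHom_pullHom]
      exact pullHom_congr D.glue e _ _ _ _ _ _)
    (fun k ↦ (pullHom_congr D.glue (Q.divMap_self k) _ _ _ _
      (by rw [← Q.divMap_self, divMap_src]) (by rw [← Q.divMap_self, divMap_tgt])).trans
        (hD.pullHom_one_glue _ _ _))
    (fun k k' k'' h h' ↦ (hD.glue_mul _ _ _ _ _ _ _ _ _).trans
      (pullHom_congr D.glue (Q.mulMap_divMap k k' k'' h h' _) _ _ _ _ _ _))
  refine ⟨y, ⟨Q, j.hom, fun {S} k l f g g' hk hk' hl hl' ↦ ?_⟩, rfl⟩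
  subst hk hk' hl'
  have h := Q.actMap_proj k l hl.symm
  -- The arrow from `k` to `k · l` is `l`, so the descent relation for this pair is the equivariance
  -- of the frame.
  have e := hj k (Q.actMap k l hl.symm) h.symm
  have e' := pullHom_congr D.glue (Q.divMap_eq k _ h.symm l hl.symm rfl) (k ≫ Q.anchor)
    (l ≫ G.tgt) (Q.divMap_src _ _ h.symm) ((Q.divMap_tgt _ _ h.symm).trans (Q.actMap_anchor _ _ _))
    hl rfl
  -- The anchor of `k · l` and the range of `l` are only propositionally equal, so the statement is
  -- generalised over this map.
  have aux : ∀ (g : S ⟶ G.Obj) (hg : Q.actMap k l hl.symm ≫ Q.anchor = g),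
      pullHom j.hom k (k ≫ Q.proj) (k ≫ Q.anchor) rfl rfl ≫
        pullHom D.glue (Q.divMap k (Q.actMap k l hl.symm) h.symm) (k ≫ Q.anchor) g
          (Q.divMap_src _ _ h.symm) ((Q.divMap_tgt _ _ h.symm).trans hg) =
      pullHom j.hom (Q.actMap k l hl.symm) (k ≫ Q.proj) g h hg := by
    rintro g rfl; exact e
  rw [← e']
  exact aux _ _

/-- The framing of `Q` need not be universal: it yields a morphism to the universal bundle of `y`,
and every morphism of principal bundles is invertible. -/
instance : (hD.toBundle T).EssSurj where
  mem_essImage Q := by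
    obtain ⟨y, P, rfl⟩ := hD.exists_framing Q
    have := isIso_of_hom (bundleMap P (hD.isUniversal y) (𝟙 y))
    exact ⟨y, ⟨(asIso (bundleMap P (hD.isUniversal y) (𝟙 y))).symm⟩⟩

instance : (hD.toBundle T).IsEquivalence where

instance (b : LocallyDiscrete TopCat.{u}ᵒᵖ) :
    ((hD.toClassifyingStack).app b).toFunctor.IsEquivalence :=
  inferInstanceAs (hD.toBundle b.as.unop).IsEquivalence

include hD in
-- Descent for bundles is transported from `Y` along the pointwise equivalence instead of being
-- proved by gluing spaces.
lemma isStackInGroupoids_classifyingStack : (classifyingStack G).IsStackInGroupoids where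
  isGroupoid _ := PrincipalBundle.isGroupoid
  isStack := StrongTrans.isStack_of_pointwise hD.toClassifyingStack _

end GroupoidMap.IsPresentation

end TopStack

/-! ### Comparison of the universal bundle of `D.obj` with the unit bundle. -/

namespace TopStack

open Pseudofunctor Pseudofunctor.LocallyDiscreteOpToCat

namespace GroupoidMap.IsPresentation

open Prestack FramedBundle PrincipalBundle

variable {G : TopGroupoid.{u}} {Y : Prestack.{u}} {D : GroupoidMap G Y}

/-- The unit bundle with its frame. -/
def unitBundle (hD : D.IsPresentation) : D.FramedBundle D.obj :=
  ⟨G.unitBundle, D.glue, fun k l f g g' hk hk' hl hl' ↦ hD.glue_mul k l f g g' hk hk' hl hl'⟩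

/-- Over `l`, `unitGlue` replaces `m` by `l⁻¹` followed by `m`; preceded by `l`, this is `m` again.
-/
lemma mulMap_unitGlue {P : PrincipalBundle G G.Arr} (φ : P ⟶ pullback G.src G.unitBundle)
    (h : P.proj ≫ G.tgt = ((φ ≫ G.unitGlue).hom ≫ pullbackSnd G.tgt G.unitBundle) ≫ G.src) :
    TopGroupoid.mulMap P.proj ((φ ≫ G.unitGlue).hom ≫ pullbackSnd G.tgt G.unitBundle) h =
      φ.hom ≫ pullbackSnd G.src G.unitBundle := by
  ext p
  have e : (φ.hom p).1.1 = P.proj p := φ.proj_hom p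
  exact (TopGroupoid.mul_congr e.symm rfl _).trans
    (TopGroupoid.mul_inv_cancel (φ.hom p).1.1 (φ.hom p).1.2 ((G.tgt_inv _).trans (φ.hom p).2)
      ((G.src_inv _).symm.trans (TopGroupoid.src_mul _ _ _).symm))

/-- By multiplicativity and `mulMap_unitGlue`, `glue` at the base arrow followed by `glue` at the
new point is `glue` at the old one. So composing a map with `unitGlue` inserts the pull-back of
`D.glue` into the morphism it lies over. -/
lemma isOver_unitGlue [∀ T, IsGroupoid (Y.fiber T)] (hD : D.IsPresentation)
    (P : D.FramedBundle ((Y.pull G.src).obj D.obj))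
    (φ : P.bundle ⟶ pullback G.src G.unitBundle)
    (h : IsOver P hD.unitBundle (Y.pullComp G.src P.bundle.proj _ rfl D.obj).inv
      (φ.hom ≫ pullbackSnd G.src G.unitBundle)) :
    IsOver P hD.unitBundle ((Y.pull P.bundle.proj).map D.glue ≫
      (Y.pullComp G.tgt P.bundle.proj _ rfl D.obj).inv)
      ((φ ≫ G.unitGlue).hom ≫ pullbackSnd G.tgt G.unitBundle) := by
  have h₁ : ((φ ≫ G.unitGlue).hom ≫ pullbackSnd G.tgt G.unitBundle) ≫ G.src =
      P.bundle.proj ≫ G.tgt := by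
    ext p
    exact ((φ ≫ G.unitGlue).hom p).2.symm.trans (congrArg G.tgt ((φ ≫ G.unitGlue).proj_hom p))
  have h₂ : ((φ ≫ G.unitGlue).hom ≫ pullbackSnd G.tgt G.unitBundle) ≫ G.tgt =
      P.bundle.anchor := by
    ext p
    exact (φ ≫ G.unitGlue).anchor_hom p
  refine ⟨h₁, h₂, ?_⟩
  have e := hD.glue_mul P.bundle.proj _ _ _ _ rfl rfl h₁ h₂
  have e' := e.trans (pullHom_congr D.glue (mulMap_unitGlue φ h₁.symm) _ _ _ _ h.comp_proj
    h.comp_anchor)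
  rw [pullHom_eq_pullComp D.glue P.bundle.proj, Category.assoc] at e'
  exact ((Iso.eq_inv_comp _).2 e').trans h.comp_pullHom

variable [∀ T, IsGroupoid (Y.fiber T)] (hD : D.IsPresentation)

/-- The comparison of the universal bundle of `D.obj` with the unit bundle. -/
noncomputable def toUnitBundle : (hD.toBundle G.Obj).obj D.obj ⟶ G.unitBundle :=
  bundleMap (hD.univBundle D.obj) (Q := hD.unitBundle) hD.isUniversal_unitFrame (𝟙 D.obj)

lemma isOver_toUnitBundle : IsOver (hD.univBundle D.obj) hD.unitBundle
    ((Y.pull (hD.univBundle D.obj).bundle.proj).map (𝟙 D.obj)) hD.toUnitBundle.hom :=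
  isOver_bundleMap _ _ _

lemma isOver_toBundlePullback_comp {S : TopCat.{u}} (f : S ⟶ G.Obj) :
    IsOver (hD.univBundle ((Y.pull f).obj D.obj)) hD.unitBundle
      (Y.pullComp f (hD.univBundle ((Y.pull f).obj D.obj)).bundle.proj _ rfl D.obj).inv
      (((hD.toBundlePullback f D.obj).hom ≫ (pullbackFunctor f).map hD.toUnitBundle).hom ≫
        pullbackSnd f G.unitBundle) := by
  have h := hD.isOver_toBundlePullback f D.obj
  refine (h.comp hD.isOver_toUnitBundle _ h.comp_proj).congr ?_
  rw [pullHom_map, CategoryTheory.Functor.map_id]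
  exact Category.comp_id _

/-- Both sides lie over the pull-back of `D.glue` followed by the comparison isomorphism of the
range map, the right one by `isOver_unitGlue`. They agree because the unit frame is universal. -/
lemma toBundle_map_glue_comp :
    (hD.toBundle G.Arr).map D.glue ≫ (hD.toBundlePullback G.tgt D.obj).hom ≫
      (pullbackFunctor G.tgt).map hD.toUnitBundle =
    ((hD.toBundlePullback G.src D.obj).hom ≫ (pullbackFunctor G.src).map hD.toUnitBundle) ≫
      G.unitGlue := by
  have h₁ := isOver_bundleMap (hD.univBundle ((Y.pull G.src).obj D.obj))
    (hD.isUniversal ((Y.pull G.tgt).obj D.obj)) D.glue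
  have h₂ := hD.isOver_toBundlePullback_comp G.tgt
  have h₃ := hD.isOver_unitGlue (hD.univBundle ((Y.pull G.src).obj D.obj)) _
    (hD.isOver_toBundlePullback_comp G.src)
  have e := (congrArg (· ≫ G.tgt) h₁.comp_proj).symm.trans (Category.assoc _ _ _)
  refine hom_ext_pullback (IsOver.unique (Q := hD.unitBundle) hD.isUniversal_unitFrame
    ((h₁.comp h₂ _ e.symm).congr ?_) h₃)
  exact congrArg (_ ≫ ·) (pullHom_pullComp_inv G.tgt _ _ _ _ _ rfl h₁.comp_proj rfl _ _)

variable [Y.IsStack TopCat.grothendieckTopology.{u}]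

/-- The equivalence of `Y` with the classifying stack. -/
noncomputable def equivalence : Y ≌ classifyingStack G :=
  StrongTrans.equivalenceOfPointwise hD.toClassifyingStack

lemma isIsomorphic_push : (D.push hD.equivalence.hom).IsIsomorphic G.unitMap := by
  refine ⟨@asIso _ _ _ _ hD.toUnitBundle (isIso_of_hom _), ?_⟩
  -- The pushed forward 2-morphism is the image of `D.glue` between the comparison isomorphisms of
  -- source and range.
  change ((hD.toBundlePullback G.src D.obj).inv ≫ (hD.toBundle G.Arr).map D.glue ≫
    (hD.toBundlePullback G.tgt D.obj).hom) ≫ (pullbackFunctor G.tgt).map hD.toUnitBundle =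
      (pullbackFunctor G.src).map hD.toUnitBundle ≫ G.unitGlue
  exact (Category.assoc _ _ _).trans ((Iso.inv_comp_eq _).2 ((Category.assoc _ _ _).trans
    (hD.toBundle_map_glue_comp.trans (Category.assoc _ _ _))))

end GroupoidMap.IsPresentation

end TopStack

/-! ### The loop groupoid of an atlas presents the loop stack. -/

namespace TopStack

open Pseudofunctor Pseudofunctor.LocallyDiscreteOpToCat

namespace Prestack

variable {X : Prestack.{u}}

/-- The universal point of a representable fibre product, as a frame. -/
def fiberProdFrame {T A P : TopCat.{u}} {x : X.fiber T} {a : X.fiber A}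
    (ρ : (X.fiberProd x a).RepresentableBy P) : Frame x a :=
  ⟨P, FiberProdPt.fst (ρ.homEquiv (𝟙 P)), FiberProdPt.snd (ρ.homEquiv (𝟙 P)),
    (FiberProdPt.iso (ρ.homEquiv (𝟙 P))).hom⟩

lemma FiberProdPt.pullHom_eq_of_restrict_eq {T A P S : TopCat.{u}} {x : X.fiber T} {a : X.fiber A}
    (p : FiberProdPt X x a P) (k : S ⟶ P) (q : FiberProdPt X x a S) (h : p.restrict k = q)
    (h₁ : k ≫ p.fst = q.fst) (h₂ : k ≫ p.snd = q.snd) :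
    pullHom p.iso.hom k q.fst q.snd h₁ h₂ = q.iso.hom := by
  subst h; rfl

lemma FiberProdPt.restrict_eq_of_pullHom_eq {T A P S : TopCat.{u}} {x : X.fiber T} {a : X.fiber A}
    (p : FiberProdPt X x a P) (k k' : S ⟶ P) (f : S ⟶ T) (g : S ⟶ A) (h : k ≫ p.fst = f)
    (h' : k ≫ p.snd = g) (l : k' ≫ p.fst = f) (l' : k' ≫ p.snd = g)
    (e : pullHom p.iso.hom k f g h h' = pullHom p.iso.hom k' f g l l') :
    p.restrict k = p.restrict k' := by
  subst l l'
  refine FiberProdPt.ext' h h' ?_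
  refine Eq.trans ?_ e
  refine (pullHom_pullHom p.iso.hom k (k ≫ p.fst) (k ≫ p.snd) (𝟙 S) (k' ≫ p.fst) (k' ≫ p.snd)
    rfl rfl (by simp [h]) (by simp [h'])).trans ?_
  exact pullHom_congr p.iso.hom (Category.id_comp k) _ _ _ _ _ _

/-- Morphisms of `X(S)` are invertible, so a frame is the same as a point of the fibre product. -/
lemma isUniversal_fiberProdFrame [∀ T, IsGroupoid (X.fiber T)] {T A P : TopCat.{u}}
    {x : X.fiber T} {a : X.fiber A} (ρ : (X.fiberProd x a).RepresentableBy P) :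
    (fiberProdFrame ρ).IsUniversal := by
  have hρ : ∀ {S : TopCat.{u}} (k : S ⟶ P), ρ.homEquiv k =
      FiberProdPt.restrict (ρ.homEquiv (𝟙 P)) k := fun k ↦
    (congrArg ρ.homEquiv (Category.comp_id _)).symm.trans (ρ.homEquiv_comp k (𝟙 P))
  refine ⟨fun {S} f g φ ↦ ?_, fun {S} k k' f g h h' l l' e ↦ ?_⟩
  · have : IsIso φ := IsGroupoid.all_isIso _
    let q : FiberProdPt X x a S := ⟨f, g, asIso φ⟩
    have h : FiberProdPt.restrict (ρ.homEquiv (𝟙 P)) (ρ.homEquiv.symm q) = q :=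
      (hρ _).symm.trans (ρ.homEquiv.apply_symm_apply q)
    exact ⟨ρ.homEquiv.symm q, congrArg FiberProdPt.fst h, congrArg FiberProdPt.snd h,
      FiberProdPt.pullHom_eq_of_restrict_eq _ _ q h _ _⟩
  · apply ρ.homEquiv.injective
    exact (hρ k).trans ((FiberProdPt.restrict_eq_of_pullHom_eq _ k k' f g h h' l l' e).trans
      (hρ k').symm)

variable {A : TopCat.{u}} {a : X.fiber A} {R : TopCat.{u}}
  (r : (X.fiberProd a a).RepresentableBy R)

lemma exists_arrow [∀ T, IsGroupoid (X.fiber T)] {S : TopCat.{u}} (f g : S ⟶ A)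
    (φ : (X.pull f).obj a ⟶ (X.pull g).obj a) :
    ∃ (n : S ⟶ R) (h : n ≫ (univPt r).fst = f) (h' : n ≫ (univPt r).snd = g),
      pullHom (univPt r).iso.hom n f g h h' = φ :=
  (isUniversal_fiberProdFrame r).exists_lift f g φ

lemma arrow_ext [∀ T, IsGroupoid (X.fiber T)] {S : TopCat.{u}} (k k' : S ⟶ R) (f g : S ⟶ A)
    (h : k ≫ (univPt r).fst = f) (h' : k ≫ (univPt r).snd = g) (l : k' ≫ (univPt r).fst = f)
    (l' : k' ≫ (univPt r).snd = g) (e : pullHom (univPt r).iso.hom k f g h h' =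
      pullHom (univPt r).iso.hom k' f g l l') : k = k' :=
  (isUniversal_fiberProdFrame r).hom_ext k k' f g h h' l l' e

/-- An arrow `(γ, μ)` acts through `μ` alone; the comparison isomorphisms account for `a` being
pulled back in two steps, through the space of loops. -/
lemma pullHom_loopGlueBase {S : TopCat.{u}} (k : S ⟶ (atlasGroupoid r).loop.Arr)
    (f g : S ⟶ (atlasGroupoid r).loop.Obj) (h : k ≫ (atlasGroupoid r).loop.src = f)
    (h' : k ≫ (atlasGroupoid r).loop.tgt = g)
    (l : (k ≫ loopArrow r) ≫ (univPt r).fst = f ≫ loopBase r)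
    (l' : (k ≫ loopArrow r) ≫ (univPt r).snd = g ≫ loopBase r) :
    pullHom (loopGlueBase r) k f g h h' =
      (X.pullComp (loopBase r) f _ rfl a).inv ≫
        pullHom (univPt r).iso.hom (k ≫ loopArrow r) _ _ l l' ≫
          (X.pullComp (loopBase r) g _ rfl a).hom := by
  have e₁ := pullHom_pullComp_inv (loopBase r) (atlasGroupoid r).loop.src k _ f _ rfl h rfl
    (by rw [← h, Category.assoc]) a
  have e₂ := pullHom_pullComp_hom (loopBase r) (atlasGroupoid r).loop.tgt k _ g _ rfl h' rfl
    (by rw [← h', Category.assoc]) a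
  have e₃ := pullHom_pullHom (univPt r).iso.hom (loopArrow r)
    ((atlasGroupoid r).loop.src ≫ loopBase r) ((atlasGroupoid r).loop.tgt ≫ loopBase r) k
    (f ≫ loopBase r) (g ≫ loopBase r) (loopArrow_src r) (loopArrow_tgt r)
    (by rw [← h, Category.assoc]) (by rw [← h', Category.assoc])
  rw [← e₁, ← e₂]
  refine Eq.trans ?_ (congrArg (fun t ↦ _ ≫ t ≫ _) e₃)
  rw [Prestack.pullHom_comp, Prestack.pullHom_comp]
  rfl

/-- The tautological automorphism of the pull-back of the atlas to the space of loops. -/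
def loopAut : (X.pull (loopBase r)).obj a ⟶ (X.pull (loopBase r)).obj a :=
  pullHom (univPt r).iso.hom (loopIncl r) (loopBase r) (loopBase r) rfl (loopIncl_tgt r)

lemma pull_map_loopAut {S : TopCat.{u}} (f : S ⟶ (atlasGroupoid r).loop.Obj)
    (fb : S ⟶ A) (h : f ≫ loopBase r = fb) (h₁ : (f ≫ loopIncl r) ≫ (univPt r).fst = fb)
    (h₂ : (f ≫ loopIncl r) ≫ (univPt r).snd = fb) :
    (X.pull f).map (loopAut r) =
      (X.pullComp (loopBase r) f fb h a).inv ≫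
        pullHom (univPt r).iso.hom (f ≫ loopIncl r) _ _ h₁ h₂ ≫
          (X.pullComp (loopBase r) f fb h a).hom := by
  have e₁ := map_eq_pullHom (F := X) (loopAut r) f fb fb h h
  have e₂ := pullHom_pullHom (univPt r).iso.hom (loopIncl r) (loopBase r) (loopBase r) f fb fb
    rfl (loopIncl_tgt r) h h
  rw [← e₂]
  exact e₁

lemma loopIncl_fst {S : TopCat.{u}} (f : S ⟶ (atlasGroupoid r).loop.Obj) :
    (f ≫ loopIncl r) ≫ (univPt r).fst = f ≫ loopBase r := rfl

lemma loopIncl_snd {S : TopCat.{u}} (f : S ⟶ (atlasGroupoid r).loop.Obj) :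
    (f ≫ loopIncl r) ≫ (univPt r).snd = f ≫ loopBase r :=
  congrArg (f ≫ ·) (loopIncl_tgt r)

lemma loopArrow_fst {S : TopCat.{u}} (k : S ⟶ (atlasGroupoid r).loop.Arr)
    {f : S ⟶ (atlasGroupoid r).loop.Obj} (h : k ≫ (atlasGroupoid r).loop.src = f) :
    (k ≫ loopArrow r) ≫ (univPt r).fst = f ≫ loopBase r := by
  subst h
  exact congrArg (k ≫ ·) (loopArrow_src r)

lemma loopArrow_snd {S : TopCat.{u}} (k : S ⟶ (atlasGroupoid r).loop.Arr)
    {g : S ⟶ (atlasGroupoid r).loop.Obj} (h : k ≫ (atlasGroupoid r).loop.tgt = g) :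
    (k ≫ loopArrow r) ≫ (univPt r).snd = g ≫ loopBase r := by
  subst h
  exact congrArg (k ≫ ·) (loopArrow_tgt r)

lemma pullHom_loopGlueBase_mul {S : TopCat.{u}} (k l : S ⟶ (atlasGroupoid r).loop.Arr)
    (f g g' : S ⟶ (atlasGroupoid r).loop.Obj) (hk : k ≫ (atlasGroupoid r).loop.src = f)
    (hk' : k ≫ (atlasGroupoid r).loop.tgt = g) (hl : l ≫ (atlasGroupoid r).loop.src = g)
    (hl' : l ≫ (atlasGroupoid r).loop.tgt = g') :
    pullHom (loopGlueBase r) k f g hk hk' ≫ pullHom (loopGlueBase r) l g g' hl hl' =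
      pullHom (loopGlueBase r) (TopGroupoid.mulMap k l (hk'.trans hl.symm)) f g'
        ((TopGroupoid.mulMap_src _ _ _).trans hk) ((TopGroupoid.mulMap_tgt _ _ _).trans hl') := by
  have hm := (TopGroupoid.mulMap_src k l (hk'.trans hl.symm)).trans hk
  have hm' := (TopGroupoid.mulMap_tgt k l (hk'.trans hl.symm)).trans hl'
  have e := pullHom_mul r (k ≫ loopArrow r) (l ≫ loopArrow r) (loopArrow_fst r k hk)
    (loopArrow_snd r k hk') (loopArrow_fst r l hl) (loopArrow_snd r l hl')
    (TopGroupoid.mulMap k l (hk'.trans hl.symm) ≫ loopArrow r)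
    (loopArrow_fst r _ hm) (loopArrow_snd r _ hm') (fun _ ↦ rfl)
  rw [pullHom_loopGlueBase r k f g hk hk' (loopArrow_fst r k hk) (loopArrow_snd r k hk'),
    pullHom_loopGlueBase r l g g' hl hl' (loopArrow_fst r l hl) (loopArrow_snd r l hl'),
    pullHom_loopGlueBase r _ f g' hm hm' (loopArrow_fst r _ hm) (loopArrow_snd r _ hm'), ← e]
  simp only [Category.assoc, Iso.hom_inv_id_assoc]

lemma loopGlue_mul {S : TopCat.{u}} (k l : S ⟶ (atlasGroupoid r).loop.Arr)
    (f g g' : S ⟶ (atlasGroupoid r).loop.Obj) (hk : k ≫ (atlasGroupoid r).loop.src = f)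
    (hk' : k ≫ (atlasGroupoid r).loop.tgt = g) (hl : l ≫ (atlasGroupoid r).loop.src = g)
    (hl' : l ≫ (atlasGroupoid r).loop.tgt = g') :
    pullHom (loopGlue r) k f g hk hk' ≫ pullHom (loopGlue r) l g g' hl hl' =
      pullHom (loopGlue r) (TopGroupoid.mulMap k l (hk'.trans hl.symm)) f g'
        ((TopGroupoid.mulMap_src _ _ _).trans hk) ((TopGroupoid.mulMap_tgt _ _ _).trans hl') :=
  LoopObj.hom_ext ((congrArg₂ (· ≫ ·) (pullHom_loopStack_hom (loopGlue r) k f g hk hk')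
    (pullHom_loopStack_hom (loopGlue r) l g g' hl hl')).trans
    ((pullHom_loopGlueBase_mul r k l f g g' hk hk' hl hl').trans
      (pullHom_loopStack_hom (loopGlue r) _ f g' _ _).symm))

variable [∀ T, IsGroupoid (X.fiber T)]

/-- `φ` is classified by a family `n` of arrows of the atlas groupoid. Compatibility with the
automorphisms reads `n · g = f · n` in diagrammatic order, which forces `g` to be the conjugate of
`f` by `n`; so `(f, n)` is a family of arrows of the loop groupoid. -/
lemma exists_loopGlueBase {S : TopCat.{u}} (f g : S ⟶ (atlasGroupoid r).loop.Obj)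
    (φ : (X.pull f).obj ((X.pull (loopBase r)).obj a) ⟶
      (X.pull g).obj ((X.pull (loopBase r)).obj a))
    (c : (X.pull f).map (loopAut r) ≫ φ = φ ≫ (X.pull g).map (loopAut r)) :
    ∃ (k : S ⟶ (atlasGroupoid r).loop.Arr) (h : k ≫ (atlasGroupoid r).loop.src = f)
      (h' : k ≫ (atlasGroupoid r).loop.tgt = g), pullHom (loopGlueBase r) k f g h h' = φ := by
  obtain ⟨n, hn, hn', e⟩ := exists_arrow r (f ≫ loopBase r) (g ≫ loopBase r)
    ((X.pullComp (loopBase r) f _ rfl a).hom ≫ φ ≫ (X.pullComp (loopBase r) g _ rfl a).inv)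
  let k : S ⟶ (atlasGroupoid r).loop.Arr := TopCat.ofHom ⟨fun s ↦ ⟨(f s, n s),
    (apply_eq_of_comp_eq hn s).symm⟩, (f.hom.continuous.prodMk n.hom.continuous).subtype_mk _⟩
  have hc₁ : n ≫ (univPt r).snd = (g ≫ loopIncl r) ≫ (univPt r).fst := hn'
  have hc₂ : (f ≫ loopIncl r) ≫ (univPt r).snd = n ≫ (univPt r).fst :=
    (loopIncl_snd r f).trans hn.symm
  let m₁ : S ⟶ R := TopGroupoid.mulMap (G := atlasGroupoid r) n (g ≫ loopIncl r) hc₁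
  let m₂ : S ⟶ R := TopGroupoid.mulMap (G := atlasGroupoid r) (f ≫ loopIncl r) n hc₂
  have hm₁ : m₁ ≫ (univPt r).fst = f ≫ loopBase r :=
    (TopGroupoid.mulMap_src (G := atlasGroupoid r) _ _ hc₁).trans hn
  have hm₁' : m₁ ≫ (univPt r).snd = g ≫ loopBase r :=
    (TopGroupoid.mulMap_tgt (G := atlasGroupoid r) _ _ hc₁).trans (loopIncl_snd r g)
  have hm₂ : m₂ ≫ (univPt r).fst = f ≫ loopBase r :=
    TopGroupoid.mulMap_src (G := atlasGroupoid r) _ _ hc₂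
  have hm₂' : m₂ ≫ (univPt r).snd = g ≫ loopBase r :=
    (TopGroupoid.mulMap_tgt (G := atlasGroupoid r) _ _ hc₂).trans hn'
  -- The two products classify the two composites of `φ` with the tautological automorphisms, equal
  -- by `c`.
  have hm : m₁ = m₂ := by
    refine arrow_ext r m₁ m₂ _ _ hm₁ hm₁' hm₂ hm₂' ?_
    rw [← pullHom_mul r n (g ≫ loopIncl r) hn hn' (loopIncl_fst r g) (loopIncl_snd r g) m₁ hm₁ hm₁'
      (fun _ ↦ rfl), ← pullHom_mul r (f ≫ loopIncl r) n (loopIncl_fst r f) (loopIncl_snd r f) hn hn'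
      m₂ hm₂ hm₂' (fun _ ↦ rfl), e]
    rw [pull_map_loopAut r f _ rfl (loopIncl_fst r f) (loopIncl_snd r f),
      pull_map_loopAut r g _ rfl (loopIncl_fst r g) (loopIncl_snd r g)] at c
    rw [← cancel_epi (X.pullComp (loopBase r) f _ rfl a).inv,
      ← cancel_mono (X.pullComp (loopBase r) g _ rfl a).hom]
    simp only [Category.assoc, Iso.inv_hom_id_assoc, Iso.inv_hom_id, Category.comp_id] at c ⊢
    exact c.symm
  have h' : k ≫ (atlasGroupoid r).loop.tgt = g := by
    ext s
    refine Subtype.ext (TopGroupoid.eq_conj (G := atlasGroupoid r) (f s).1 (n s) (g s).1 (f s).2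
      (apply_eq_of_comp_eq hn s).symm (apply_eq_of_comp_eq hc₁ s) (apply_eq_of_comp_eq hc₂ s)
      (congrArg (fun m : S ⟶ R ↦ m s) hm)).symm
  refine ⟨k, rfl, h', (pullHom_loopGlueBase r k f g rfl h' hn hn').trans ?_⟩
  refine (congrArg (fun t ↦ _ ≫ t ≫ _) e).trans ?_
  simp only [Category.assoc, Iso.inv_hom_id_assoc, Iso.inv_hom_id, Category.comp_id]

lemma loopArrow_ext {S : TopCat.{u}} (k k' : S ⟶ (atlasGroupoid r).loop.Arr)
    (f g : S ⟶ (atlasGroupoid r).loop.Obj) (h : k ≫ (atlasGroupoid r).loop.src = f)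
    (h' : k ≫ (atlasGroupoid r).loop.tgt = g) (l : k' ≫ (atlasGroupoid r).loop.src = f)
    (l' : k' ≫ (atlasGroupoid r).loop.tgt = g)
    (e : pullHom (loopGlueBase r) k f g h h' = pullHom (loopGlueBase r) k' f g l l') : k = k' := by
  rw [pullHom_loopGlueBase r k f g h h' (loopArrow_fst r k h) (loopArrow_snd r k h'),
    pullHom_loopGlueBase r k' f g l l' (loopArrow_fst r k' l) (loopArrow_snd r k' l'),
    cancel_epi, cancel_mono] at e
  have e' := arrow_ext r _ _ _ _ _ _ _ _ e
  ext s
  exact Subtype.ext (Prod.ext (apply_eq_of_comp_eq (h.trans l.symm) s)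
    (congrArg (fun m : S ⟶ R ↦ m s) e'))

lemma isUniversal_unitFrame_loopMap : (loopMap r).unitFrame.IsUniversal where
  exists_lift f g φ := by
    obtain ⟨k, h, h', e⟩ := exists_loopGlueBase r f g (LoopObj.Hom.hom φ) (LoopObj.Hom.comm φ)
    exact ⟨k, h, h', LoopObj.hom_ext ((pullHom_loopStack_hom (loopGlue r) k f g h h').trans e)⟩
  hom_ext k k' f g h h' l l' e := loopArrow_ext r k k' f g h h' l l'
    ((pullHom_loopStack_hom (loopGlue r) k f g h h').symm.trans
      ((congrArg LoopObj.Hom.hom e).trans (pullHom_loopStack_hom (loopGlue r) k' f g l l')))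

section

variable {T : TopCat.{u}} {y : X.fiber T} (α : y ≅ y) (E : Frame y a)

/-- An automorphism of an object induces a map from a frame to the space of loops. -/
lemma exists_loopAnchor : ∃ (w : E.total ⟶ (atlasGroupoid r).loop.Obj)
    (h : w ≫ loopBase r = E.anchor),
    E.hom ≫ pullHom (univPt r).iso.hom (w ≫ loopIncl r) _ _
      ((loopIncl_fst r w).trans h) ((loopIncl_snd r w).trans h) =
    (X.pull E.proj).map α.hom ≫ E.hom := by
  have : IsIso E.hom := IsGroupoid.all_isIso _
  -- The frame carries `α` to an automorphism of the pull-back of `a`; the arrow classifying it has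
  -- equal source and range, hence is a loop.
  obtain ⟨n, h, h', e⟩ := exists_arrow r _ _ (inv E.hom ≫
    (X.pull E.proj).map α.hom ≫ E.hom)
  refine ⟨TopCat.ofHom ⟨fun p ↦ ⟨n p, apply_eq_of_comp_eq (h.trans h'.symm) p⟩,
    n.hom.continuous.subtype_mk _⟩, h, ?_⟩
  refine (congrArg (_ ≫ ·) e).trans ?_
  rw [IsIso.hom_inv_id_assoc]

variable {E} {w : E.total ⟶ (atlasGroupoid r).loop.Obj} (hw : w ≫ loopBase r = E.anchor)

/-- The morphism underlying `loopFrame`. -/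
def loopFrameHom : (X.pull E.proj).obj y ⟶
    (X.pull w).obj ((X.pull (loopBase r)).obj a) :=
  E.hom ≫ (X.pullComp (loopBase r) w _ hw a).hom

omit [∀ T, IsGroupoid (X.fiber T)] in
lemma pullHom_loopFrameHom {S : TopCat.{u}} (k : S ⟶ E.total) (f : S ⟶ T)
    (g : S ⟶ (atlasGroupoid r).loop.Obj) (h : k ≫ E.proj = f)
    (h' : k ≫ w = g) (h'' : k ≫ E.anchor = g ≫ loopBase r) :
    pullHom (loopFrameHom r hw) k f g h h' =
      pullHom E.hom k f (g ≫ loopBase r) h h'' ≫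
        (X.pullComp (loopBase r) g _ rfl a).hom := by
  have e := pullHom_pullComp_hom (loopBase r) w k _ g _ hw h' rfl h'' a
  rw [← e, Prestack.pullHom_comp]
  rfl

variable (hα : E.hom ≫ pullHom (univPt r).iso.hom (w ≫ loopIncl r) _ _
      ((loopIncl_fst r w).trans hw) ((loopIncl_snd r w).trans hw) =
    (X.pull E.proj).map α.hom ≫ E.hom)

include hα

omit [∀ T, IsGroupoid (X.fiber T)] in
lemma map_comp_loopFrameHom : (X.pull E.proj).map α.hom ≫ loopFrameHom r hw =
    loopFrameHom r hw ≫ (X.pull w).map (loopAut r) := by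
  rw [pull_map_loopAut r w _ hw ((loopIncl_fst r _).trans hw) ((loopIncl_snd r _).trans hw),
    loopFrameHom, Category.assoc, Iso.hom_inv_id_assoc, ← Category.assoc, ← hα, Category.assoc]

/-- The frame of an object of the loop stack given by a frame of the underlying object. -/
def loopFrame : Frame (Y := loopStack X) (T := T) (LoopObj.mk y α) (loopAtlas r) where
  total := E.total
  proj := E.proj
  anchor := w
  hom := LoopObj.Hom.mk (loopFrameHom r hw) (map_comp_loopFrameHom r α hw hα)

/-- Universality of `E` provides `k`. That it has the right loop, `k ≫ w = g`, is forced: both loops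
classify the automorphism to which the frame carries `α`, the first by the choice of `w`, the second
by the compatibility `c`. -/
lemma exists_lift_loopFrameHom (hE : E.IsUniversal) {S : TopCat.{u}} (f : S ⟶ T)
    (g : S ⟶ (atlasGroupoid r).loop.Obj)
    (φ : (X.pull f).obj y ⟶ (X.pull g).obj ((X.pull (loopBase r)).obj a))
    (c : (X.pull f).map α.hom ≫ φ = φ ≫ (X.pull g).map (loopAut r)) :
    ∃ (k : S ⟶ E.total) (h : k ≫ E.proj = f) (h' : k ≫ w = g),
      pullHom (loopFrameHom r hw) k f g h h' = φ := by
  have : IsIso E.hom := IsGroupoid.all_isIso _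
  obtain ⟨k, h, h'', e⟩ :=
    hE.exists_lift f (g ≫ loopBase r) (φ ≫ (X.pullComp (loopBase r) g _ rfl a).inv)
  have hkw : (k ≫ w) ≫ loopBase r = g ≫ loopBase r := by rw [Category.assoc, hw, h'']
  have h₁ : k ≫ w ≫ loopIncl r = g ≫ loopIncl r := by
    refine arrow_ext r _ _ (g ≫ loopBase r) (g ≫ loopBase r) ((loopIncl_fst r (k ≫ w)).trans hkw)
      ((loopIncl_snd r (k ≫ w)).trans hkw) (loopIncl_fst r g) (loopIncl_snd r g) ?_
    have e₁ := congrArg (fun t ↦ pullHom t k f (g ≫ loopBase r) h h'') hα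
    have e₂ := pullHom_pullHom (univPt r).iso.hom (w ≫ loopIncl r) _ _ k
      (g ≫ loopBase r) (g ≫ loopBase r) ((loopIncl_fst r _).trans hw)
      ((loopIncl_snd r _).trans hw) h'' h''
    have e₃ := Prestack.pullHom_comp E.hom
      (pullHom (univPt r).iso.hom (w ≫ loopIncl r) _ _
        ((loopIncl_fst r _).trans hw) ((loopIncl_snd r _).trans hw)) k f (g ≫ loopBase r)
        (g ≫ loopBase r) h h'' h''
    have e₄ := Prestack.pullHom_comp ((X.pull E.proj).map α.hom)
      E.hom k f f (g ≫ loopBase r) h h h''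
    have e₅ := (congrArg (_ ≫ ·) e₂).symm.trans (e₃.trans (e₁.trans e₄.symm))
    rw [pullHom_map] at e₅
    rw [pull_map_loopAut r g _ rfl (loopIncl_fst r g) (loopIncl_snd r g)] at c
    rw [← cancel_epi (pullHom E.hom k f (g ≫ loopBase r) h h'')]
    refine e₅.trans ?_
    rw [e, ← cancel_mono (X.pullComp (loopBase r) g _ rfl a).hom]
    simp only [Category.assoc, Iso.inv_hom_id, Category.comp_id]
    exact c
  have h' : k ≫ w = g := by
    ext s
    exact Subtype.ext (congrArg (fun m : S ⟶ R ↦ m s) h₁)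
  refine ⟨k, h, h', (pullHom_loopFrameHom r hw k f g h h' h'').trans ?_⟩
  rw [e, Category.assoc, Iso.inv_hom_id, Category.comp_id]

omit [∀ T, IsGroupoid (X.fiber T)] hα in
lemma hom_ext_loopFrameHom (hE : E.IsUniversal) {S : TopCat.{u}} (k k' : S ⟶ E.total) (f : S ⟶ T)
    (g : S ⟶ (atlasGroupoid r).loop.Obj) (h : k ≫ E.proj = f) (h' : k ≫ w = g)
    (l : k' ≫ E.proj = f) (l' : k' ≫ w = g)
    (e : pullHom (loopFrameHom r hw) k f g h h' = pullHom (loopFrameHom r hw) k' f g l l') :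
    k = k' := by
  have hk : ∀ k : S ⟶ E.total, k ≫ w = g → k ≫ E.anchor = g ≫ loopBase r := by
    rintro k rfl
    rw [Category.assoc, hw]
  rw [pullHom_loopFrameHom r hw k f g h h' (hk k h'),
    pullHom_loopFrameHom r hw k' f g l l' (hk k' l'), cancel_mono] at e
  exact hE.hom_ext k k' f _ h (hk k h') l (hk k' l') e

/-- This identifies `T ×_{LX} W` with `T ×_X A`: an isomorphism `y_t ≅ a_x` leaves no choice for the
loop at `x`, which is the transport of `α`. -/
lemma isUniversal_loopFrame (hE : E.IsUniversal) : (loopFrame r α hw hα).IsUniversal where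
  exists_lift f g φ := by
    obtain ⟨k, h, h', e⟩ := exists_lift_loopFrameHom r α hw hα hE f g (LoopObj.Hom.hom φ)
      (LoopObj.Hom.comm φ)
    exact ⟨k, h, h', LoopObj.hom_ext
      ((pullHom_loopStack_hom (loopFrame r α hw hα).hom k f g h h').trans e)⟩
  hom_ext k k' f g h h' l l' e := hom_ext_loopFrameHom r hw hE k k' f g h h' l l'
    ((pullHom_loopStack_hom (loopFrame r α hw hα).hom k f g h h').symm.trans
      ((congrArg LoopObj.Hom.hom e).trans
        (pullHom_loopStack_hom (loopFrame r α hw hα).hom k' f g l l')))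

end

/-- The frame of a loop has the total space and the projection of the fibre product with the atlas,
so representability and local sections are inherited from `a`. -/
lemma isPresentation_loopMap (ha : IsAtlas a) : (loopMap r).IsPresentation where
  glue_mul k l f g g' hk hk' hl hl' := loopGlue_mul r k l f g g' hk hk' hl hl'
  isUniversal_unitFrame := isUniversal_unitFrame_loopMap r
  exists_frame {T} y := by
    obtain ⟨P, ⟨ρ⟩⟩ := ha.representable T (LoopObj.base y)
    obtain ⟨w, hw, hα⟩ := exists_loopAnchor r (LoopObj.aut y) (fiberProdFrame ρ)
    exact ⟨loopFrame r (LoopObj.aut y) hw hα, isUniversal_loopFrame r (LoopObj.aut y) hw hα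
      (isUniversal_fiberProdFrame ρ),
      ha.localSections T (LoopObj.base y) P ρ⟩

end Prestack

end TopStack

theorem mainTheorem9 (X : TopStack.Prestack.{u}) (hX : X.IsStackInGroupoids)
    {A : TopCat.{u}} (a : X.fiber A) (ha : TopStack.Prestack.IsAtlas a)
    {R : TopCat.{u}} (r : (X.fiberProd a a).RepresentableBy R) :
    (TopStack.loopStack X).IsStackInGroupoids ∧
    (TopStack.classifyingStack (TopStack.Prestack.atlasGroupoid r).loop).IsStackInGroupoids ∧
    ∃ e : TopStack.loopStack X ≌
        TopStack.classifyingStack (TopStack.Prestack.atlasGroupoid r).loop,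
      ((TopStack.Prestack.loopMap r).push e.hom).IsIsomorphic
        (TopStack.Prestack.atlasGroupoid r).loop.unitMap := by
  have hL := TopStack.Prestack.isStackInGroupoids_loopStack hX
  have := hX.isGroupoid
  have := hL.isGroupoid
  have := hL.isStack
  have hD := TopStack.Prestack.isPresentation_loopMap r ha
  exact ⟨hL, hD.isStackInGroupoids_classifyingStack, hD.equivalence, hD.isIsomorphic_push⟩
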